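/- **Theorem 3.1 (Stability estimate).** Let $N\in\mathbb N$, $\mathcal N=\{1,\dots,N\}$, $T>0$, $Q_T=(0,T)\times\mathbb R$. Consider the system of nonlocal balance laws with memory $$\partial_t U^k+\partial_x\big(f^k(U^k)\,\nu^k((\Theta\circledast U)^k)\big)=R^k\big(U,(\Upsilon\circledast U)^k\big)\ \text{ in } Q_T,\qquad U^k(0,\cdot)=U^k_0,\qquad k\in\mathcal N,$$ where $\Theta^{j,k}(t,x)=\mu^{j,k}(x)\Gamma^{j,k}(t)$, $\Upsilon^{j,k}(t,x)=\eta^{j,k}(x)\theta^{j,k}(t)$ and, for $Z=\Theta,\Upsilon$, $$(Z\circledast U)^k(t,x)=\Big(\int_0^t\!\int_{\mathbb R}U^j(\tau,\xi)\,Z^{j,k}(t-\tau,x-\xi)\,d\xi\,d\tau\Big)_{j\in\mathcal N}.$$ Assume for all $j,k\in\mathcal N$: (H1) $f^k\in \mathrm{Lip}(\mathbb R)$, $f^k(0)=0=f^k(1)$; (H2) $\nu^k\in C^2\cap W^{2,\infty}(\mathbb R^N)$ has finite total variation, i.e. $\nabla\nu^k\in L^1$; (H3) $\mu^{j,k},\eta^{j,k}\in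 C^1(\mathbb R)\cap W^{1,\infty}(\mathbb R)$, $\eta^{j,k}\in L^1(\mathbb R)$, and $\Gamma^{j,k},\theta^{j,k}\in L^\infty([0,\infty))$ are non-negative; (H4) $R^k\in \mathrm{Lip}(\mathbb R^{2N})$, $R^k(0,0)=0$. Given $U_0\in L^1(\mathbb R)^N$, an *entropy solution* is a $U$ with $U^k\in C([0,T];L^1(\mathbb R;[0,1]))\cap L^\infty([0,T];BV(\mathbb R))$ for every $k$ such that for every $k\in\mathcal N$, $\alpha\in\mathbb R$ and non-negative $\phi\in C_c^\infty([0,T)\times\mathbb R)$, $$\int_{Q_T}|U^k-\alpha|\phi_t+\int_{\mathbb R}|U^k_0-\alpha|\phi(0,x)\,dx+\int_{Q_T}\mathrm{sgn}(U^k-\alpha)\,\nu^k((\Theta\circledast U)^k)\,(f^k(U^k)-f^k(\alpha))\,\phi_x$$ $$-\int_{Q_T}f^k(\alpha)\,\mathrm{sgn}(U^k-\alpha)\,\partial_x\big[\nu^k((\Theta\circledast U)^k)\big]\phi+\int_{Q_T}\mathrm{sgn}(U^k-\alpha)\,R^k(U,(\Upsilon\circledast U)^k)\,\phi\ \ge 0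 .$$ Let $(f,\nu,\mu,\Gamma,\eta,\theta,R)$ and $(\bar f,\bar\nu,\bar\mu,\bar\Gamma,\bar\eta,\bar\theta,\bar R)$ both satisfy (H1)–(H4), let $U_0,V_0\in L^1(\mathbb R)^N$, and let $U$, $V$ be entropy solutions of the corresponding initial value problems with data $U_0$, $V_0$. Then for every $t\in[0,T]$ $$\begin{aligned}\|U(t)-V(t)\|_{L^1}\le\Big(&\|U_0-V_0\|_{L^1}+C_1|\bar f-f|_{\mathrm{Lip}(\mathbb R)}+C_2\|\bar\nu-\nu\|_{L^\infty}+C_3\|\nabla\bar\nu-\nabla\nu\|_{L^\infty}+C_4\|\bar\Gamma-\Gamma\|_{L^\infty(\mathbb R^+)}\\&+C_5\|\bar\mu-\mu\|_{W^{1,\infty}}+C_6\|\bar\eta-\eta\|_{L^1(\mathbb R)}+C_7\|\bar\theta-\theta\|_{L^1(\mathbb R^+)}+C_8|R-\bar R|_{\mathrm{Lip}(\mathbb R^{2N})}\Big)e^{C_9t}.\end{aligned}$$ Here $L^1$ norms of vectors and matrices are sums, and the other norms are maxima, over the components; $\mathbb R^{2N}$ carries the $1$-norm; the right-hand side is $+\infty$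 if $\bar\theta-\theta\notin L^1(\mathbb R^+)$. The finite constants $C_1,\dots,C_9\ge0$ depend only on $N$, $T$ and a common upper bound for $|f|_{\mathrm{Lip}}$, $\|\nu\|_{W^{2,\infty}}$, $\|\mu\|_{W^{1,\infty}}$, $\|\Gamma\|_{L^\infty}$, $\|\eta\|_{L^1}$, $\|\theta\|_{L^\infty}$, $|R|_{\mathrm{Lip}}$, the same norms of the barred functions, $\|U\|_{L^1(Q_T)}$, $\|V\|_{L^1(Q_T)}$ and $\max_k\sup_{t\in[0,T]}TV(U^k(t,\cdot))$. Consequently, entropy solutions are unique: two entropy solutions $U,V$ of the same problem with the same initial data satisfy $U(t,\cdot)=V(t,\cdot)$ a.e. for every $t\in[0,T]$. -/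

import Mathlib

open MeasureTheory Set Filter Topology
open scoped ENNReal NNReal ContDiff

noncomputable section

namespace NonlocalMemory

/-! ### Norms and seminorms, with values in `[0, ∞]` -/

/-- The Lipschitz seminorm of a function on `ℝ` (here `0 / 0 = 0`). -/
def lipR (g : ℝ → ℝ) : ℝ≥0∞ :=
  ⨆ (x : ℝ) (y : ℝ), ENNReal.ofReal |g x - g y| / ENNReal.ofReal |x - y|

/-- The `1`-norm on `ℝ^N`. -/
def norm1 {N : ℕ} (a : Fin N → ℝ) : ℝ := ∑ j, |a j|

/-- The Lipschitz seminorm of a function on `ℝ^{2N} = ℝ^N × ℝ^N`, with respect to the `1`-norm. -/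
def lipSource {N : ℕ} (G : (Fin N → ℝ) → (Fin N → ℝ) → ℝ) : ℝ≥0∞ :=
  ⨆ (a : Fin N → ℝ) (b : Fin N → ℝ) (a' : Fin N → ℝ) (b' : Fin N → ℝ),
    ENNReal.ofReal |G a b - G a' b'| / ENNReal.ofReal (norm1 (a - a') + norm1 (b - b'))

/-- The `j`-th partial derivative of a function on `ℝ^N`. -/
def partialD {N : ℕ} (j : Fin N) (g : (Fin N → ℝ) → ℝ) (w : Fin N → ℝ) : ℝ :=
  fderiv ℝ g w (Pi.single j 1)

/-- The essential supremum norm with respect to Lebesgue measure. -/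
def supNorm {E : Type*} [MeasureSpace E] (g : E → ℝ) : ℝ≥0∞ := eLpNorm g (⊤ : ℝ≥0∞) volume

/-- The `L^1` norm with respect to Lebesgue measure. -/
def oneNorm {E : Type*} [MeasureSpace E] (g : E → ℝ) : ℝ≥0∞ := eLpNorm g 1 volume

/-- The `W^{1,∞}(ℝ)` norm of a `C^1` function. -/
def sobolevNorm (g : ℝ → ℝ) : ℝ≥0∞ := supNorm g + supNorm (deriv g)

/-- Lebesgue measure on the time half-line `[0, ∞)`. -/
def halfLine : Measure ℝ := volume.restrict (Ici 0)

/-- The total variation of (the distributional derivative of) `u` on `ℝ`. -/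
def totalVar (u : ℝ → ℝ) : ℝ≥0∞ :=
  ⨆ (φ : ℝ → ℝ) (_ : ContDiff ℝ 1 φ) (_ : HasCompactSupport φ) (_ : ∀ x, |φ x| ≤ 1),
    ENNReal.ofReal (∫ x, u x * deriv φ x)

/-- The space-time strip `Q_T = (0, T) × ℝ`; points are `(t, x)`. -/
def QT (T : ℝ) : Set (ℝ × ℝ) := Ioo 0 T ×ˢ univ

/-- `∑_k ‖U^k‖_{L^1(Q_T)}`; a vector-valued function of time and space is written `U k t x`. -/
def spaceTimeNorm {N : ℕ} (T : ℝ) (U : Fin N → ℝ → ℝ → ℝ) : ℝ≥0∞ :=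
  ∑ k, eLpNorm (fun p : ℝ × ℝ => U k p.1 p.2) 1 (volume.restrict (QT T))

/-- `max_k sup_{t ∈ [0,T]} TV(U^k(t, ·))`. -/
def supTV {N : ℕ} (T : ℝ) (U : Fin N → ℝ → ℝ → ℝ) : ℝ≥0∞ :=
  ⨆ (k : Fin N) (t ∈ Icc (0 : ℝ) T), totalVar (U k t)

/-! ### The system -/

/-- The coefficient functions of a system of `N` nonlocal balance laws with memory: fluxes `f^k`,
velocities `ν^k`, spatial kernels `μ^{j,k}`, `η^{j,k}`, temporal kernels `Γ^{j,k}`, `θ^{j,k}` and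
sources `R^k`. -/
structure SystemData (N : ℕ) where
  f : Fin N → ℝ → ℝ
  ν : Fin N → (Fin N → ℝ) → ℝ
  μ : Fin N → Fin N → ℝ → ℝ
  Γ : Fin N → Fin N → ℝ → ℝ
  η : Fin N → Fin N → ℝ → ℝ
  θ : Fin N → Fin N → ℝ → ℝ
  R : Fin N → (Fin N → ℝ) → (Fin N → ℝ) → ℝ

/-- The standing assumptions on the coefficient functions. -/
structure SystemData.Admissible {N : ℕ} (D : SystemData N) : Prop where
  f_lip : ∀ k, ∃ K, LipschitzWith K (D.f k)
  f_zero : ∀ k, D.f k 0 = 0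
  f_one : ∀ k, D.f k 1 = 0
  ν_smooth : ∀ k, ContDiff ℝ 2 (D.ν k)
  /-- Finite total variation: for a `C^1` function on `ℝ^N` it is the integral of `|∇ν^k|`. -/
  ν_bv : ∀ k j, Integrable (partialD j (D.ν k))
  ν_bdd : ∀ k, supNorm (D.ν k) < (⊤ : ℝ≥0∞)
  ν_grad_bdd : ∀ k j, supNorm (partialD j (D.ν k)) < (⊤ : ℝ≥0∞)
  ν_hess_bdd : ∀ k i j, supNorm (partialD i (partialD j (D.ν k))) < (⊤ : ℝ≥0∞)
  μ_smooth : ∀ j k, ContDiff ℝ 1 (D.μ j k)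
  μ_sobolev : ∀ j k, sobolevNorm (D.μ j k) < (⊤ : ℝ≥0∞)
  η_smooth : ∀ j k, ContDiff ℝ 1 (D.η j k)
  η_sobolev : ∀ j k, sobolevNorm (D.η j k) < (⊤ : ℝ≥0∞)
  η_integrable : ∀ j k, Integrable (D.η j k)
  Γ_bdd : ∀ j k, MemLp (D.Γ j k) (⊤ : ℝ≥0∞) halfLine
  Γ_nonneg : ∀ j k, ∀ᵐ s ∂halfLine, 0 ≤ D.Γ j k s
  θ_bdd : ∀ j k, MemLp (D.θ j k) (⊤ : ℝ≥0∞) halfLine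
  θ_nonneg : ∀ j k, ∀ᵐ s ∂halfLine, 0 ≤ D.θ j k s
  R_lip : ∀ k, ∃ K, LipschitzWith K (Function.uncurry (D.R k))
  R_zero : ∀ k, D.R k 0 0 = 0

/-- `M` bounds the norms of the coefficient functions on which the constants may depend. -/
structure SystemData.BoundedBy {N : ℕ} (D : SystemData N) (M : ℝ≥0) : Prop where
  f_le : ∀ k, lipR (D.f k) ≤ M
  ν_le : ∀ k, supNorm (D.ν k) ≤ M
  ν_grad_le : ∀ k j, supNorm (partialD j (D.ν k)) ≤ M
  ν_hess_le : ∀ k i j, supNorm (partialD i (partialD j (D.ν k))) ≤ M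
  μ_le : ∀ j k, sobolevNorm (D.μ j k) ≤ M
  Γ_le : ∀ j k, eLpNorm (D.Γ j k) (⊤ : ℝ≥0∞) halfLine ≤ M
  η_le : ∀ j k, oneNorm (D.η j k) ≤ M
  θ_le : ∀ j k, eLpNorm (D.θ j k) (⊤ : ℝ≥0∞) halfLine ≤ M
  R_le : ∀ k, lipSource (D.R k) ≤ M

/-- The space-time convolution with memory: for the kernels `Z^{j,k}(t,x) = κ^{j,k}(x) w^{j,k}(t)`,
the vector `(Z^{j,k} * U^j)_j` at the point `(t, x)`. -/
def memConv {N : ℕ} (κ w : Fin N → Fin N → ℝ → ℝ) (U : Fin N → ℝ → ℝ → ℝ)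
    (k : Fin N) (t x : ℝ) : Fin N → ℝ :=
  fun j => ∫ τ in (0 : ℝ)..t, ∫ ξ, U j τ ξ * κ j k (x - ξ) * w j k (t - τ)

/-- The velocity `ν^k((Θ ⊛ U)^k(t, x))`. -/
def SystemData.velocity {N : ℕ} (D : SystemData N) (U : Fin N → ℝ → ℝ → ℝ)
    (k : Fin N) (t x : ℝ) : ℝ :=
  D.ν k (memConv D.μ D.Γ U k t x)

/-- The source `R^k(U, (Υ ⊛ U)^k)(t, x)`. -/
def SystemData.source {N : ℕ} (D : SystemData N) (U : Fin N → ℝ → ℝ → ℝ)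
    (k : Fin N) (t x : ℝ) : ℝ :=
  D.R k (fun j => U j t x) (memConv D.η D.θ U k t x)

/-- Test functions of class `C_c^∞([0,T) × ℝ)` that are non-negative there: restrictions of smooth
functions on the plane with compact support in `(-∞, T) × ℝ`. -/
structure IsTestFunction (T : ℝ) (φ : ℝ × ℝ → ℝ) : Prop where
  smooth : ContDiff ℝ ∞ φ
  compact : HasCompactSupport φ
  support : tsupport φ ⊆ Iio T ×ˢ univ
  nonneg : ∀ t ∈ Ico 0 T, ∀ x, 0 ≤ φ (t, x)

/-- The left-hand side of the Kruzhkov entropy inequality for the component `k`, the constant `α`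
and the test function `φ`. -/
def SystemData.entropyForm {N : ℕ} (D : SystemData N) (T : ℝ) (U₀ : Fin N → ℝ → ℝ)
    (U : Fin N → ℝ → ℝ → ℝ) (k : Fin N) (α : ℝ) (φ : ℝ × ℝ → ℝ) : ℝ :=
  (∫ p in QT T, |U k p.1 p.2 - α| * deriv (fun s => φ (s, p.2)) p.1)
  + (∫ x, |U₀ k x - α| * φ (0, x))
  + (∫ p in QT T, Real.sign (U k p.1 p.2 - α) * D.velocity U k p.1 p.2
      * (D.f k (U k p.1 p.2) - D.f k α) * deriv (fun y => φ (p.1, y)) p.2)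
  - (∫ p in QT T, D.f k α * Real.sign (U k p.1 p.2 - α)
      * deriv (fun y => D.velocity U k p.1 y) p.2 * φ p)
  + (∫ p in QT T, Real.sign (U k p.1 p.2 - α) * D.source U k p.1 p.2 * φ p)

/-- `U` is an entropy solution on `[0, T]` of the system with coefficients `D` and initial datum
`U₀`. Each component is (a jointly measurable representative of) an element of
`C([0,T]; L^1(ℝ; [0,1])) ∩ L^∞([0,T]; BV(ℝ))`. -/
structure IsEntropySolution {N : ℕ} (D : SystemData N) (T : ℝ) (U₀ : Fin N → ℝ → ℝ)
    (U : Fin N → ℝ → ℝ → ℝ) : Prop where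
  measurable : ∀ k, AEStronglyMeasurable (fun p : ℝ × ℝ => U k p.1 p.2) (volume.restrict (QT T))
  integrable : ∀ k, ∀ t ∈ Icc 0 T, Integrable (U k t)
  range : ∀ k, ∀ t ∈ Icc 0 T, ∀ᵐ x, U k t x ∈ Icc (0 : ℝ) 1
  continuous : ∀ k, ∀ s ∈ Icc 0 T,
    Tendsto (fun t => oneNorm (fun x => U k t x - U k s x)) (𝓝[Icc 0 T] s) (𝓝 0)
  bv : ∀ k, ∃ B : ℝ≥0, ∀ᵐ t ∂(volume.restrict (Icc 0 T)), totalVar (U k t) ≤ B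
  entropy : ∀ (k : Fin N) (α : ℝ) (φ : ℝ × ℝ → ℝ), IsTestFunction T φ →
    0 ≤ D.entropyForm T U₀ U k α φ

/-- The weighted sum of the distances between two sets of coefficients and initial data. -/
def weightedDist {N : ℕ} (C₁ C₂ C₃ C₄ C₅ C₆ C₇ C₈ : ℝ≥0) (D D' : SystemData N)
    (U₀ V₀ : Fin N → ℝ → ℝ) : ℝ≥0∞ :=
  (∑ k, oneNorm (fun x => U₀ k x - V₀ k x))
  + C₁ * (⨆ k, lipR (fun u => D'.f k u - D.f k u))
  + C₂ * (⨆ k, supNorm (fun w => D'.ν k w - D.ν k w))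
  + C₃ * (⨆ (k) (j), supNorm (fun w => partialD j (D'.ν k) w - partialD j (D.ν k) w))
  + C₄ * (⨆ (j) (k), eLpNorm (fun s => D'.Γ j k s - D.Γ j k s) (⊤ : ℝ≥0∞) halfLine)
  + C₅ * (⨆ (j) (k), sobolevNorm (fun x => D'.μ j k x - D.μ j k x))
  + C₆ * (∑ j, ∑ k, oneNorm (fun x => D'.η j k x - D.η j k x))
  + C₇ * (∑ j, ∑ k, eLpNorm (fun s => D'.θ j k s - D.θ j k s) 1 halfLine)
  + C₈ * (⨆ k, lipSource (fun a b => D.R k a b - D'.R k a b))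

end NonlocalMemory

end

open NonlocalMemory

/-! The proof is Kruzhkov's doubling of variables, applied to one component at a time, followed by
Gronwall's inequality.

Once the solutions are inserted into the nonlocal terms, the velocity and the source become given
functions of (t, x). Thus u = U^k solves a scalar law u_t + (a f(u))_x = r and v = V^k solves v_t +
(b g(v))_x = s (`IsEntropySolution.scalarSolution`). The smoothness of μ and ν makes a, b and their
x-derivatives continuous and bounded.

For the scalar laws, the inequality for u at p with α = v(q) and the one for v at q with α = u(p)
are tested with Φ(p) ρ(p - q) and added (`DoublingSetup.doubled_ineq`). The time derivatives of ρ
cancel. The singular remainder is the flux mismatch sgn(u(p) - v(q)) [a(p)(f(u(p)) - f(v(q))) -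
b(q)(g(u(p)) - g(v(q)))] against the x-derivative of the kernel in p. As a function of the density
u(p) alone, with the coefficients frozen, the mismatch is Lipschitz with the small constant A |f -
g|_Lip + K (|a - b| + oscillation of b). Hence integration by parts in p costs only this constant
times the variation of u (`DoublingSetup.flux_ineq`); difference quotients stand in for the measure
∂_x u. This is why only the total variation of U enters, not that of V. The part of the derivative
that falls on a combines with the f(α) ∂_x a terms of the entropy inequalities: f(v(q)) disappears,
and g(u) ∂_x b - f(u) ∂_x a remains, which is controlled by the coefficient gaps times u.

Letting the radius of ρ tend to zero gives a Kato inequality (`kato_ineq`). Removing the cutoffs in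
space and then in time bounds the L¹ distance at the final time by the initial distance plus the
coefficient gaps (`scalar_stability`).

For the system these gaps themselves depend on U - V. Memory is convolution with bounded kernels, so
a - b and its x-derivative are bounded uniformly by the data gaps plus the space-time L¹ distance of
U and V (`KernelBound.abs_sub_le`). Since η is integrable, Young's inequality bounds r - s in L¹ in
the same way (`KernelBound.lintegral_sub_le`). Applied on every interval [0, t], this yields W(t) ≤
W(0) + C gap + C ∫_0^t W for the distance W, and Gronwall concludes (`exists_stability_constant`).

Two points concern traces. The datum U₀ occurs only inside the entropy inequality, so U(0) = U₀ has
to be proved (`IsEntropySolution.initial_trace`): cutoffs concentrating at time zero give |U(0) - α|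
≤ |U₀ - α| for every α, and then α = U₀(x). For uniqueness all gaps vanish, and the variation bound,
assumed for almost every t, extends to every t by lower semicontinuity (`L1Curve.totalVar_le`). -/

noncomputable section

namespace NonlocalMemory

/-! ### Partial derivatives on the plane -/

/-- The partial derivative in the first variable. -/
def timeDeriv (φ : ℝ × ℝ → ℝ) (p : ℝ × ℝ) : ℝ := deriv (fun s => φ (s, p.2)) p.1

/-- The partial derivative in the second variable. -/
def spaceDeriv (φ : ℝ × ℝ → ℝ) (p : ℝ × ℝ) : ℝ := deriv (fun y => φ (p.1, y)) p.2

theorem hasDerivAt_time {φ : ℝ × ℝ → ℝ} (hφ : ContDiff ℝ ∞ φ) (p : ℝ × ℝ) :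
    HasDerivAt (fun s => φ (s, p.2)) (fderiv ℝ φ p (1, 0)) p.1 := by
  have h : HasFDerivAt φ (fderiv ℝ φ p) (p.1, p.2) :=
    (hφ.differentiable (by simp) p).hasFDerivAt
  exact h.comp_hasDerivAt p.1 ((hasDerivAt_id p.1).prodMk (hasDerivAt_const p.1 p.2))

theorem hasDerivAt_space {φ : ℝ × ℝ → ℝ} (hφ : ContDiff ℝ ∞ φ) (p : ℝ × ℝ) :
    HasDerivAt (fun y => φ (p.1, y)) (fderiv ℝ φ p (0, 1)) p.2 := by
  have h : HasFDerivAt φ (fderiv ℝ φ p) (p.1, p.2) :=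
    (hφ.differentiable (by simp) p).hasFDerivAt
  exact h.comp_hasDerivAt p.2 ((hasDerivAt_const p.2 p.1).prodMk (hasDerivAt_id p.2))

theorem timeDeriv_eq {φ : ℝ × ℝ → ℝ} (hφ : ContDiff ℝ ∞ φ) (p : ℝ × ℝ) :
    timeDeriv φ p = fderiv ℝ φ p (1, 0) := (hasDerivAt_time hφ p).deriv

theorem spaceDeriv_eq {φ : ℝ × ℝ → ℝ} (hφ : ContDiff ℝ ∞ φ) (p : ℝ × ℝ) :
    spaceDeriv φ p = fderiv ℝ φ p (0, 1) := (hasDerivAt_space hφ p).deriv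

theorem continuous_timeDeriv {φ : ℝ × ℝ → ℝ} (hφ : ContDiff ℝ ∞ φ) :
    Continuous (timeDeriv φ) := by
  rw [show timeDeriv φ = _ from funext (timeDeriv_eq hφ)]
  exact (hφ.continuous_fderiv (by simp)).clm_apply continuous_const

theorem continuous_spaceDeriv {φ : ℝ × ℝ → ℝ} (hφ : ContDiff ℝ ∞ φ) :
    Continuous (spaceDeriv φ) := by
  rw [show spaceDeriv φ = _ from funext (spaceDeriv_eq hφ)]
  exact (hφ.continuous_fderiv (by simp)).clm_apply continuous_const

theorem timeDeriv_eq_zero {φ : ℝ × ℝ → ℝ} (hφ : ContDiff ℝ ∞ φ) {p : ℝ × ℝ}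
    (hp : p ∉ tsupport φ) : timeDeriv φ p = 0 := by
  rw [timeDeriv_eq hφ, fderiv_of_notMem_tsupport ℝ hp]; rfl

theorem spaceDeriv_eq_zero {φ : ℝ × ℝ → ℝ} (hφ : ContDiff ℝ ∞ φ) {p : ℝ × ℝ}
    (hp : p ∉ tsupport φ) : spaceDeriv φ p = 0 := by
  rw [spaceDeriv_eq hφ, fderiv_of_notMem_tsupport ℝ hp]; rfl

theorem hasCompactSupport_timeDeriv {φ : ℝ × ℝ → ℝ} (hφ : ContDiff ℝ ∞ φ)
    (hc : HasCompactSupport φ) : HasCompactSupport (timeDeriv φ) :=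
  HasCompactSupport.intro hc fun _ hp => timeDeriv_eq_zero hφ hp

theorem hasCompactSupport_spaceDeriv {φ : ℝ × ℝ → ℝ} (hφ : ContDiff ℝ ∞ φ)
    (hc : HasCompactSupport φ) : HasCompactSupport (spaceDeriv φ) :=
  HasCompactSupport.intro hc fun _ hp => spaceDeriv_eq_zero hφ hp

theorem integrable_timeDeriv {φ : ℝ × ℝ → ℝ} (hφ : ContDiff ℝ ∞ φ)
    (hc : HasCompactSupport φ) : Integrable (timeDeriv φ) :=
  (continuous_timeDeriv hφ).integrable_of_hasCompactSupport (hasCompactSupport_timeDeriv hφ hc)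

theorem integrable_spaceDeriv {φ : ℝ × ℝ → ℝ} (hφ : ContDiff ℝ ∞ φ)
    (hc : HasCompactSupport φ) : Integrable (spaceDeriv φ) :=
  (continuous_spaceDeriv hφ).integrable_of_hasCompactSupport (hasCompactSupport_spaceDeriv hφ hc)

/-! ### The Kruzhkov sign. -/

theorem measurable_realSign : Measurable Real.sign := by
  unfold Real.sign
  exact Measurable.ite measurableSet_Iio measurable_const
    (Measurable.ite measurableSet_Ioi measurable_const measurable_const)

theorem abs_realSign_le (x : ℝ) : |Real.sign x| ≤ 1 := by
  rcases Real.sign_apply_eq x with h | h | h <;> simp [h]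

theorem realSign_mul_self (x : ℝ) : Real.sign x * x = |x| := by
  rcases lt_trichotomy x 0 with h | h | h
  · simp [Real.sign_of_neg h, abs_of_neg h]
  · simp [h]
  · simp [Real.sign_of_pos h, abs_of_pos h]

theorem realSign_sub_comm (x y : ℝ) : Real.sign (x - y) = -Real.sign (y - x) := by
  rw [← Real.sign_neg, neg_sub]

/-- Composition with the Kruzhkov sign preserves Lipschitz bounds. -/
theorem abs_sign_mul_sub_le {G : ℝ → ℝ} {L : ℝ} (hG : ∀ x y, |G x - G y| ≤ L * |x - y|)
    (w w' z : ℝ) :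
    |Real.sign (w - z) * (G w - G z) - Real.sign (w' - z) * (G w' - G z)| ≤ L * |w - w'| := by
  have h1 := hG w z
  have h2 := hG w' z
  have h3 := hG w w'
  -- If w and w' lie on the same side of z, the values G z cancel. On opposite sides the two terms
  -- add up, but then |w - z| + |z - w'| = |w - w'|.
  rcases lt_trichotomy w z with hw | hw | hw <;> rcases lt_trichotomy w' z with hw' | hw' | hw'
  · rw [Real.sign_of_neg (sub_neg.2 hw), Real.sign_of_neg (sub_neg.2 hw'), abs_sub_comm]
    convert h3 using 2; ring
  · subst hw'
    rw [Real.sign_of_neg (sub_neg.2 hw)]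
    simpa [abs_sub_comm] using h1
  · rw [Real.sign_of_neg (sub_neg.2 hw), Real.sign_of_pos (sub_pos.2 hw')]
    rw [abs_of_neg (sub_neg.2 hw)] at h1
    rw [abs_of_pos (sub_pos.2 hw')] at h2
    rw [abs_of_neg (by linarith : w - w' < 0)]
    have := abs_le.1 h1
    have := abs_le.1 h2
    rw [abs_le]; constructor <;> linarith
  · subst hw
    rw [Real.sign_of_neg (sub_neg.2 hw')]
    simpa [abs_sub_comm] using h2
  · subst hw; subst hw'
    simp
  · subst hw
    rw [Real.sign_of_pos (sub_pos.2 hw')]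
    simpa [abs_sub_comm] using h2
  · rw [Real.sign_of_pos (sub_pos.2 hw), Real.sign_of_neg (sub_neg.2 hw')]
    rw [abs_of_pos (sub_pos.2 hw)] at h1
    rw [abs_of_neg (sub_neg.2 hw')] at h2
    rw [abs_of_pos (by linarith : 0 < w - w')]
    have := abs_le.1 h1
    have := abs_le.1 h2
    rw [abs_le]; constructor <;> linarith
  · subst hw'
    rw [Real.sign_of_pos (sub_pos.2 hw)]
    simpa [abs_sub_comm] using h1
  · rw [Real.sign_of_pos (sub_pos.2 hw), Real.sign_of_pos (sub_pos.2 hw')]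
    convert h3 using 2; ring

/-! ### Integrability on the product of two planes -/

/-- The usual convolution integrand carries the weight at the second point; reflecting the kernel
and swapping the two points moves it to the first. -/
theorem integrable_convolution_left {w k : ℝ × ℝ → ℝ} (hw : Integrable w) (hk : Integrable k) :
    Integrable (fun z : (ℝ × ℝ) × (ℝ × ℝ) => w z.1 * k (z.1 - z.2)) (volume.prod volume) := by
  have h := (Integrable.convolution_integrand (ContinuousLinearMap.mul ℝ ℝ) hw hk.comp_neg).swap
  refine h.congr (ae_of_all _ fun z => ?_)
  simp

theorem integrable_convolution_right {w k : ℝ × ℝ → ℝ} (hw : Integrable w) (hk : Integrable k) :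
    Integrable (fun z : (ℝ × ℝ) × (ℝ × ℝ) => w z.2 * k (z.1 - z.2)) (volume.prod volume) :=
  Integrable.convolution_integrand (ContinuousLinearMap.mul ℝ ℝ) hw hk

/-- By translation invariance the inner integral over the second point is the mass of the kernel.
For a mollifier of mass one, doubled integrals of functions of the first point are thus evaluated
exactly. -/
theorem integral_convolution_left {w k : ℝ × ℝ → ℝ} (hw : Integrable w) (hk : Integrable k) :
    ∫ z : (ℝ × ℝ) × (ℝ × ℝ), w z.1 * k (z.1 - z.2) ∂(volume.prod volume)
      = (∫ p, w p) * ∫ p, k p := by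
  rw [integral_prod _ (integrable_convolution_left hw hk), ← integral_mul_const]
  refine integral_congr_ae (ae_of_all _ fun p => ?_)
  simp only
  rw [integral_const_mul, integral_sub_left_eq_self k volume p]

/-! ### Continuity of translations in `L^1` -/

/-- Density of compactly supported continuous functions: for these, uniform continuity bounds the
change pointwise, and for shifts shorter than 1 the change is confined to the unit thickening of the
support, which has finite measure. -/
theorem tendsto_integral_abs_sub_translate {v : ℝ × ℝ → ℝ} (hv : Integrable v) :
    Tendsto (fun z => ∫ p, |v p - v (p - z)|) (𝓝 0) (𝓝 0) := by
  have key : ∀ ε > 0, ∀ᶠ z in 𝓝 (0 : ℝ × ℝ), ∫ p, |v p - v (p - z)| < ε := by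
    intro ε hε
    obtain ⟨w, hwc, hw, hwcont, hwi⟩ :=
      hv.exists_hasCompactSupport_integral_sub_le (ε := ε / 4) (by positivity)
    have hK : IsCompact (Metric.cthickening 1 (tsupport w)) := hwc.cthickening
    set m := volume.real (Metric.cthickening 1 (tsupport w)) with hm
    have hm0 : 0 ≤ m := measureReal_nonneg
    have hu := hwc.uniformContinuous_of_continuous hwcont
    rw [Metric.uniformContinuous_iff] at hu
    obtain ⟨δ, hδ, hδ'⟩ := hu (ε / (4 * (m + 1))) (by positivity)
    filter_upwards [Metric.ball_mem_nhds (0 : ℝ × ℝ) (lt_min hδ one_pos)] with z hz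
    rw [mem_ball_zero_iff, lt_min_iff] at hz
    have hvz : Integrable fun p => v (p - z) := hv.comp_sub_right z
    have hwz : Integrable fun p => w (p - z) := hwi.comp_sub_right z
    have h1 : ∫ p, |w p - w (p - z)| ≤ ε / 4 := by
      have h2 : ∀ p, |w p - w (p - z)| ≤
          (Metric.cthickening 1 (tsupport w)).indicator (fun _ => ε / (4 * (m + 1))) p := by
        intro p
        by_cases hp : p ∈ Metric.cthickening 1 (tsupport w)
        · rw [indicator_of_mem hp, ← Real.dist_eq]
          exact (hδ' (by simpa [dist_eq_norm] using hz.1)).le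
        · rw [indicator_of_notMem hp]
          have h3 : w p = 0 := image_eq_zero_of_notMem_tsupport
            fun h => hp (Metric.self_subset_cthickening _ h)
          have h4 : w (p - z) = 0 := image_eq_zero_of_notMem_tsupport fun h => hp
            (Metric.mem_cthickening_of_dist_le p (p - z) 1 _ h (by simpa [dist_eq_norm] using hz.2.le))
          simp [h3, h4]
      calc ∫ p, |w p - w (p - z)| ≤ ∫ p, (Metric.cthickening 1 (tsupport w)).indicator
            (fun _ => ε / (4 * (m + 1))) p := by
              refine integral_mono (hwi.sub hwz).abs ?_ h2
              exact (integrable_indicator_iff hK.measurableSet).2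
                (integrableOn_const hK.measure_lt_top.ne)
        _ = m * (ε / (4 * (m + 1))) := by
              rw [integral_indicator hK.measurableSet, setIntegral_const, smul_eq_mul]
        _ ≤ ε / 4 := by
              rw [mul_div_assoc', div_le_div_iff₀ (by positivity) (by positivity)]
              nlinarith
    have h5 : ∫ p, |v (p - z) - w (p - z)| ≤ ε / 4 := by
      rw [integral_sub_right_eq_self (fun p => |v p - w p|) z]
      simpa using hw
    have h6 : ∫ p, |v p - w p| ≤ ε / 4 := by simpa using hw
    calc ∫ p, |v p - v (p - z)|
        ≤ ∫ p, (|v p - w p| + |w p - w (p - z)| + |v (p - z) - w (p - z)|) := by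
          refine integral_mono (hv.sub hvz).abs
            (((hv.sub hwi).abs.add (hwi.sub hwz).abs).add (hvz.sub hwz).abs) fun p => ?_
          simp only
          have := abs_sub_le (v p) (w p) (v (p - z))
          have := abs_sub_le (w p) (w (p - z)) (v (p - z))
          rw [abs_sub_comm (w (p - z))] at this
          linarith
      _ = (∫ p, |v p - w p|) + (∫ p, |w p - w (p - z)|) + ∫ p, |v (p - z) - w (p - z)| := by
          have e1 := integral_add ((hv.sub hwi).abs.add (hwi.sub hwz).abs) (hvz.sub hwz).abs
          have e2 := integral_add (hv.sub hwi).abs (hwi.sub hwz).abs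
          simp only [Pi.add_apply, Pi.sub_apply] at e1 e2
          rw [e1, e2]
      _ < ε := by linarith
  rw [Metric.tendsto_nhds]
  intro ε hε
  filter_upwards [key ε hε] with z hz
  rw [Real.dist_0_eq_abs, abs_of_nonneg (integral_nonneg fun p => abs_nonneg _)]
  exact hz

/-- Mollification with a kernel of small support changes an integrable function little. -/
theorem exists_integral_mollify_le {v : ℝ × ℝ → ℝ} (hvm : Measurable v) (hv : Integrable v)
    {η : ℝ} (hη : 0 < η) :
    ∃ δ > 0, ∀ ρ : ℝ × ℝ → ℝ, Continuous ρ → HasCompactSupport ρ → (∀ z, 0 ≤ ρ z) →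
      ∫ z, ρ z = 1 → (∀ z, δ ≤ ‖z‖ → ρ z = 0) →
      ∫ z : (ℝ × ℝ) × (ℝ × ℝ), |v z.1 - v z.2| * ρ (z.1 - z.2) ∂(volume.prod volume) ≤ η := by
  obtain ⟨δ, hδ, h⟩ := Metric.eventually_nhds_iff.1
    ((tendsto_integral_abs_sub_translate hv).eventually (gt_mem_nhds hη))
  refine ⟨δ, hδ, fun ρ hρc hρs hρ0 hρ1 hρδ => ?_⟩
  have hρi : Integrable ρ := hρc.integrable_of_hasCompactSupport hρs
  have hρm := hρc.measurable
  have hint : Integrable (fun z : (ℝ × ℝ) × (ℝ × ℝ) => |v z.1 - v z.2| * ρ (z.1 - z.2))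
      (volume.prod volume) := by
    refine Integrable.mono' ((integrable_convolution_left hv.abs hρi).add
      (integrable_convolution_right hv.abs hρi)) (by fun_prop) (ae_of_all _ fun z => ?_)
    simp only [Pi.add_apply]
    rw [Real.norm_eq_abs, abs_mul, abs_abs, abs_of_nonneg (hρ0 _), ← add_mul]
    exact mul_le_mul_of_nonneg_right (abs_sub _ _) (hρ0 _)
  rw [← ENNReal.ofReal_le_ofReal_iff hη.le,
    ofReal_integral_eq_lintegral_ofReal hint
      (ae_of_all _ fun z => mul_nonneg (abs_nonneg _) (hρ0 _)),
    lintegral_prod _ (by fun_prop)]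
  -- With z = p - q and Tonelli, the mollification error becomes a ρ-average of translation errors.
  calc ∫⁻ p, ∫⁻ q, ENNReal.ofReal (|v p - v q| * ρ (p - q))
      = ∫⁻ p, ∫⁻ z, ENNReal.ofReal (|v p - v (p - z)| * ρ z) := by
        refine lintegral_congr fun p => ?_
        rw [← lintegral_sub_left_eq_self _ p]
        simp
    _ = ∫⁻ z, ∫⁻ p, ENNReal.ofReal (|v p - v (p - z)| * ρ z) :=
        lintegral_lintegral_swap (by fun_prop)
    _ ≤ ∫⁻ z, ENNReal.ofReal (η * ρ z) := by
        refine lintegral_mono fun z => ?_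
        by_cases hz : δ ≤ ‖z‖
        · simp [hρδ z hz]
        · have hi : Integrable (fun p => |v p - v (p - z)| * ρ z) :=
            ((hv.sub (hv.comp_sub_right z)).abs).mul_const _
          rw [← ofReal_integral_eq_lintegral_ofReal hi
            (ae_of_all _ fun p => mul_nonneg (abs_nonneg _) (hρ0 _)), integral_mul_const]
          refine ENNReal.ofReal_le_ofReal (mul_le_mul_of_nonneg_right (h ?_).le (hρ0 z))
          simpa using not_le.1 hz
    _ = ENNReal.ofReal η := by
        rw [← ofReal_integral_eq_lintegral_ofReal (hρi.const_mul η)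
          (ae_of_all _ fun z => mul_nonneg hη.le (hρ0 z)), integral_const_mul, hρ1, mul_one]

/-! ### Integration by parts with difference quotients -/

/-- Summation by parts: difference quotients of a bounded function in a direction `e`, tested with
`ψ`, converge to minus the distributional derivative. -/
theorem tendsto_integral_diff_quotient {X : Type*} [NormedAddCommGroup X] [NormedSpace ℝ X]
    [FiniteDimensional ℝ X] [MeasurableSpace X] [BorelSpace X] (μ : Measure X)
    [μ.IsAddHaarMeasure] {F ψ : X → ℝ} {C : ℝ} (hF : Measurable F) (hFC : ∀ z, |F z| ≤ C)
    (hψ : ContDiff ℝ ∞ ψ) (hψc : HasCompactSupport ψ) (e : X) :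
    Tendsto (fun h : ℝ => ∫ z, h⁻¹ * (F (z - h • e) - F z) * ψ z ∂μ) (𝓝[>] 0)
      (𝓝 (∫ z, F z * fderiv ℝ ψ z e ∂μ)) := by
  have hψi : Integrable ψ μ := hψ.continuous.integrable_of_hasCompactSupport hψc
  have hψm := hψ.continuous.measurable
  have hFψ : Integrable (fun z => F z * ψ z) μ :=
    hψi.bdd_mul hF.aestronglyMeasurable (ae_of_all _ fun z => by simpa using hFC z)
  obtain ⟨L, hL⟩ := hψ.lipschitzWith_of_hasCompactSupport hψc (by simp)
  -- Translation invariance moves the difference quotient from F, which is merely bounded and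
  -- measurable, to the smooth function ψ.
  have hrew : ∀ h : ℝ, ∫ z, h⁻¹ * (F (z - h • e) - F z) * ψ z ∂μ
      = ∫ z, F z * (h⁻¹ * (ψ (z + h • e) - ψ z)) ∂μ := by
    intro h
    have h1 : Integrable (fun z => F (z - h • e) * ψ z) μ :=
      hψi.bdd_mul (hF.comp (measurable_id.sub_const _)).aestronglyMeasurable
        (ae_of_all _ fun z => by simpa using hFC _)
    have h2 : Integrable (fun z => F z * ψ (z + h • e)) μ :=
      (hψi.comp_add_right (h • e)).bdd_mul hF.aestronglyMeasurable
        (ae_of_all _ fun z => by simpa using hFC z)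
    have h3 : ∫ z, F (z - h • e) * ψ z ∂μ = ∫ z, F z * ψ (z + h • e) ∂μ := by
      rw [← integral_add_right_eq_self _ (h • e)]
      simp
    calc _ = ∫ z, h⁻¹ * (F (z - h • e) * ψ z - F z * ψ z) ∂μ := by
            congr 1; ext z; ring
      _ = h⁻¹ * (∫ z, F (z - h • e) * ψ z ∂μ - ∫ z, F z * ψ z ∂μ) := by
            rw [integral_const_mul, integral_sub h1 hFψ]
      _ = ∫ z, h⁻¹ * (F z * ψ (z + h • e) - F z * ψ z) ∂μ := by
            rw [h3, integral_const_mul, integral_sub h2 hFψ]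
      _ = _ := by congr 1; ext z; ring
  simp_rw [hrew]
  -- For 0 < h < 1 all quotients of ψ vanish off this fixed compact set and are bounded by the
  -- Lipschitz constant of ψ times ‖e‖, which gives the dominating function.
  have hK : IsCompact (Metric.cthickening (‖e‖) (tsupport ψ)) := hψc.cthickening
  have hC : ∀ z, 0 ≤ C := fun z => (abs_nonneg _).trans (hFC z)
  refine tendsto_integral_filter_of_dominated_convergence
    ((Metric.cthickening (‖e‖) (tsupport ψ)).indicator fun _ => C * (L * ‖e‖)) ?_ ?_ ?_ ?_
  · exact Eventually.of_forall fun h => by fun_prop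
  · filter_upwards [Ioo_mem_nhdsGT (zero_lt_one' ℝ)] with h hh
    refine ae_of_all _ fun z => ?_
    by_cases hz : z ∈ Metric.cthickening (‖e‖) (tsupport ψ)
    · rw [indicator_of_mem hz, norm_mul]
      refine mul_le_mul (hFC z) ?_ (norm_nonneg _) (hC z)
      rw [norm_mul, norm_inv, Real.norm_of_nonneg hh.1.le]
      have := hL.norm_sub_le (z + h • e) z
      rw [add_sub_cancel_left, norm_smul, Real.norm_of_nonneg hh.1.le] at this
      rw [inv_mul_le_iff₀ hh.1]
      linarith
    · rw [indicator_of_notMem hz]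
      have h3 : ψ z = 0 := image_eq_zero_of_notMem_tsupport
        fun h => hz (Metric.self_subset_cthickening _ h)
      have h4 : ψ (z + h • e) = 0 := image_eq_zero_of_notMem_tsupport fun h' => hz
        (Metric.mem_cthickening_of_dist_le z (z + h • e) _ _ h' (by
          rw [dist_self_add_right, norm_smul, Real.norm_of_nonneg hh.1.le]
          exact mul_le_of_le_one_left (norm_nonneg _) hh.2.le))
      simp [h3, h4]
  · exact (integrable_indicator_iff hK.measurableSet).2 (integrableOn_const hK.measure_lt_top.ne)
  · refine ae_of_all _ fun z => Tendsto.const_mul _ ?_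
    have h1 : HasFDerivAt ψ (fderiv ℝ ψ z) z := (hψ.differentiable (by simp) z).hasFDerivAt
    have h2 := (h1.hasLineDerivAt e).tendsto_slope_zero_right
    simpa using h2

/-! ### Doubling of variables for scalar balance laws -/

/-- The Kruzhkov entropy inequality on `(0, T) × ℝ` for `∂_t u + ∂_x (a f(u)) = r`, where `a'` is
the spatial derivative of `a`. -/
def KruzhkovIneq (T : ℝ) (f : ℝ → ℝ) (a a' r u : ℝ × ℝ → ℝ) : Prop :=
  ∀ (α : ℝ) (φ : ℝ × ℝ → ℝ), ContDiff ℝ ∞ φ → HasCompactSupport φ →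
    tsupport φ ⊆ Ioo 0 T ×ˢ univ → (∀ p, 0 ≤ φ p) →
    0 ≤ ∫ p, (|u p - α| * timeDeriv φ p
      + Real.sign (u p - α) * (a p * (f (u p) - f α)) * spaceDeriv φ p
      + Real.sign (u p - α) * (r p - f α * a' p) * φ p)

/-- A globally defined entropy solution of a scalar balance law with bounds on the coefficients. -/
structure ScalarSolution (T K A A' : ℝ) (f : ℝ → ℝ) (a a' r u : ℝ × ℝ → ℝ) : Prop where
  u_meas : Measurable u
  u_int : Integrable u
  u_range : ∀ p, u p ∈ Icc (0 : ℝ) 1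
  r_meas : Measurable r
  r_int : Integrable r
  a_cont : Continuous a
  a'_cont : Continuous a'
  a_le : ∀ p, |a p| ≤ A
  a'_le : ∀ p, |a' p| ≤ A'
  f_lip : ∀ x y, |f x - f y| ≤ K * |x - y|
  f_zero : f 0 = 0
  ineq : KruzhkovIneq T f a a' r u

variable {T K A A' : ℝ} {f g : ℝ → ℝ} {a a' r u b b' s v Φ ρ : ℝ × ℝ → ℝ}

theorem abs_sub_le_one_of_mem {x y : ℝ} (hx : x ∈ Icc (0 : ℝ) 1) (hy : y ∈ Icc (0 : ℝ) 1) :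
    |x - y| ≤ 1 := by
  rw [abs_le]; constructor <;> linarith [hx.1, hx.2, hy.1, hy.2]

theorem nonneg_of_lip (hf : ∀ x y, |f x - f y| ≤ K * |x - y|) : 0 ≤ K := by
  simpa using (abs_nonneg _).trans (hf 1 0)

theorem continuous_of_lip (hf : ∀ x y, |f x - f y| ≤ K * |x - y|) : Continuous f := by
  refine (LipschitzWith.of_dist_le_mul (K := K.toNNReal) fun x y => ?_).continuous
  rw [Real.dist_eq, Real.dist_eq, Real.coe_toNNReal _ (nonneg_of_lip hf)]
  exact hf x y

namespace ScalarSolution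

theorem K_nonneg (hu : ScalarSolution T K A A' f a a' r u) : 0 ≤ K := nonneg_of_lip hu.f_lip

theorem A_nonneg (hu : ScalarSolution T K A A' f a a' r u) : 0 ≤ A :=
  (abs_nonneg _).trans (hu.a_le 0)

theorem A'_nonneg (hu : ScalarSolution T K A A' f a a' r u) : 0 ≤ A' :=
  (abs_nonneg _).trans (hu.a'_le 0)

theorem f_meas (hu : ScalarSolution T K A A' f a a' r u) : Measurable f :=
  (continuous_of_lip hu.f_lip).measurable

theorem abs_f_le (hu : ScalarSolution T K A A' f a a' r u) {x : ℝ} (hx : x ∈ Icc (0 : ℝ) 1) :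
    |f x| ≤ K := by
  have := hu.f_lip x 0
  rw [hu.f_zero, sub_zero, sub_zero, abs_of_nonneg hx.1] at this
  exact this.trans (mul_le_of_le_one_right hu.K_nonneg hx.2)

theorem abs_f_sub_le (hu : ScalarSolution T K A A' f a a' r u) {x y : ℝ}
    (hx : x ∈ Icc (0 : ℝ) 1) (hy : y ∈ Icc (0 : ℝ) 1) : |f x - f y| ≤ K :=
  (hu.f_lip x y).trans (mul_le_of_le_one_right hu.K_nonneg (abs_sub_le_one_of_mem hx hy))

end ScalarSolution

/-- Measure on pairs of points of the plane. -/
abbrev pairVolume : Measure ((ℝ × ℝ) × (ℝ × ℝ)) := volume.prod volume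

/-! ### The doubling kernel Φ(p) ρ(p - q) and its derivatives. -/

section Kernel

variable (hΦ : ContDiff ℝ ∞ Φ) (hρ : ContDiff ℝ ∞ ρ)
include hΦ hρ

theorem contDiff_doublingKernel :
    ContDiff ℝ ∞ fun z : (ℝ × ℝ) × (ℝ × ℝ) => Φ z.1 * ρ (z.1 - z.2) := by
  fun_prop

-- The shear (p, q) ↦ (p, p - q) is its own inverse, so the support lies in the image under it of
-- the compact set `tsupport Φ ×ˢ tsupport ρ`.
omit hΦ hρ in
theorem hasCompactSupport_doublingKernel (hΦc : HasCompactSupport Φ) (hρc : HasCompactSupport ρ) :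
    HasCompactSupport fun z : (ℝ × ℝ) × (ℝ × ℝ) => Φ z.1 * ρ (z.1 - z.2) := by
  have hK : IsCompact ((fun z : (ℝ × ℝ) × (ℝ × ℝ) => (z.1, z.1 - z.2)) ''
      (tsupport Φ ×ˢ tsupport ρ)) := (hΦc.prod hρc).image (by fun_prop)
  refine HasCompactSupport.intro hK fun z hz => ?_
  by_contra hne
  refine hz ⟨(z.1, z.1 - z.2), ⟨?_, ?_⟩, by simp⟩
  · exact subset_tsupport _ (left_ne_zero_of_mul hne)
  · exact subset_tsupport _ (right_ne_zero_of_mul hne)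

/-- The direction ((0, 1), 0) moves p alone. Integration by parts in this direction therefore
differentiates u(p) and leaves v(q) untouched. -/
theorem fderiv_doublingKernel (z : (ℝ × ℝ) × (ℝ × ℝ)) :
    fderiv ℝ (fun z : (ℝ × ℝ) × (ℝ × ℝ) => Φ z.1 * ρ (z.1 - z.2)) z ((0, 1), 0)
      = spaceDeriv Φ z.1 * ρ (z.1 - z.2) + Φ z.1 * spaceDeriv ρ (z.1 - z.2) := by
  have h1 : HasFDerivAt Φ (fderiv ℝ Φ z.1) z.1 := (hΦ.differentiable (by simp) _).hasFDerivAt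
  have h2 : HasFDerivAt ρ (fderiv ℝ ρ (z.1 - z.2)) (z.1 - z.2) :=
    (hρ.differentiable (by simp) _).hasFDerivAt
  have h3 := (h1.comp z hasFDerivAt_fst).mul (h2.comp z (hasFDerivAt_fst.sub hasFDerivAt_snd))
  have h4 := h3.fderiv
  simp only [Function.comp_def] at h4
  erw [h4]
  rw [spaceDeriv_eq hΦ, spaceDeriv_eq hρ]
  simp
  ring

theorem timeDeriv_kernel_left (p q : ℝ × ℝ) :
    timeDeriv (fun p => Φ p * ρ (p - q)) p
      = timeDeriv Φ p * ρ (p - q) + Φ p * timeDeriv ρ (p - q) := by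
  have h1 := hasDerivAt_time hΦ p
  have h2 := (hasDerivAt_time hρ (p - q)).comp_sub_const p.1 q.1
  rw [timeDeriv_eq hΦ, timeDeriv_eq hρ]
  exact (h1.mul h2).deriv

theorem spaceDeriv_kernel_left (p q : ℝ × ℝ) :
    spaceDeriv (fun p => Φ p * ρ (p - q)) p
      = spaceDeriv Φ p * ρ (p - q) + Φ p * spaceDeriv ρ (p - q) := by
  have h1 := hasDerivAt_space hΦ p
  have h2 := (hasDerivAt_space hρ (p - q)).comp_sub_const p.2 q.2
  rw [spaceDeriv_eq hΦ, spaceDeriv_eq hρ]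
  exact (h1.mul h2).deriv

-- Only ρ depends on q, and with the opposite sign; this is what cancels the time derivatives of ρ
-- when the two entropy inequalities are added.
omit hΦ in
theorem timeDeriv_kernel_right (p q : ℝ × ℝ) :
    timeDeriv (fun q => Φ p * ρ (p - q)) q = -(Φ p * timeDeriv ρ (p - q)) := by
  have h2 := ((hasDerivAt_time hρ (p - q)).comp_const_sub p.1 q.1).const_mul (Φ p)
  rw [timeDeriv_eq hρ, ← mul_neg]
  exact h2.deriv

omit hΦ in
theorem spaceDeriv_kernel_right (p q : ℝ × ℝ) :
    spaceDeriv (fun q => Φ p * ρ (p - q)) q = -(Φ p * spaceDeriv ρ (p - q)) := by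
  have h2 := ((hasDerivAt_space hρ (p - q)).comp_const_sub p.2 q.2).const_mul (Φ p)
  rw [spaceDeriv_eq hρ, ← mul_neg]
  exact h2.deriv

end Kernel

/-- Two scalar solutions together with a test function and a mollifier of radius `δ`. -/
structure DoublingSetup (T K A A' : ℝ) (f g : ℝ → ℝ) (a a' r u b b' s v Φ ρ : ℝ × ℝ → ℝ)
    (δ : ℝ) : Prop where
  hu : ScalarSolution T K A A' f a a' r u
  hv : ScalarSolution T K A A' g b b' s v
  Φ_smooth : ContDiff ℝ ∞ Φ
  Φ_compact : HasCompactSupport Φ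
  Φ_nonneg : ∀ p, 0 ≤ Φ p
  Φ_le_one : ∀ p, Φ p ≤ 1
  ρ_smooth : ContDiff ℝ ∞ ρ
  ρ_compact : HasCompactSupport ρ
  ρ_nonneg : ∀ z, 0 ≤ ρ z
  ρ_integral : ∫ z, ρ z = 1
  ρ_zero : ∀ z, δ ≤ ‖z‖ → ρ z = 0
  δ_pos : 0 < δ
  Φ_support : ∀ p ∈ tsupport Φ, ∀ q, dist p q ≤ δ → q ∈ Ioo 0 T ×ˢ (univ : Set ℝ)

namespace DoublingSetup

variable {δ : ℝ} (h : DoublingSetup T K A A' f g a a' r u b b' s v Φ ρ δ)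
include h

theorem ρ_int : Integrable ρ := h.ρ_smooth.continuous.integrable_of_hasCompactSupport h.ρ_compact

theorem Φ_int : Integrable Φ := h.Φ_smooth.continuous.integrable_of_hasCompactSupport h.Φ_compact

theorem measurables : Measurable Φ ∧ Measurable ρ ∧ Measurable (timeDeriv Φ) ∧
    Measurable (spaceDeriv Φ) ∧ Measurable (timeDeriv ρ) ∧ Measurable (spaceDeriv ρ) :=
  ⟨h.Φ_smooth.continuous.measurable, h.ρ_smooth.continuous.measurable,
    (continuous_timeDeriv h.Φ_smooth).measurable, (continuous_spaceDeriv h.Φ_smooth).measurable,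
    (continuous_timeDeriv h.ρ_smooth).measurable, (continuous_spaceDeriv h.ρ_smooth).measurable⟩

theorem sign_measurable :
    Measurable fun z : (ℝ × ℝ) × (ℝ × ℝ) => Real.sign (u z.1 - v z.2) := by
  have := h.hu.u_meas; have := h.hv.u_meas
  exact measurable_realSign.comp (by fun_prop)

/-- A bounded measurable factor times an integrable kernel. -/
theorem integrable_bdd {G k : (ℝ × ℝ) × (ℝ × ℝ) → ℝ} {C : ℝ} (hk : Integrable k pairVolume)
    (hG : Measurable G) (hC : ∀ z, |G z| ≤ C) :
    Integrable (fun z => Real.sign (u z.1 - v z.2) * G z * k z) pairVolume := by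
  refine hk.bdd_mul (c := C) (h.sign_measurable.mul hG).aestronglyMeasurable
    (ae_of_all _ fun z => ?_)
  rw [Real.norm_eq_abs, abs_mul]
  exact (mul_le_of_le_one_left (abs_nonneg _) (abs_realSign_le _)).trans (hC z)

theorem integrable_abs_mul {k : (ℝ × ℝ) × (ℝ × ℝ) → ℝ} (hk : Integrable k pairVolume) :
    Integrable (fun z => |u z.1 - v z.2| * k z) pairVolume := by
  have := h.hu.u_meas; have := h.hv.u_meas
  refine hk.bdd_mul (c := 1) (by fun_prop) (ae_of_all _ fun z => ?_)
  rw [Real.norm_eq_abs, abs_abs]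
  exact abs_sub_le_one_of_mem (h.hu.u_range _) (h.hv.u_range _)

/-- The source is integrable but not bounded, so integrability is drawn from r(p) ρ(p - q), and Φ
together with the sign serves as the bounded factor. -/
theorem integrable_source_left :
    Integrable (fun z : (ℝ × ℝ) × (ℝ × ℝ) =>
      Real.sign (u z.1 - v z.2) * r z.1 * (Φ z.1 * ρ (z.1 - z.2))) pairVolume := by
  obtain ⟨m1, m2, -⟩ := h.measurables
  have := h.hu.r_meas
  have h1 := integrable_convolution_left h.hu.r_int h.ρ_int
  have h2 := h1.bdd_mul (c := 1) (f := fun z => Real.sign (u z.1 - v z.2) * Φ z.1)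
    (h.sign_measurable.mul (by fun_prop)).aestronglyMeasurable (ae_of_all _ fun z => by
      rw [Real.norm_eq_abs, abs_mul, abs_of_nonneg (h.Φ_nonneg _)]
      exact mul_le_one₀ (abs_realSign_le _) (h.Φ_nonneg _) (h.Φ_le_one _))
  exact h2.congr (ae_of_all _ fun z => by simp only; ring)

theorem integrable_source_right :
    Integrable (fun z : (ℝ × ℝ) × (ℝ × ℝ) =>
      Real.sign (u z.1 - v z.2) * s z.2 * (Φ z.1 * ρ (z.1 - z.2))) pairVolume := by
  obtain ⟨m1, m2, -⟩ := h.measurables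
  have := h.hv.r_meas
  have h1 := integrable_convolution_right h.hv.r_int h.ρ_int
  have h2 := h1.bdd_mul (c := 1) (f := fun z => Real.sign (u z.1 - v z.2) * Φ z.1)
    (h.sign_measurable.mul (by fun_prop)).aestronglyMeasurable (ae_of_all _ fun z => by
      rw [Real.norm_eq_abs, abs_mul, abs_of_nonneg (h.Φ_nonneg _)]
      exact mul_le_one₀ (abs_realSign_le _) (h.Φ_nonneg _) (h.Φ_le_one _))
  exact h2.congr (ae_of_all _ fun z => by simp only; ring)

theorem integrable_flux_left {k : (ℝ × ℝ) × (ℝ × ℝ) → ℝ} (hk : Integrable k pairVolume) :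
    Integrable (fun z => Real.sign (u z.1 - v z.2) * (a z.1 * (f (u z.1) - f (v z.2))) * k z)
      pairVolume := by
  have := h.hu.u_meas; have := h.hv.u_meas; have := h.hu.a_cont.measurable; have := h.hu.f_meas
  refine h.integrable_bdd (C := A * K) hk (by fun_prop) fun z => ?_
  rw [abs_mul]
  exact mul_le_mul (h.hu.a_le _) (h.hu.abs_f_sub_le (h.hu.u_range _) (h.hv.u_range _))
    (abs_nonneg _) h.hu.A_nonneg

theorem integrable_flux_right {k : (ℝ × ℝ) × (ℝ × ℝ) → ℝ} (hk : Integrable k pairVolume) :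
    Integrable (fun z => Real.sign (u z.1 - v z.2) * (b z.2 * (g (u z.1) - g (v z.2))) * k z)
      pairVolume := by
  have := h.hu.u_meas; have := h.hv.u_meas; have := h.hv.a_cont.measurable; have := h.hv.f_meas
  refine h.integrable_bdd (C := A * K) hk (by fun_prop) fun z => ?_
  rw [abs_mul]
  exact mul_le_mul (h.hv.a_le _) (h.hv.abs_f_sub_le (h.hu.u_range _) (h.hv.u_range _))
    (abs_nonneg _) h.hu.A_nonneg

/-- The density w and the point π are left free because two instances are needed: f(v(q)) from the
entropy inequality and f(u(p)) from the integration by parts. -/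
theorem integrable_grad_left {w : ℝ × ℝ → ℝ} (hw : Measurable w) (hwr : ∀ p, w p ∈ Icc (0 : ℝ) 1)
    {π : (ℝ × ℝ) × (ℝ × ℝ) → ℝ × ℝ} (hπ : Measurable π)
    {k : (ℝ × ℝ) × (ℝ × ℝ) → ℝ} (hk : Integrable k pairVolume) :
    Integrable (fun z => Real.sign (u z.1 - v z.2) * (f (w (π z)) * a' z.1) * k z)
      pairVolume := by
  have := h.hu.a'_cont.measurable; have := h.hu.f_meas
  refine h.integrable_bdd (C := K * A') hk (by fun_prop) fun z => ?_
  rw [abs_mul]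
  exact mul_le_mul (h.hu.abs_f_le (hwr _)) (h.hu.a'_le _) (abs_nonneg _) h.hu.K_nonneg

theorem integrable_grad_right {k : (ℝ × ℝ) × (ℝ × ℝ) → ℝ} (hk : Integrable k pairVolume) :
    Integrable (fun z => Real.sign (u z.1 - v z.2) * (g (u z.1) * b' z.2) * k z)
      pairVolume := by
  have := h.hu.u_meas; have := h.hv.a'_cont.measurable; have := h.hv.f_meas
  refine h.integrable_bdd (C := K * A') hk (by fun_prop) fun z => ?_
  rw [abs_mul]
  exact mul_le_mul (h.hv.abs_f_le (h.hu.u_range _)) (h.hv.a'_le _) (abs_nonneg _) h.hu.K_nonneg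

theorem mem_of_kernel_ne_zero {p q : ℝ × ℝ} (hne : Φ p * ρ (p - q) ≠ 0) :
    p ∈ tsupport Φ ∧ dist p q ≤ δ := by
  refine ⟨subset_tsupport _ (left_ne_zero_of_mul hne), ?_⟩
  by_contra hd
  exact right_ne_zero_of_mul hne (h.ρ_zero _ (by rw [← dist_eq_norm]; exact (not_le.1 hd).le))

/-- The sum of the two entropy inequalities, each tested with the other solution. -/
theorem doubled_ineq :
    0 ≤ ∫ z, (|u z.1 - v z.2| * (timeDeriv Φ z.1 * ρ (z.1 - z.2))
      + Real.sign (u z.1 - v z.2) * (b z.2 * (g (u z.1) - g (v z.2)))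
        * (spaceDeriv Φ z.1 * ρ (z.1 - z.2))
      + (Real.sign (u z.1 - v z.2) * r z.1 * (Φ z.1 * ρ (z.1 - z.2))
        - Real.sign (u z.1 - v z.2) * s z.2 * (Φ z.1 * ρ (z.1 - z.2)))
      + (Real.sign (u z.1 - v z.2) * (g (u z.1) * b' z.2) * (Φ z.1 * ρ (z.1 - z.2))
        - Real.sign (u z.1 - v z.2) * (f (v z.2) * a' z.1) * (Φ z.1 * ρ (z.1 - z.2)))
      + Real.sign (u z.1 - v z.2) * (a z.1 * (f (u z.1) - f (v z.2))
          - b z.2 * (g (u z.1) - g (v z.2)))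
        * (spaceDeriv Φ z.1 * ρ (z.1 - z.2) + Φ z.1 * spaceDeriv ρ (z.1 - z.2))) ∂pairVolume := by
  have i1 := integrable_convolution_left (integrable_timeDeriv h.Φ_smooth h.Φ_compact) h.ρ_int
  have i2 := integrable_convolution_left h.Φ_int (integrable_timeDeriv h.ρ_smooth h.ρ_compact)
  have i3 := integrable_convolution_left (integrable_spaceDeriv h.Φ_smooth h.Φ_compact) h.ρ_int
  have i4 := integrable_convolution_left h.Φ_int (integrable_spaceDeriv h.ρ_smooth h.ρ_compact)
  have i5 := integrable_convolution_left h.Φ_int h.ρ_int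
  have hfst := h.integrable_grad_left h.hv.u_meas h.hv.u_range measurable_snd i5
  -- Integrand of the inequality for u at p with α = v(q).
  set Zu : (ℝ × ℝ) × (ℝ × ℝ) → ℝ := fun z =>
    |u z.1 - v z.2| * (timeDeriv Φ z.1 * ρ (z.1 - z.2) + Φ z.1 * timeDeriv ρ (z.1 - z.2))
    + Real.sign (u z.1 - v z.2) * (a z.1 * (f (u z.1) - f (v z.2)))
      * (spaceDeriv Φ z.1 * ρ (z.1 - z.2) + Φ z.1 * spaceDeriv ρ (z.1 - z.2))
    + (Real.sign (u z.1 - v z.2) * r z.1 * (Φ z.1 * ρ (z.1 - z.2))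
      - Real.sign (u z.1 - v z.2) * (f (v z.2) * a' z.1) * (Φ z.1 * ρ (z.1 - z.2))) with hZu
  -- Integrand of the inequality for v at q with α = u(p). The sign function and the derivatives of
  -- ρ both change sign, so the flux term keeps the form b(g(u) - g(v)).
  set Zv : (ℝ × ℝ) × (ℝ × ℝ) → ℝ := fun z =>
    -(|u z.1 - v z.2| * (Φ z.1 * timeDeriv ρ (z.1 - z.2)))
    - Real.sign (u z.1 - v z.2) * (b z.2 * (g (u z.1) - g (v z.2)))
      * (Φ z.1 * spaceDeriv ρ (z.1 - z.2))
    - (Real.sign (u z.1 - v z.2) * s z.2 * (Φ z.1 * ρ (z.1 - z.2))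
      - Real.sign (u z.1 - v z.2) * (g (u z.1) * b' z.2) * (Φ z.1 * ρ (z.1 - z.2))) with hZv
  have hZui : Integrable Zu pairVolume :=
    ((h.integrable_abs_mul (i1.add i2)).add (h.integrable_flux_left (i3.add i4))).add
      (h.integrable_source_left.sub hfst)
  have hZvi : Integrable Zv pairVolume :=
    ((h.integrable_abs_mul i2).neg.sub (h.integrable_flux_right i4)).sub
      (h.integrable_source_right.sub (h.integrable_grad_right i5))
  have hu0 : 0 ≤ ∫ z, Zu z ∂pairVolume := by
    rw [integral_prod_symm _ hZui]
    refine integral_nonneg fun q => ?_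
    have hsm : ContDiff ℝ ∞ fun p => Φ p * ρ (p - q) := by
      have := h.Φ_smooth; have := h.ρ_smooth; fun_prop
    have hc : HasCompactSupport fun p => Φ p * ρ (p - q) := h.Φ_compact.mul_right
    have hsupp : tsupport (fun p => Φ p * ρ (p - q)) ⊆ Ioo 0 T ×ˢ univ :=
      (tsupport_mul_subset_left (f := Φ) (g := fun p => ρ (p - q))).trans
        fun p hp => h.Φ_support p hp p (by simpa using h.δ_pos.le)
    refine (h.hu.ineq (v q) _ hsm hc hsupp
      fun p => mul_nonneg (h.Φ_nonneg _) (h.ρ_nonneg _)).trans_eq ?_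
    refine integral_congr_ae (ae_of_all _ fun p => ?_)
    simp only [hZu, timeDeriv_kernel_left h.Φ_smooth h.ρ_smooth,
      spaceDeriv_kernel_left h.Φ_smooth h.ρ_smooth]
    ring
  have hv0 : 0 ≤ ∫ z, Zv z ∂pairVolume := by
    rw [integral_prod _ hZvi]
    refine integral_nonneg fun p => ?_
    -- Only balls around points of `tsupport Φ` are known to stay inside the strip; for other p the
    -- integrand vanishes.
    by_cases hp : p ∈ tsupport Φ
    swap
    · simp [hZv, image_eq_zero_of_notMem_tsupport hp]
    have hsm : ContDiff ℝ ∞ fun q => Φ p * ρ (p - q) := by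
      have := h.ρ_smooth; fun_prop
    have hsub : tsupport (fun q => Φ p * ρ (p - q)) ⊆ Metric.closedBall p δ := by
      refine closure_minimal (fun q hq => ?_) Metric.isClosed_closedBall
      rw [Metric.mem_closedBall, dist_comm]
      exact (h.mem_of_kernel_ne_zero hq).2
    have hc : HasCompactSupport fun q => Φ p * ρ (p - q) :=
      (isCompact_closedBall p δ).of_isClosed_subset (isClosed_tsupport _) hsub
    have hsupp : tsupport (fun q => Φ p * ρ (p - q)) ⊆ Ioo 0 T ×ˢ univ := fun q hq =>
      h.Φ_support p hp q (by rw [dist_comm]; exact hsub hq)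
    refine (h.hv.ineq (u p) _ hsm hc hsupp
      fun p => mul_nonneg (h.Φ_nonneg _) (h.ρ_nonneg _)).trans_eq ?_
    refine integral_congr_ae (ae_of_all _ fun q => ?_)
    simp only [hZv, timeDeriv_kernel_right h.ρ_smooth, spaceDeriv_kernel_right h.ρ_smooth,
      realSign_sub_comm (v q), abs_sub_comm (v q)]
    ring
  -- The terms with the time derivative of ρ cancel. The term b(q)(g(u) - g(v)) ∂_xΦ ρ is added and
  -- subtracted, so that the flux mismatch multiplies the full x-derivative of the kernel.
  refine (add_nonneg hu0 hv0).trans_eq ?_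
  rw [← integral_add hZui hZvi]
  refine integral_congr_ae (ae_of_all _ fun z => ?_)
  simp only [hZu, hZv]
  ring

end DoublingSetup

variable {T K A A' : ℝ} {f g : ℝ → ℝ} {a a' r u b b' s v Φ ρ : ℝ × ℝ → ℝ}

namespace DoublingSetup

variable {δ : ℝ} (h : DoublingSetup T K A A' f g a a' r u b b' s v Φ ρ δ)
include h

/-- Integration by parts in the principal term, using the bounded variation of `u` in space. -/
theorem flux_ineq (ha : ∀ t x, HasDerivAt (fun y => a (t, y)) (a' (t, x)) x)
    {B d Λ κ : ℝ} (hB : ∀ h : ℝ, 0 < h → ∫ p, |u (p - (0, h)) - u p| ≤ B * h)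
    (hd0 : 0 ≤ d) (hfg : ∀ x y, |(f x - g x) - (f y - g y)| ≤ d * |x - y|)
    (hΛ : ∀ p, |a p - b p| ≤ Λ)
    (hκ0 : 0 ≤ κ) (hκ : ∀ p ∈ tsupport Φ, ∀ q, dist p q ≤ δ → |b p - b q| ≤ κ) :
    ∫ z, Real.sign (u z.1 - v z.2) * (a z.1 * (f (u z.1) - f (v z.2))
          - b z.2 * (g (u z.1) - g (v z.2)))
        * (spaceDeriv Φ z.1 * ρ (z.1 - z.2) + Φ z.1 * spaceDeriv ρ (z.1 - z.2)) ∂pairVolume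
      ≤ -(∫ z, Real.sign (u z.1 - v z.2) * (a' z.1 * (f (u z.1) - f (v z.2)))
          * (Φ z.1 * ρ (z.1 - z.2)) ∂pairVolume) + (A * d + K * (Λ + 2 * κ)) * B := by
  obtain ⟨mΦ, mρ, -⟩ := h.measurables
  have mu := h.hu.u_meas
  have mv := h.hv.u_meas
  have ma := h.hu.a_cont.measurable
  have mb := h.hv.a_cont.measurable
  have ma' := h.hu.a'_cont.measurable
  have mf := h.hu.f_meas
  have mg := h.hv.f_meas
  have hK := h.hu.K_nonneg
  have hA := h.hu.A_nonneg
  have mS := h.sign_measurable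
  have hΛ0 : 0 ≤ Λ := (abs_nonneg _).trans (hΛ 0)
  have hψi := integrable_convolution_left h.Φ_int h.ρ_int
  set F : (ℝ × ℝ) × (ℝ × ℝ) → ℝ := fun z => Real.sign (u z.1 - v z.2) *
    (a z.1 * (f (u z.1) - f (v z.2)) - b z.2 * (g (u z.1) - g (v z.2))) with hF
  have mF : Measurable F := mS.mul (by fun_prop)
  have hFC : ∀ z, |F z| ≤ A * K + A * K := by
    intro z
    rw [hF, abs_mul]
    refine (mul_le_of_le_one_left (abs_nonneg _) (abs_realSign_le _)).trans ?_
    refine (abs_sub _ _).trans (add_le_add ?_ ?_)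
    · rw [abs_mul]
      exact mul_le_mul (h.hu.a_le _) (h.hu.abs_f_sub_le (h.hu.u_range _) (h.hv.u_range _))
        (abs_nonneg _) hA
    · rw [abs_mul]
      exact mul_le_mul (h.hv.a_le _) (h.hv.abs_f_sub_le (h.hu.u_range _) (h.hv.u_range _))
        (abs_nonneg _) hA
  -- As u has no pointwise derivative, the integration by parts is carried out on difference
  -- quotients in the space coordinate of p.
  have hlim := tendsto_integral_diff_quotient pairVolume mF hFC
    (contDiff_doublingKernel h.Φ_smooth h.ρ_smooth)
    (hasCompactSupport_doublingKernel h.Φ_compact h.ρ_compact) ((0, 1), 0)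
  simp_rw [fderiv_doublingKernel h.Φ_smooth h.ρ_smooth] at hlim
  have haL : ∀ (p : ℝ × ℝ) (k : ℝ), |a (p - (0, k)) - a p| ≤ A' * |k| := by
    intro p k
    have := Convex.norm_image_sub_le_of_norm_hasDerivWithin_le (f := fun y => a (p.1, y))
      (f' := fun y => a' (p.1, y)) (C := A') (s := univ) (x := p.2) (y := p.2 - k)
      (fun y _ => (ha p.1 y).hasDerivWithinAt) (fun y _ => h.hu.a'_le _) convex_univ
      (mem_univ _) (mem_univ _)
    simpa [Real.norm_eq_abs, Prod.sub_def] using this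
  -- `G k` is the part of the quotient that falls on the coefficient a; it converges to the term
  -- with -a'.
  set G : ℝ → (ℝ × ℝ) × (ℝ × ℝ) → ℝ := fun k z => Real.sign (u z.1 - v z.2) *
    ((k⁻¹ * (a (z.1 - (0, k)) - a z.1)) * (f (u z.1) - f (v z.2))) * (Φ z.1 * ρ (z.1 - z.2)) with hG
  have hGle : ∀ k : ℝ, 0 < k → ∀ z, ‖G k z‖ ≤ A' * K * (Φ z.1 * ρ (z.1 - z.2)) := by
    intro k hk z
    rw [hG, norm_mul, Real.norm_of_nonneg (mul_nonneg (h.Φ_nonneg _) (h.ρ_nonneg _))]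
    refine mul_le_mul_of_nonneg_right ?_ (mul_nonneg (h.Φ_nonneg _) (h.ρ_nonneg _))
    rw [Real.norm_eq_abs, abs_mul, abs_mul, abs_mul, abs_inv, abs_of_pos hk]
    refine (mul_le_of_le_one_left (by positivity) (abs_realSign_le _)).trans ?_
    refine mul_le_mul ?_ (h.hu.abs_f_sub_le (h.hu.u_range _) (h.hv.u_range _)) (abs_nonneg _)
      h.hu.A'_nonneg
    rw [inv_mul_le_iff₀ hk, mul_comm]
    have := haL z.1 k
    rwa [abs_of_pos hk] at this
  have mG : ∀ k, Measurable (G k) := fun k => (mS.mul (by fun_prop)).mul (by fun_prop)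
  have hGi : ∀ k, 0 < k → Integrable (G k) pairVolume := fun k hk =>
    (hψi.const_mul _).mono' (mG k).aestronglyMeasurable (ae_of_all _ (hGle k hk))
  have hGlim : Tendsto (fun k => ∫ z, G k z ∂pairVolume) (𝓝[>] 0)
      (𝓝 (-(∫ z, Real.sign (u z.1 - v z.2) * (a' z.1 * (f (u z.1) - f (v z.2)))
          * (Φ z.1 * ρ (z.1 - z.2)) ∂pairVolume))) := by
    rw [← integral_neg]
    refine tendsto_integral_filter_of_dominated_convergence _
      (Eventually.of_forall fun k => (mG k).aestronglyMeasurable)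
      (eventually_mem_nhdsWithin.mono fun k hk => ae_of_all _ (hGle k hk))
      (hψi.const_mul _) (ae_of_all _ fun z => ?_)
    have h1 : HasDerivAt (fun k => a (z.1.1, z.1.2 - k)) (-a' z.1) 0 := by
      have := (ha z.1.1 (z.1.2 - 0)).comp_const_sub z.1.2 0
      simpa using this
    have h2 := h1.tendsto_slope_zero_right
    have h3 : Tendsto (fun k : ℝ => k⁻¹ * (a (z.1 - (0, k)) - a z.1)) (𝓝[>] 0) (𝓝 (-a' z.1)) := by
      refine h2.congr fun k => ?_
      simp [Prod.sub_def]
    have h4 := ((h3.mul_const (f (u z.1) - f (v z.2))).const_mul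
      (Real.sign (u z.1 - v z.2))).mul_const (Φ z.1 * ρ (z.1 - z.2))
    convert h4 using 2
    ring
  set L := A * d + K * (Λ + 2 * κ) with hL
  have hdu : ∀ k : ℝ, Integrable (fun p => |u (p - (0, k)) - u p|) := fun k =>
    ((h.hu.u_int.comp_sub_right (0, k)).sub h.hu.u_int).abs
  have hdi : ∀ k : ℝ, Integrable (fun z : (ℝ × ℝ) × (ℝ × ℝ) =>
      |u (z.1 - (0, k)) - u z.1| * ρ (z.1 - z.2)) pairVolume := fun k =>
    integrable_convolution_left (hdu k) h.ρ_int
  have hL0 : 0 ≤ L := by positivity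
  refine le_of_tendsto_of_tendsto hlim (hGlim.add_const (L * B)) ?_
  -- The shift k < δ keeps the moved point p' within the range in which b oscillates by at most κ.
  filter_upwards [Ioo_mem_nhdsGT h.δ_pos] with k hk
  have hk0 := hk.1
  have hpt : ∀ z : (ℝ × ℝ) × (ℝ × ℝ),
      k⁻¹ * (F (z - k • ((0, 1), 0)) - F z) * (Φ z.1 * ρ (z.1 - z.2))
        ≤ G k z + L * k⁻¹ * (|u (z.1 - (0, k)) - u z.1| * ρ (z.1 - z.2)) := by
    rintro ⟨p, q⟩
    have hsh : ((p, q) - k • (((0 : ℝ), (1 : ℝ)), ((0 : ℝ), (0 : ℝ))) : (ℝ × ℝ) × (ℝ × ℝ))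
        = (p - (0, k), q) := by
      ext <;> simp
    by_cases hz : Φ p * ρ (p - q) = 0
    · simp only [hG, hz, mul_zero, zero_add]
      have := h.ρ_nonneg (p - q)
      positivity
    obtain ⟨hp, hq⟩ := h.mem_of_kernel_ne_zero hz
    have h0 := h.Φ_nonneg p
    have h0' := h.ρ_nonneg (p - q)
    change k⁻¹ * (F ((p, q) - k • (((0 : ℝ), (1 : ℝ)), ((0 : ℝ), (0 : ℝ)))) - F (p, q))
      * (Φ p * ρ (p - q)) ≤ G k (p, q) + L * k⁻¹ * (|u (p - (0, k)) - u p| * ρ (p - q))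
    rw [hsh]
    set p' := p - (0, k) with hp'
    have hpp' : dist p p' ≤ δ := by
      rw [hp', dist_self_sub_right]
      simpa [Prod.norm_def, abs_of_pos hk0, hk0.le] using hk.2.le
    -- With the coefficients frozen at a(p') and b(q), the mismatch is one Lipschitz function of the
    -- density with constant L, and the Kruzhkov sign preserves that constant.
    have hLip : |Real.sign (u p' - v q) * ((a p' * f (u p') - b q * g (u p'))
          - (a p' * f (v q) - b q * g (v q)))
        - Real.sign (u p - v q) * ((a p' * f (u p) - b q * g (u p))
          - (a p' * f (v q) - b q * g (v q)))| ≤ L * |u p' - u p| := by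
      refine abs_sign_mul_sub_le (G := fun w => a p' * f w - b q * g w) (fun x y => ?_) _ _ _
      have e : a p' * f x - b q * g x - (a p' * f y - b q * g y)
          = a p' * ((f x - g x) - (f y - g y)) + (a p' - b q) * (g x - g y) := by ring
      rw [e]
      have e1 : |a p' - b q| ≤ Λ + 2 * κ := by
        -- Only a - b at a common point is controlled by Λ. Passing from b(p') to b(q) through b(p)
        -- costs 2κ.
        have e2 : a p' - b q = (a p' - b p') - (b p - b p') + (b p - b q) := by ring
        rw [e2]
        refine (abs_add_le _ _).trans ?_
        have := abs_sub (a p' - b p') (b p - b p')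
        have := hΛ p'
        have := hκ p hp p' hpp'
        have := hκ p hp q hq
        linarith
      calc _ ≤ |a p'| * |(f x - g x) - (f y - g y)| + |a p' - b q| * |g x - g y| := by
            rw [← abs_mul, ← abs_mul]; exact abs_add_le _ _
        _ ≤ A * (d * |x - y|) + (Λ + 2 * κ) * (K * |x - y|) := by
            refine add_le_add (mul_le_mul (h.hu.a_le _) (hfg x y) (abs_nonneg _) hA)
              (mul_le_mul e1 (h.hv.f_lip x y) (abs_nonneg _) (by positivity))
        _ = L * |x - y| := by rw [hL]; ring
    have hsplit : F (p', q) - F (p, q) =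
        (Real.sign (u p' - v q) * ((a p' * f (u p') - b q * g (u p'))
          - (a p' * f (v q) - b q * g (v q)))
        - Real.sign (u p - v q) * ((a p' * f (u p) - b q * g (u p))
          - (a p' * f (v q) - b q * g (v q))))
        + Real.sign (u p - v q) * ((a p' - a p) * (f (u p) - f (v q))) := by
      simp only [hF]; ring
    have hle := (le_abs_self _).trans hLip
    have hΦ1 : Φ p * ρ (p - q) ≤ ρ (p - q) := mul_le_of_le_one_left h0' (h.Φ_le_one p)
    calc k⁻¹ * (F (p', q) - F (p, q)) * (Φ p * ρ (p - q))
        ≤ k⁻¹ * (L * |u p' - u p| + Real.sign (u p - v q) * ((a p' - a p) * (f (u p) - f (v q))))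
            * (Φ p * ρ (p - q)) := by
          rw [hsplit]; gcongr
      _ = G k (p, q) + L * k⁻¹ * (|u p' - u p| * (Φ p * ρ (p - q))) := by
          simp only [hG]; ring
      _ ≤ G k (p, q) + L * k⁻¹ * (|u p' - u p| * ρ (p - q)) := by gcongr
  have hFi : Integrable (fun z : (ℝ × ℝ) × (ℝ × ℝ) =>
      k⁻¹ * (F (z - k • ((0, 1), 0)) - F z) * (Φ z.1 * ρ (z.1 - z.2))) pairVolume := by
    refine hψi.bdd_mul (c := k⁻¹ * ((A * K + A * K) + (A * K + A * K)))
      ((((mF.comp (measurable_id.sub_const _)).sub mF).const_mul _).aestronglyMeasurable)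
      (ae_of_all _ fun z => ?_)
    rw [norm_mul, norm_inv, Real.norm_of_nonneg hk0.le]
    exact mul_le_mul_of_nonneg_left ((abs_sub _ _).trans (add_le_add (hFC _) (hFC _)))
      (inv_nonneg.2 hk0.le)
  calc _ ≤ ∫ z, (G k z + L * k⁻¹ * (|u (z.1 - (0, k)) - u z.1| * ρ (z.1 - z.2))) ∂pairVolume :=
        integral_mono hFi ((hGi k hk0).add ((hdi k).const_mul _)) hpt
    _ = ∫ z, G k z ∂pairVolume + L * k⁻¹ * (∫ p, |u (p - (0, k)) - u p|) := by
        rw [integral_add (hGi k hk0) ((hdi k).const_mul _), integral_const_mul,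
          integral_convolution_left (hdu k) h.ρ_int, h.ρ_integral, mul_one]
    _ ≤ ∫ z, G k z ∂pairVolume + L * k⁻¹ * (B * k) := by
        have := hB k hk0
        gcongr
    _ = ∫ z, G k z ∂pairVolume + L * B := by field_simp

/-- The doubled entropy inequalities with all errors made explicit. -/
theorem estimate (ha : ∀ t x, HasDerivAt (fun y => a (t, y)) (a' (t, x)) x)
    {B d Λ Λ' κ C₁ C₂ : ℝ} (hB : ∀ h : ℝ, 0 < h → ∫ p, |u (p - (0, h)) - u p| ≤ B * h)
    (hd0 : 0 ≤ d) (hfg : ∀ x y, |(f x - g x) - (f y - g y)| ≤ d * |x - y|)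
    (hΛ : ∀ p, |a p - b p| ≤ Λ) (hΛ' : ∀ p, |a' p - b' p| ≤ Λ') (hκ0 : 0 ≤ κ)
    (hκ : ∀ p ∈ tsupport Φ, ∀ q, dist p q ≤ δ → |b p - b q| ≤ κ)
    (hκ' : ∀ p ∈ tsupport Φ, ∀ q, dist p q ≤ δ → |b' p - b' q| ≤ κ)
    (hC₁ : ∀ p, |timeDeriv Φ p| ≤ C₁) (hC₂ : ∀ p, |spaceDeriv Φ p| ≤ C₂) :
    0 ≤ (∫ p, |u p - v p| * timeDeriv Φ p) + A * K * (∫ p, |u p - v p| * |spaceDeriv Φ p|)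
      + (A * d + K * (Λ + 2 * κ)) * B + (A' * d + K * (Λ' + κ)) * (∫ p, u p)
      + (∫ p, |r p - s p|)
      + (C₁ + A * K * C₂) * (∫ z, |v z.1 - v z.2| * ρ (z.1 - z.2) ∂pairVolume)
      + ∫ z, |s z.1 - s z.2| * ρ (z.1 - z.2) ∂pairVolume := by
  have i1 := integrable_convolution_left (integrable_timeDeriv h.Φ_smooth h.Φ_compact) h.ρ_int
  have i3 := integrable_convolution_left (integrable_spaceDeriv h.Φ_smooth h.Φ_compact) h.ρ_int
  have i4 := integrable_convolution_left h.Φ_int (integrable_spaceDeriv h.ρ_smooth h.ρ_compact)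
  have i5 := integrable_convolution_left h.Φ_int h.ρ_int
  obtain ⟨mΦ, mρ, mΦt, mΦx, -⟩ := h.measurables
  have mu := h.hu.u_meas
  have mv := h.hv.u_meas
  have ms := h.hv.r_meas
  have hK := h.hu.K_nonneg
  have hA := h.hu.A_nonneg
  have hA' := h.hu.A'_nonneg
  have hΛ0' : 0 ≤ Λ' := (abs_nonneg _).trans (hΛ' 0)
  have j1 := h.integrable_abs_mul i1
  have j2 := h.integrable_flux_right i3
  have j3 := h.integrable_source_left.sub h.integrable_source_right
  have j4 := h.integrable_grad_right i5
  have j5 := h.integrable_grad_left h.hv.u_meas h.hv.u_range measurable_snd i5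
  have j6 := h.integrable_grad_left h.hu.u_meas h.hu.u_range measurable_fst i5
  have j7 : Integrable (fun z => Real.sign (u z.1 - v z.2) * (a z.1 * (f (u z.1) - f (v z.2))
          - b z.2 * (g (u z.1) - g (v z.2)))
        * (spaceDeriv Φ z.1 * ρ (z.1 - z.2) + Φ z.1 * spaceDeriv ρ (z.1 - z.2))) pairVolume :=
    ((h.integrable_flux_left (i3.add i4)).sub (h.integrable_flux_right (i3.add i4))).congr
      (ae_of_all _ fun z => by simp only [Pi.sub_apply, Pi.add_apply]; ring)
  have j8 : Integrable (fun z => Real.sign (u z.1 - v z.2) * (a' z.1 * (f (u z.1) - f (v z.2)))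
      * (Φ z.1 * ρ (z.1 - z.2))) pairVolume :=
    (j6.sub j5).congr (ae_of_all _ fun z => by simp only [Pi.sub_apply]; ring)
  have h1 := h.doubled_ineq
  have h2 := h.flux_ineq ha hB hd0 hfg hΛ hκ0 hκ
  -- This collects every term of `doubled_ineq` except the flux mismatch. The latter is replaced by
  -- the bound of `flux_ineq`, whose a' term is then merged into the same integrand.
  have jY0 := ((j1.add j2).add j3).add (j4.sub j5)
  have h3 := integral_add jY0 j7
  have h4 := integral_sub jY0 j8
  simp only [Pi.add_apply, Pi.sub_apply] at h3 h4
  rw [h3] at h1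
  have h5 := (h1.trans (add_le_add_right h2 _))
  rw [← add_assoc, ← sub_eq_add_neg, ← h4] at h5
  have hv1 : Integrable (fun z : (ℝ × ℝ) × (ℝ × ℝ) => |v z.1 - v z.2| * ρ (z.1 - z.2))
      pairVolume := by
    refine Integrable.mono' ((integrable_convolution_left h.hv.u_int.abs h.ρ_int).add
      (integrable_convolution_right h.hv.u_int.abs h.ρ_int)) (by fun_prop) (ae_of_all _ fun z => ?_)
    simp only [Pi.add_apply]
    rw [Real.norm_eq_abs, abs_mul, abs_abs, abs_of_nonneg (h.ρ_nonneg _), ← add_mul]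
    exact mul_le_mul_of_nonneg_right (abs_sub _ _) (h.ρ_nonneg _)
  have hs1 : Integrable (fun z : (ℝ × ℝ) × (ℝ × ℝ) => |s z.1 - s z.2| * ρ (z.1 - z.2))
      pairVolume := by
    refine Integrable.mono' ((integrable_convolution_left h.hv.r_int.abs h.ρ_int).add
      (integrable_convolution_right h.hv.r_int.abs h.ρ_int)) (by fun_prop) (ae_of_all _ fun z => ?_)
    simp only [Pi.add_apply]
    rw [Real.norm_eq_abs, abs_mul, abs_abs, abs_of_nonneg (h.ρ_nonneg _), ← add_mul]
    exact mul_le_mul_of_nonneg_right (abs_sub _ _) (h.ρ_nonneg _)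
  have k1 : Integrable fun p => |u p - v p| * timeDeriv Φ p :=
    (integrable_timeDeriv h.Φ_smooth h.Φ_compact).bdd_mul (c := 1) (by fun_prop)
      (ae_of_all _ fun p => by
        simpa using abs_sub_le_one_of_mem (h.hu.u_range p) (h.hv.u_range p))
  have k2 : Integrable fun p => |u p - v p| * |spaceDeriv Φ p| :=
    (integrable_spaceDeriv h.Φ_smooth h.Φ_compact).abs.bdd_mul (c := 1) (by fun_prop)
      (ae_of_all _ fun p => by
        simpa using abs_sub_le_one_of_mem (h.hu.u_range p) (h.hv.u_range p))
  have k3 : Integrable fun p => |r p - s p| := (h.hu.r_int.sub h.hv.r_int).abs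
  have k4 := ((k1.add (k2.const_mul (A * K))).add
    (h.hu.u_int.const_mul (A' * d + K * (Λ' + κ)))).add k3
  have k5 := integrable_convolution_left k4 h.ρ_int
  have k6 := (k5.add (hv1.const_mul (C₁ + A * K * C₂))).add hs1
  -- In this pointwise bound q survives only in ρ and in the mollification errors of v and s;
  -- everything else is a function of p times ρ and integrates exactly.
  have h6 : ∀ z : (ℝ × ℝ) × (ℝ × ℝ), _ ≤ _ := fun z =>
    show (|u z.1 - v z.2| * (timeDeriv Φ z.1 * ρ (z.1 - z.2))
      + Real.sign (u z.1 - v z.2) * (b z.2 * (g (u z.1) - g (v z.2)))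
        * (spaceDeriv Φ z.1 * ρ (z.1 - z.2))
      + (Real.sign (u z.1 - v z.2) * r z.1 * (Φ z.1 * ρ (z.1 - z.2))
        - Real.sign (u z.1 - v z.2) * s z.2 * (Φ z.1 * ρ (z.1 - z.2)))
      + (Real.sign (u z.1 - v z.2) * (g (u z.1) * b' z.2) * (Φ z.1 * ρ (z.1 - z.2))
        - Real.sign (u z.1 - v z.2) * (f (v z.2) * a' z.1) * (Φ z.1 * ρ (z.1 - z.2))))
      - Real.sign (u z.1 - v z.2) * (a' z.1 * (f (u z.1) - f (v z.2)))
          * (Φ z.1 * ρ (z.1 - z.2))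
      ≤ (|u z.1 - v z.1| * timeDeriv Φ z.1 + A * K * (|u z.1 - v z.1| * |spaceDeriv Φ z.1|)
        + (A' * d + K * (Λ' + κ)) * u z.1 + |r z.1 - s z.1|) * ρ (z.1 - z.2)
        + (C₁ + A * K * C₂) * (|v z.1 - v z.2| * ρ (z.1 - z.2))
        + |s z.1 - s z.2| * ρ (z.1 - z.2) by
    obtain ⟨p, q⟩ := z
    simp only
    have hρ0 := h.ρ_nonneg (p - q)
    by_cases hz : ρ (p - q) = 0
    · simp [hz]
    have hpq : dist p q ≤ δ := by
      by_contra hd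
      exact hz (h.ρ_zero _ (by rw [← dist_eq_norm]; exact (not_le.1 hd).le))
    have hS := abs_realSign_le (u p - v q)
    have hSu := realSign_mul_self (u p - v q)
    set S := Real.sign (u p - v q)
    have hvv : |(|u p - v q| - |u p - v p|)| ≤ |v p - v q| := by
      refine (abs_abs_sub_abs_le_abs_sub _ _).trans_eq ?_
      rw [show u p - v q - (u p - v p) = v p - v q by ring]
    have t1 : |u p - v q| * timeDeriv Φ p
        ≤ |u p - v p| * timeDeriv Φ p + C₁ * |v p - v q| := by
      have : (|u p - v q| - |u p - v p|) * timeDeriv Φ p ≤ |v p - v q| * C₁ := by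
        refine (le_abs_self _).trans ?_
        rw [abs_mul]
        exact mul_le_mul hvv (hC₁ p) (abs_nonneg _) (abs_nonneg _)
      linarith
    have t2 : S * (b q * (g (u p) - g (v q))) * spaceDeriv Φ p
        ≤ A * K * (|u p - v p| * |spaceDeriv Φ p|) + A * K * C₂ * |v p - v q| := by
      have e1 : S * (b q * (g (u p) - g (v q))) * spaceDeriv Φ p
          ≤ 1 * (A * (K * |u p - v q|)) * |spaceDeriv Φ p| := by
        refine (le_abs_self _).trans ?_
        rw [abs_mul, abs_mul, abs_mul]
        have := h.hv.a_le q
        have := h.hv.f_lip (u p) (v q)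
        gcongr
      have e2 : |u p - v q| ≤ |u p - v p| + |v p - v q| := abs_sub_le _ _ _
      have e3 : A * K * |u p - v q| * |spaceDeriv Φ p|
          ≤ A * K * (|u p - v p| + |v p - v q|) * |spaceDeriv Φ p| := by gcongr
      have e4 : A * K * |v p - v q| * |spaceDeriv Φ p| ≤ A * K * |v p - v q| * C₂ := by
        have := hC₂ p
        gcongr
      linarith
    have hΦ0 := h.Φ_nonneg p
    have hΦ1 := h.Φ_le_one p
    have t3 : S * (r p - s q) * Φ p ≤ |r p - s p| + |s p - s q| := by
      refine (le_abs_self _).trans ?_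
      rw [abs_mul, abs_mul, abs_of_nonneg hΦ0]
      calc |S| * |r p - s q| * Φ p ≤ 1 * |r p - s q| * 1 := by gcongr
        _ ≤ _ := by simpa using abs_sub_le _ _ _
    -- The a' term from the integration by parts has cancelled f(v(q)). The rest vanishes with u(p),
    -- because f(0) = g(0) = 0, which explains the factor u(p).
    have t4 : S * (g (u p) * b' q - f (u p) * a' p) * Φ p
        ≤ (A' * d + K * (Λ' + κ)) * u p := by
      by_cases hp : p ∈ tsupport Φ
      swap
      · rw [image_eq_zero_of_notMem_tsupport hp, mul_zero]
        have := (h.hu.u_range p).1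
        positivity
      have hu0 := (h.hu.u_range p).1
      have e1 : |f (u p) - g (u p)| ≤ d * u p := by
        have := hfg (u p) 0
        rwa [h.hu.f_zero, h.hv.f_zero, sub_zero, sub_zero, sub_zero, abs_of_nonneg hu0] at this
      have e2 : |f (u p)| ≤ K * u p := by
        have := h.hu.f_lip (u p) 0
        rwa [h.hu.f_zero, sub_zero, sub_zero, abs_of_nonneg hu0] at this
      have e3 : |a' p - b' q| ≤ Λ' + κ :=
        (abs_sub_le _ (b' p) _).trans (add_le_add (hΛ' p) (hκ' p hp q hpq))
      have e4 : |g (u p) * b' q - f (u p) * a' p| ≤ (A' * d + K * (Λ' + κ)) * u p := by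
        have e5 : g (u p) * b' q - f (u p) * a' p
            = -((f (u p) - g (u p)) * b' q) - f (u p) * (a' p - b' q) := by ring
        rw [e5]
        refine (abs_sub _ _).trans ?_
        rw [abs_neg, abs_mul, abs_mul]
        have := h.hv.a'_le q
        calc _ ≤ d * u p * A' + K * u p * (Λ' + κ) := by gcongr
          _ = _ := by ring
      refine (le_abs_self _).trans ?_
      rw [abs_mul, abs_mul, abs_of_nonneg hΦ0]
      calc |S| * |g (u p) * b' q - f (u p) * a' p| * Φ p
          ≤ 1 * |g (u p) * b' q - f (u p) * a' p| * 1 := by gcongr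
        _ ≤ _ := by simpa using e4
    have t5 := mul_le_mul_of_nonneg_right (add_le_add (add_le_add t1 t2) (add_le_add t3 t4)) hρ0
    refine le_trans (le_of_eq ?_) (t5.trans (le_of_eq ?_)) <;> ring
  have h7 := integral_mono (jY0.sub j8) k6 h6
  have h8 := integral_add (k5.add (hv1.const_mul (C₁ + A * K * C₂))) hs1
  have h9 := integral_add k5 (hv1.const_mul (C₁ + A * K * C₂))
  have h10 := integral_convolution_left k4 h.ρ_int
  have h11 := integral_add ((k1.add (k2.const_mul (A * K))).add
    (h.hu.u_int.const_mul (A' * d + K * (Λ' + κ)))) k3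
  have h12 := integral_add (k1.add (k2.const_mul (A * K)))
    (h.hu.u_int.const_mul (A' * d + K * (Λ' + κ)))
  have h13 := integral_add k1 (k2.const_mul (A * K))
  simp only [Pi.add_apply, Pi.sub_apply, integral_const_mul, h.ρ_integral, mul_one]
    at h7 h8 h9 h10 h11 h12 h13 h5
  linarith

end DoublingSetup

/-- Near a compact set continuous functions oscillate little at small scales. -/
theorem exists_forall_dist_le_abs_sub_le {b : ℝ × ℝ → ℝ} (hb : Continuous b) {S : Set (ℝ × ℝ)}
    (hS : IsCompact S) {η : ℝ} (hη : 0 < η) :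
    ∃ δ > 0, ∀ p ∈ S, ∀ q, dist p q < δ → |b p - b q| ≤ η := by
  have h := hS.uniformContinuousAt_of_continuousAt b (fun p _ => hb.continuousAt)
    (Metric.dist_mem_uniformity hη)
  obtain ⟨δ, hδ, h'⟩ := Metric.mem_uniformity_dist.1 h
  exact ⟨δ, hδ, fun p hp q hpq => (h' hpq hp).le⟩

/-! ### Kato inequality: removal of the mollifier and of the cutoff in space. -/

section Kato

variable {T K A A' : ℝ} {f g : ℝ → ℝ} {a a' r u b b' s v Φ : ℝ × ℝ → ℝ}

/-- The Kato inequality for two solutions of scalar balance laws with different coefficients. -/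
theorem kato_ineq (hu : ScalarSolution T K A A' f a a' r u)
    (hv : ScalarSolution T K A A' g b b' s v)
    (ha : ∀ t x, HasDerivAt (fun y => a (t, y)) (a' (t, x)) x)
    {B d Λ Λ' : ℝ} (hB : ∀ h : ℝ, 0 < h → ∫ p, |u (p - (0, h)) - u p| ≤ B * h)
    (hd0 : 0 ≤ d) (hfg : ∀ x y, |(f x - g x) - (f y - g y)| ≤ d * |x - y|)
    (hΛ : ∀ p, |a p - b p| ≤ Λ) (hΛ' : ∀ p, |a' p - b' p| ≤ Λ')
    (hΦ : ContDiff ℝ ∞ Φ) (hΦc : HasCompactSupport Φ) (hΦs : tsupport Φ ⊆ Ioo 0 T ×ˢ univ)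
    (hΦ0 : ∀ p, 0 ≤ Φ p) (hΦ1 : ∀ p, Φ p ≤ 1) :
    0 ≤ (∫ p, |u p - v p| * timeDeriv Φ p) + A * K * (∫ p, |u p - v p| * |spaceDeriv Φ p|)
      + ((A * d + K * Λ) * B + (A' * d + K * Λ') * (∫ p, u p) + ∫ p, |r p - s p|) := by
  obtain ⟨C₁, hC₁⟩ := (hasCompactSupport_timeDeriv hΦ hΦc).exists_bound_of_continuous
    (continuous_timeDeriv hΦ)
  obtain ⟨C₂, hC₂⟩ := (hasCompactSupport_spaceDeriv hΦ hΦc).exists_bound_of_continuous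
    (continuous_spaceDeriv hΦ)
  have hC₁0 : 0 ≤ C₁ := (norm_nonneg _).trans (hC₁ 0)
  have hC₂0 : 0 ≤ C₂ := (norm_nonneg _).trans (hC₂ 0)
  have hK := hu.K_nonneg
  have hA := hu.A_nonneg
  set X := (∫ p, |u p - v p| * timeDeriv Φ p) + A * K * (∫ p, |u p - v p| * |spaceDeriv Φ p|)
      + ((A * d + K * Λ) * B + (A' * d + K * Λ') * (∫ p, u p) + ∫ p, |r p - s p|) with hX
  -- A single η bounds the oscillation κ and the mollification errors of v and s; the bracket
  -- collects the coefficients with which these enter `DoublingSetup.estimate`.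
  have key : ∀ η > 0, 0 ≤ X + η * (2 * K * B + K * (∫ p, u p) + (C₁ + A * K * C₂) + 1) := by
    intro η hη
    obtain ⟨δ₁, hδ₁, h₁⟩ := exists_forall_dist_le_abs_sub_le hv.a_cont hΦc hη
    obtain ⟨δ₂, hδ₂, h₂⟩ := exists_forall_dist_le_abs_sub_le hv.a'_cont hΦc hη
    obtain ⟨δ₃, hδ₃, h₃⟩ := exists_integral_mollify_le hv.u_meas hv.u_int hη
    obtain ⟨δ₄, hδ₄, h₄⟩ := exists_integral_mollify_le hv.r_meas hv.r_int hη
    obtain ⟨δ₅, hδ₅, h₅⟩ := hΦc.isCompact.exists_cthickening_subset_open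
      (isOpen_Ioo.prod isOpen_univ) hΦs
    -- The five thresholds come from the oscillation of b, that of b', the mollification of v, that
    -- of s, and the distance of the support of Φ from the boundary of the strip.
    obtain ⟨δ, hδ, hδ'⟩ : ∃ δ > 0, δ < δ₁ ∧ δ < δ₂ ∧ δ < δ₃ ∧ δ < δ₄ ∧ δ < δ₅ := by
      obtain ⟨δ, h1, h2⟩ := exists_between
        (lt_min hδ₁ (lt_min hδ₂ (lt_min hδ₃ (lt_min hδ₄ hδ₅))))
      exact ⟨δ, h1, by simpa [lt_min_iff] using h2⟩
    obtain ⟨d1, d2, d3, d4, d5⟩ := hδ'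
    let φ : ContDiffBump (0 : ℝ × ℝ) := ⟨δ / 2, δ, by positivity, by linarith⟩
    have hρz : ∀ z, δ ≤ ‖z‖ → φ.normed volume z = 0 := by
      intro z hz
      have : z ∉ Function.support (φ.normed volume) := by
        rw [φ.support_normed_eq, mem_ball_zero_iff]
        exact not_lt.2 hz
      simpa using this
    have H : DoublingSetup T K A A' f g a a' r u b b' s v Φ (φ.normed volume) δ :=
      { hu := hu, hv := hv, Φ_smooth := hΦ, Φ_compact := hΦc, Φ_nonneg := hΦ0, Φ_le_one := hΦ1
        ρ_smooth := φ.contDiff_normed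
        ρ_compact := φ.hasCompactSupport_normed
        ρ_nonneg := φ.nonneg_normed
        ρ_integral := φ.integral_normed
        ρ_zero := hρz
        δ_pos := hδ
        Φ_support := fun p hp q hpq => h₅ (Metric.mem_cthickening_of_dist_le q p _ _ hp
          (by rw [dist_comm]; linarith)) }
    have e := H.estimate ha hB hd0 hfg hΛ hΛ' hη.le
      (fun p hp q hpq => h₁ p hp q (by linarith)) (fun p hp q hpq => h₂ p hp q (by linarith))
      hC₁ hC₂
    have e3 := h₃ _ φ.continuous_normed φ.hasCompactSupport_normed φ.nonneg_normed
      φ.integral_normed fun z hz => hρz z (by linarith)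
    have e4 := h₄ _ φ.continuous_normed φ.hasCompactSupport_normed φ.nonneg_normed
      φ.integral_normed fun z hz => hρz z (by linarith)
    have e5 : (C₁ + A * K * C₂) * (∫ z, |v z.1 - v z.2| * φ.normed volume (z.1 - z.2) ∂pairVolume)
        ≤ (C₁ + A * K * C₂) * η := by gcongr
    rw [hX]
    linarith
  have hlim : Tendsto (fun η : ℝ => X + η * (2 * K * B + K * (∫ p, u p) + (C₁ + A * K * C₂) + 1))
      (𝓝[>] 0) (𝓝 (X + 0 * (2 * K * B + K * (∫ p, u p) + (C₁ + A * K * C₂) + 1))) :=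
    ((continuous_id.mul continuous_const).const_add X).continuousAt.tendsto.mono_left
      nhdsWithin_le_nhds
  rw [zero_mul, add_zero] at hlim
  exact ge_of_tendsto hlim (eventually_mem_nhdsWithin.mono fun η hη => key η hη)

/-- The Kato inequality integrated over the whole line. -/
theorem kato_ineq_time (hu : ScalarSolution T K A A' f a a' r u)
    (hv : ScalarSolution T K A A' g b b' s v)
    (ha : ∀ t x, HasDerivAt (fun y => a (t, y)) (a' (t, x)) x)
    {B d Λ Λ' : ℝ} (hB : ∀ h : ℝ, 0 < h → ∫ p, |u (p - (0, h)) - u p| ≤ B * h)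
    (hd0 : 0 ≤ d) (hfg : ∀ x y, |(f x - g x) - (f y - g y)| ≤ d * |x - y|)
    (hΛ : ∀ p, |a p - b p| ≤ Λ) (hΛ' : ∀ p, |a' p - b' p| ≤ Λ')
    {χ : ℝ → ℝ} (hχ : ContDiff ℝ ∞ χ) (hχc : HasCompactSupport χ) (hχs : tsupport χ ⊆ Ioo 0 T)
    (hχ0 : ∀ t, 0 ≤ χ t) (hχ1 : ∀ t, χ t ≤ 1) :
    0 ≤ (∫ p : ℝ × ℝ, |u p - v p| * deriv χ p.1)
      + ((A * d + K * Λ) * B + (A' * d + K * Λ') * (∫ p, u p) + ∫ p, |r p - s p|) := by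
  have mu := hu.u_meas
  have mv := hv.u_meas
  let ϖ : ContDiffBump (0 : ℝ) := ⟨1, 2, one_pos, one_lt_two⟩
  have hϖ : ContDiff ℝ ∞ ϖ := ϖ.contDiff
  obtain ⟨C, hC⟩ := (ϖ.hasCompactSupport.deriv).exists_bound_of_continuous
    (hϖ.continuous_deriv (by simp))
  have hχ' : Continuous (deriv χ) := hχ.continuous_deriv (by simp)
  obtain ⟨C₁, hC₁⟩ := hχc.deriv.exists_bound_of_continuous hχ'
  -- Cutoff in space at scale n + 1: its x-derivative is at most C / (n + 1), so the term with
  -- |∂_xΦ| vanishes in the limit because u - v is integrable.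
  set Φ : ℕ → ℝ × ℝ → ℝ := fun n p => χ p.1 * ϖ (p.2 * ((n : ℝ) + 1)⁻¹) with hΦ
  have hΦt : ∀ n p, timeDeriv (Φ n) p = deriv χ p.1 * ϖ (p.2 * ((n : ℝ) + 1)⁻¹) := by
    intro n p
    simp only [timeDeriv, hΦ]
    exact deriv_mul_const (hχ.differentiable (by simp) _) _
  have hΦx : ∀ n p, spaceDeriv (Φ n) p
      = χ p.1 * (deriv ϖ (p.2 * ((n : ℝ) + 1)⁻¹) * ((n : ℝ) + 1)⁻¹) := by
    intro n p
    have h1 := ((hϖ.differentiable (by simp) (p.2 * ((n : ℝ) + 1)⁻¹)).hasDerivAt.comp p.2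
      ((hasDerivAt_id p.2).mul_const ((n : ℝ) + 1)⁻¹)).const_mul (χ p.1)
    exact h1.deriv.trans (by rw [one_mul])
  have hw : Integrable fun p => |u p - v p| := (hu.u_int.sub hv.u_int).abs
  have hX : ∀ n : ℕ, 0 ≤ (∫ p, |u p - v p| * (deriv χ p.1 * ϖ (p.2 * ((n : ℝ) + 1)⁻¹)))
      + A * K * (C * (∫ p, |u p - v p|) * ((n : ℝ) + 1)⁻¹)
      + ((A * d + K * Λ) * B + (A' * d + K * Λ') * (∫ p, u p) + ∫ p, |r p - s p|) := by
    intro n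
    have hn : (0 : ℝ) < ((n : ℝ) + 1)⁻¹ := by positivity
    have hsub : ∀ p, Φ n p ≠ 0 → p ∈ tsupport χ ×ˢ Icc (-(2 * ((n : ℝ) + 1))) (2 * ((n : ℝ) + 1)) := by
      intro p hp
      refine ⟨subset_tsupport _ (left_ne_zero_of_mul hp), ?_⟩
      have : p.2 * ((n : ℝ) + 1)⁻¹ ∈ Function.support ϖ := right_ne_zero_of_mul hp
      rw [ϖ.support_eq, mem_ball_zero_iff, Real.norm_eq_abs, abs_mul, abs_of_pos hn,
        ← div_eq_mul_inv, div_lt_iff₀ (by positivity)] at this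
      exact abs_le.1 this.le
    have hcl : tsupport (Φ n) ⊆ tsupport χ ×ˢ Icc (-(2 * ((n : ℝ) + 1))) (2 * ((n : ℝ) + 1)) :=
      closure_minimal (fun p hp => hsub p hp) ((isClosed_tsupport χ).prod isClosed_Icc)
    have hc : HasCompactSupport (Φ n) :=
      (hχc.prod isCompact_Icc).of_isClosed_subset (isClosed_tsupport _) hcl
    have h := kato_ineq hu hv ha hB hd0 hfg hΛ hΛ' (Φ := Φ n) (by fun_prop) hc
      (hcl.trans (prod_mono hχs (subset_univ _))) (fun p => mul_nonneg (hχ0 _) ϖ.nonneg)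
      (fun p => mul_le_one₀ (hχ1 _) ϖ.nonneg ϖ.le_one)
    simp_rw [hΦt, hΦx] at h
    refine h.trans ?_
    have hle : ∫ p, |u p - v p| * |χ p.1 * (deriv ϖ (p.2 * ((n : ℝ) + 1)⁻¹) * ((n : ℝ) + 1)⁻¹)|
        ≤ C * (∫ p, |u p - v p|) * ((n : ℝ) + 1)⁻¹ := by
      rw [mul_comm C, mul_assoc, ← integral_mul_const]
      refine integral_mono_of_nonneg (ae_of_all _ fun p => by positivity)
        (hw.mul_const _) (ae_of_all _ fun p => ?_)
      simp only
      refine mul_le_mul_of_nonneg_left ?_ (abs_nonneg _)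
      rw [abs_mul, abs_mul, abs_of_nonneg (hχ0 _), abs_of_pos hn]
      have := hC (p.2 * ((n : ℝ) + 1)⁻¹)
      rw [Real.norm_eq_abs] at this
      calc χ p.1 * (|deriv ϖ (p.2 * ((n : ℝ) + 1)⁻¹)| * ((n : ℝ) + 1)⁻¹)
          ≤ 1 * (C * ((n : ℝ) + 1)⁻¹) := by
            have := hχ1 p.1
            gcongr
        _ = _ := one_mul _
    have := hu.K_nonneg
    have := hu.A_nonneg
    gcongr
  have hinv : Tendsto (fun n : ℕ => ((n : ℝ) + 1)⁻¹) atTop (𝓝 0) := by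
    simpa using tendsto_one_div_add_atTop_nhds_zero_nat (𝕜 := ℝ)
  have hlim1 : Tendsto (fun n : ℕ => ∫ p, |u p - v p| * (deriv χ p.1 * ϖ (p.2 * ((n : ℝ) + 1)⁻¹)))
      atTop (𝓝 (∫ p : ℝ × ℝ, |u p - v p| * deriv χ p.1)) := by
    have mϖ := hϖ.continuous.measurable
    have mχ := hχ'.measurable
    refine tendsto_integral_of_dominated_convergence (fun p => |u p - v p| * C₁)
      (fun n => by fun_prop) (hw.mul_const _) (fun n => ae_of_all _ fun p => ?_)
      (ae_of_all _ fun p => ?_)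
    · rw [norm_mul, norm_mul, Real.norm_eq_abs, abs_abs, Real.norm_of_nonneg ϖ.nonneg]
      refine mul_le_mul_of_nonneg_left ?_ (abs_nonneg _)
      exact (mul_le_of_le_one_right (norm_nonneg _) ϖ.le_one).trans (hC₁ _)
    · have h1 : Tendsto (fun n : ℕ => ϖ (p.2 * ((n : ℝ) + 1)⁻¹)) atTop (𝓝 (ϖ (p.2 * 0))) :=
        (hϖ.continuous.tendsto _).comp (hinv.const_mul p.2)
      have h2 : ϖ (p.2 * 0) = 1 := by
        rw [mul_zero]
        exact ϖ.one_of_mem_closedBall (by simp [ϖ])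
      rw [h2] at h1
      simpa using (h1.const_mul (deriv χ p.1)).const_mul |u p - v p|
  have hlim2 := (hlim1.add ((hinv.const_mul (C * ∫ p, |u p - v p|)).const_mul (A * K))).add_const
    ((A * d + K * Λ) * B + (A' * d + K * Λ') * (∫ p, u p) + ∫ p, |r p - s p|)
  simp only [mul_zero, add_zero] at hlim2
  exact ge_of_tendsto' hlim2 hX

end Kato

/-! ### Cutoffs in time -/

/-- A smooth cutoff of the interval `[t₁, t₂]` whose derivative is a difference of mollifiers. -/
theorem exists_time_cutoff (φ : ContDiffBump (0 : ℝ)) {t₁ t₂ : ℝ} (ht : t₁ ≤ t₂) :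
    ∃ χ : ℝ → ℝ, ContDiff ℝ ∞ χ ∧ tsupport χ ⊆ Icc (t₁ - φ.rOut) (t₂ + φ.rOut) ∧
      (∀ t, 0 ≤ χ t) ∧ (∀ t, χ t ≤ 1) ∧
      (∀ t ∈ Icc (t₁ + φ.rOut) (t₂ - φ.rOut), χ t = 1) ∧
      ∀ t, deriv χ t = φ.normed volume (t - t₁) - φ.normed volume (t - t₂) := by
  set η := φ.normed volume with hη
  have hηc : Continuous η := φ.continuous_normed
  have hηi : Integrable η := φ.integrable_normed
  -- H is a smooth monotone step from 0 to 1 across [-rOut, rOut]; the cutoff is the difference of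
  -- its shifts to t₁ and t₂.
  set H : ℝ → ℝ := fun t => ∫ τ in Iic t, η τ with hH
  have hHd : ∀ t, HasDerivAt H (η t) t := by
    intro t
    have h1 : HasDerivAt (fun t => (∫ τ in Iic (0 : ℝ), η τ) + ∫ τ in (0 : ℝ)..t, η τ) (η t) t :=
      (intervalIntegral.integral_hasDerivAt_right (hηc.intervalIntegrable _ _)
        (hηc.stronglyMeasurableAtFilter _ _) hηc.continuousAt).const_add _
    have h2 : H = fun t => (∫ τ in Iic (0 : ℝ), η τ) + ∫ τ in (0 : ℝ)..t, η τ := by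
      ext t
      rw [hH, ← intervalIntegral.integral_Iic_sub_Iic hηi.integrableOn hηi.integrableOn]
      ring
    rw [h2]; exact h1
  have hHs : ContDiff ℝ ∞ H := by
    rw [contDiff_infty_iff_deriv]
    refine ⟨fun t => (hHd t).differentiableAt, ?_⟩
    rw [show deriv H = η from funext fun t => (hHd t).deriv]
    exact φ.contDiff_normed
  have hmono : Monotone H := fun x y hxy =>
    setIntegral_mono_set hηi.integrableOn (ae_of_all _ φ.nonneg_normed)
      (Iic_subset_Iic.2 hxy).eventuallyLE
  have hz : ∀ τ, φ.rOut ≤ |τ| → η τ = 0 := by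
    intro τ hτ
    have : τ ∉ Function.support η := by
      rw [hη, φ.support_normed_eq, mem_ball_zero_iff]
      exact not_lt.2 hτ
    simpa using this
  have hH0 : ∀ t, t ≤ -φ.rOut → H t = 0 := by
    intro t ht
    refine setIntegral_eq_zero_of_forall_eq_zero fun τ hτ => hz τ ?_
    rw [le_abs]; right
    linarith [mem_Iic.1 hτ]
  have hH1 : ∀ t, φ.rOut ≤ t → H t = 1 := by
    intro t ht
    rw [← φ.integral_normed (μ := volume)]
    refine setIntegral_eq_integral_of_forall_compl_eq_zero fun τ hτ => hz τ ?_
    rw [le_abs]; left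
    linarith [not_le.1 (fun h => hτ (mem_Iic.2 h))]
  have hr := φ.rOut_pos
  have hH0' : ∀ t, 0 ≤ H t := fun t => setIntegral_nonneg measurableSet_Iic
    fun τ _ => φ.nonneg_normed τ
  have hH1' : ∀ t, H t ≤ 1 := by
    intro t
    rw [← hH1 (max t φ.rOut) (le_max_right _ _)]
    exact hmono (le_max_left _ _)
  refine ⟨fun t => H (t - t₁) - H (t - t₂), by fun_prop, ?_, ?_, ?_, ?_, ?_⟩
  · refine closure_minimal (fun t hne => ?_) isClosed_Icc
    rw [Function.mem_support] at hne
    constructor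
    · by_contra! hlt
      exact hne (by rw [hH0 _ (by linarith), hH0 _ (by linarith), sub_zero])
    · by_contra! hlt
      exact hne (by rw [hH1 _ (by linarith), hH1 _ (by linarith), sub_self])
  · exact fun t => sub_nonneg.2 (hmono (by linarith))
  · exact fun t => by linarith [hH0' (t - t₂), hH1' (t - t₁)]
  · intro t ht
    simp only
    rw [hH1 _ (by linarith [ht.1]), hH0 _ (by linarith [ht.2]), sub_zero]
  · intro t
    exact (((hHd (t - t₁)).comp_sub_const t t₁).sub ((hHd (t - t₂)).comp_sub_const t t₂)).deriv

/-- Mollifiers recover point values of continuous functions. -/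
theorem tendsto_integral_normed_sub_mul {W : ℝ → ℝ} (hW : Continuous W) {t : ℕ → ℝ} {t₀ : ℝ}
    (ht : Tendsto t atTop (𝓝 t₀)) {φ : ℕ → ContDiffBump (0 : ℝ)}
    (hφ : Tendsto (fun n => (φ n).rOut) atTop (𝓝 0)) :
    Tendsto (fun n => ∫ τ, (φ n).normed volume (τ - t n) * W τ) atTop (𝓝 (W t₀)) := by
  have h := ContDiffBump.convolution_tendsto_right (μ := volume) (g := fun _ => W) hφ
    (Eventually.of_forall fun _ => hW.aestronglyMeasurable)
    ((hW.tendsto t₀).comp tendsto_snd) ht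
  refine h.congr fun n => ?_
  rw [convolution_def, ← integral_sub_left_eq_self _ volume (t n)]
  refine integral_congr_ae (ae_of_all _ fun t => ?_)
  simp only [ContinuousLinearMap.lsmul_apply, smul_eq_mul, sub_sub_cancel]
  rw [← (φ n).normed_neg, neg_sub]

/-- A continuous function whose distributional derivative is bounded against cutoffs. -/
theorem sub_le_of_forall_cutoff {W : ℝ → ℝ} {T C : ℝ} (hT : 0 < T) (hW : Continuous W)
    (h : ∀ χ : ℝ → ℝ, ContDiff ℝ ∞ χ → HasCompactSupport χ → tsupport χ ⊆ Ioo 0 T →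
      (∀ t, 0 ≤ χ t) → (∀ t, χ t ≤ 1) → 0 ≤ (∫ t, deriv χ t * W t) + C) :
    W T - W 0 ≤ C := by
  have key : ∀ t₁ t₂, 0 < t₁ → t₁ ≤ t₂ → t₂ < T → W t₂ - W t₁ ≤ C := by
    intro t₁ t₂ h1 h2 h3
    -- Mollifier radii below m keep the support of the cutoff inside (0, T).
    set m := min t₁ (T - t₂) with hm
    have hm0 : 0 < m := lt_min h1 (by linarith)
    let φ : ℕ → ContDiffBump (0 : ℝ) := fun n =>
      ⟨m / (n + 2) / 2, m / (n + 2), by positivity, half_lt_self (by positivity)⟩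
    have hφ : Tendsto (fun n => (φ n).rOut) atTop (𝓝 0) :=
      tendsto_const_nhds.div_atTop
        (tendsto_atTop_add_const_right _ _ tendsto_natCast_atTop_atTop)
    have hlim := ((tendsto_integral_normed_sub_mul hW (tendsto_const_nhds (x := t₁)) hφ).sub
      (tendsto_integral_normed_sub_mul hW (tendsto_const_nhds (x := t₂)) hφ)).add_const C
    have hge : ∀ n, 0 ≤ (∫ t, (φ n).normed volume (t - t₁) * W t)
        - (∫ t, (φ n).normed volume (t - t₂) * W t) + C := by
      intro n
      obtain ⟨χ, c1, c2, c3, c4, -, c6⟩ := exists_time_cutoff (φ n) h2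
      have hlt : (φ n).rOut < m := div_lt_self hm0 (by linarith [Nat.cast_nonneg (α := ℝ) n])
      have hs : tsupport χ ⊆ Ioo 0 T := c2.trans fun t ht =>
        ⟨by linarith [ht.1, min_le_left t₁ (T - t₂)], by linarith [ht.2, min_le_right t₁ (T - t₂)]⟩
      have hi : ∀ t₀, Integrable fun t => (φ n).normed volume (t - t₀) * W t := fun t₀ =>
        (((φ n).continuous_normed.comp (continuous_id.sub continuous_const)).mul
          hW).integrable_of_hasCompactSupport
          (((φ n).hasCompactSupport_normed.comp_homeomorph (Homeomorph.subRight t₀)).mul_right)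
      have := h χ c1 (isCompact_Icc.of_isClosed_subset (isClosed_tsupport _) c2) hs c3 c4
      simp_rw [c6, sub_mul] at this
      rwa [integral_sub (hi t₁) (hi t₂)] at this
    linarith [ge_of_tendsto' hlim hge]
  -- Cutoffs supported in the open interval do not see the endpoints; 0 and T are reached by
  -- continuity of W.
  have hl1 : Tendsto (fun ε : ℝ => W (T - ε) - W ε) (𝓝[>] 0) (𝓝 (W T - W 0)) := by
    have : Continuous fun ε : ℝ => W (T - ε) - W ε := by fun_prop
    have := (this.tendsto 0).mono_left (nhdsWithin_le_nhds (s := Ioi 0))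
    simpa using this
  refine le_of_tendsto hl1 ?_
  filter_upwards [Ioo_mem_nhdsGT (half_pos hT)] with ε hε
  exact key ε (T - ε) hε.1 (by linarith [hε.2]) (by linarith [hε.1])

/-! ### From the Kato inequality to L¹ distances of time slices. -/

section Slices

variable {T K A A' : ℝ} {f g : ℝ → ℝ} {a a' r u b b' s v : ℝ × ℝ → ℝ}

/-- Stability of scalar balance laws in terms of time slices. -/
theorem scalar_stability (hT : 0 < T) (hu : ScalarSolution T K A A' f a a' r u)
    (hv : ScalarSolution T K A A' g b b' s v)
    (ha : ∀ t x, HasDerivAt (fun y => a (t, y)) (a' (t, x)) x)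
    {B d Λ Λ' : ℝ} (hB : ∀ h : ℝ, 0 < h → ∫ p, |u (p - (0, h)) - u p| ≤ B * h)
    (hd0 : 0 ≤ d) (hfg : ∀ x y, |(f x - g x) - (f y - g y)| ≤ d * |x - y|)
    (hΛ : ∀ p, |a p - b p| ≤ Λ) (hΛ' : ∀ p, |a' p - b' p| ≤ Λ')
    {W : ℝ → ℝ} (hW : ContinuousOn W (Icc 0 T))
    (hWu : ∀ᵐ t, t ∈ Ioo 0 T → ∫ x, |u (t, x) - v (t, x)| = W t) :
    W T ≤ W 0 + ((A * d + K * Λ) * B + (A' * d + K * Λ') * (∫ p, u p) + ∫ p, |r p - s p|) := by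
  have hWc : Continuous (IccExtend hT.le ((Icc 0 T).domRestrict W)) :=
    (continuousOn_iff_continuous_domRestrict.1 hW).Icc_extend'
  have hWe : ∀ t ∈ Icc 0 T, IccExtend hT.le ((Icc 0 T).domRestrict W) t = W t := fun t ht => by
    rw [IccExtend_of_mem _ _ ht]; rfl
  have h := sub_le_of_forall_cutoff (C := (A * d + K * Λ) * B + (A' * d + K * Λ') * (∫ p, u p)
    + ∫ p, |r p - s p|) hT hWc ?_
  · rw [hWe T (right_mem_Icc.2 hT.le), hWe 0 (left_mem_Icc.2 hT.le)] at h
    linarith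
  intro χ h1 h2 h3 h4 h5
  refine (kato_ineq_time hu hv ha hB hd0 hfg hΛ hΛ' h1 h2 h3 h4 h5).trans_eq ?_
  congr 1
  have hw : Integrable fun p => |u p - v p| := (hu.u_int.sub hv.u_int).abs
  obtain ⟨C₁, hC₁⟩ := h2.deriv.exists_bound_of_continuous (h1.continuous_deriv (by simp))
  have hi : Integrable fun p : ℝ × ℝ => |u p - v p| * deriv χ p.1 :=
    hw.mul_bdd (c := C₁) ((h1.continuous_deriv (by simp)).comp continuous_fst).aestronglyMeasurable
      (ae_of_all _ fun p => hC₁ _)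
  rw [Measure.volume_eq_prod] at hi ⊢
  rw [integral_prod _ hi]
  refine integral_congr_ae ?_
  filter_upwards [hWu] with t ht
  by_cases hts : t ∈ tsupport χ
  · rw [integral_mul_const, ht (h3 hts), hWe t (Ioo_subset_Icc_self (h3 hts)), mul_comm]
  · have : deriv χ t = 0 := by
      have := notMem_subset (tsupport_deriv_subset (f := χ)) hts
      exact image_eq_zero_of_notMem_tsupport this
    simp [this]

end Slices

/-! ### Total variation and translations -/

/-- The `L^1` norm is determined by pairing with continuous functions of compact support. -/
theorem integral_abs_le_of_forall_pairing {w : ℝ → ℝ} (hw : Integrable w) {C : ℝ}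
    (h : ∀ φ : ℝ → ℝ, Continuous φ → HasCompactSupport φ → (∀ x, |φ x| ≤ 1) →
      ∫ x, w x * φ x ≤ C) : ∫ x, |w x| ≤ C := by
  refine le_of_forall_pos_le_add fun ε hε => ?_
  obtain ⟨g, hgc, hg, hgcont, hgi⟩ :=
    hw.exists_hasCompactSupport_integral_sub_le (ε := ε / 4) (by positivity)
  simp only [Real.norm_eq_abs] at hg
  set m := volume.real (tsupport g) with hm
  have hm0 : 0 ≤ m := measureReal_nonneg
  set δ := ε / (4 * (m + 1)) with hδ
  have hδ0 : 0 < δ := by positivity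
  have hpos : ∀ x, 0 < |g x| + δ := fun x => by positivity
  -- A continuous compactly supported substitute for sgn w: g approximates w in L¹, and g φ ≥ |g| -
  -- δ on `tsupport g`.
  set φ : ℝ → ℝ := fun x => g x / (|g x| + δ) with hφ
  have hφc : Continuous φ := hgcont.div (by fun_prop) fun x => (hpos x).ne'
  have hφs : HasCompactSupport φ := by
    refine HasCompactSupport.intro hgc fun x hx => ?_
    simp [hφ, image_eq_zero_of_notMem_tsupport hx]
  have hφ1 : ∀ x, |φ x| ≤ 1 := fun x => by
    rw [hφ, abs_div, abs_of_pos (hpos x), div_le_one (hpos x)]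
    linarith
  have hwφ : Integrable fun x => w x * φ x :=
    hw.mul_bdd (c := 1) hφc.aestronglyMeasurable (ae_of_all _ fun x => by simpa using hφ1 x)
  have hK : Integrable ((tsupport g).indicator fun _ => δ) :=
    (integrable_indicator_iff (isClosed_tsupport g).measurableSet).2
      (integrableOn_const hgc.isCompact.measure_lt_top.ne)
  have hwg : Integrable fun x => |w x - g x| := (hw.sub hgi).abs
  have hpt : ∀ x, |w x| ≤ w x * φ x + (2 * |w x - g x| + (tsupport g).indicator (fun _ => δ) x) := by
    intro x
    have h1 : |g x| ≤ g x * φ x + (tsupport g).indicator (fun _ => δ) x := by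
      by_cases hx : x ∈ tsupport g
      · rw [indicator_of_mem hx]
        have e : g x * φ x = |g x| * |g x| / (|g x| + δ) := by
          rw [hφ, abs_mul_abs_self]; ring
        rw [e, ← sub_le_iff_le_add, le_div_iff₀ (hpos x)]
        nlinarith [abs_nonneg (g x), mul_pos hδ0 hδ0]
      · simp [image_eq_zero_of_notMem_tsupport hx, indicator_of_notMem hx]
    have h2 : (g x - w x) * φ x ≤ |w x - g x| := by
      refine (le_abs_self _).trans ?_
      rw [abs_mul, abs_sub_comm]
      exact mul_le_of_le_one_right (abs_nonneg _) (hφ1 x)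
    have h3 : |w x| ≤ |w x - g x| + |g x| := by
      simpa using abs_add_le (w x - g x) (g x)
    linarith
  have h1 := integral_mono hw.abs (hwφ.add ((hwg.const_mul 2).add hK)) hpt
  have h2 := integral_add hwφ ((hwg.const_mul 2).add hK)
  have h3 := integral_add (hwg.const_mul 2) hK
  have h4 := h φ hφc hφs hφ1
  have h5 : ∫ x, (tsupport g).indicator (fun _ => δ) x = m * δ := by
    rw [integral_indicator (isClosed_tsupport g).measurableSet, setIntegral_const, smul_eq_mul]
  have h6 : m * δ ≤ ε / 4 := by
    rw [hδ, mul_div_assoc', div_le_div_iff₀ (by positivity) (by positivity)]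
    nlinarith
  simp only [Pi.add_apply, integral_const_mul] at h1 h2 h3
  linarith

theorem integral_mul_deriv_le_of_totalVar_le {u : ℝ → ℝ} {B : ℝ≥0} (hB : totalVar u ≤ B)
    {φ : ℝ → ℝ} (h1 : ContDiff ℝ 1 φ) (h2 : HasCompactSupport φ) (h3 : ∀ x, |φ x| ≤ 1) :
    ∫ x, u x * deriv φ x ≤ B := by
  have h : ENNReal.ofReal (∫ x, u x * deriv φ x) ≤ B := by
    refine le_trans ?_ hB
    unfold totalVar
    refine le_trans ?_ (le_iSup _ φ)
    rw [iSup_pos h1, iSup_pos h2, iSup_pos h3]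
  rw [← ENNReal.ofReal_coe_nnreal] at h
  exact (ENNReal.ofReal_le_ofReal_iff B.2).1 h

/-- Translation estimate for functions of bounded variation. -/
theorem integral_abs_translate_sub_le {u : ℝ → ℝ} (hu : Integrable u) {B : ℝ≥0}
    (hB : totalVar u ≤ B) {h : ℝ} (hh : 0 < h) :
    ∫ x, |u (x - h) - u x| ≤ B * h := by
  refine integral_abs_le_of_forall_pairing ((hu.comp_sub_right h).sub hu) fun φ hφ hφs hφ1 => ?_
  -- The moving average of φ is a C¹ competitor with |ζ| ≤ 1 and h ζ' = φ(· + h) - φ. Pairing the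
  -- translation difference with φ is thus h times a pairing admissible in the total variation.
  set ζ : ℝ → ℝ := fun x => h⁻¹ * ∫ y in x..(x + h), φ y with hζ
  have hint : ∀ x y, IntervalIntegrable φ volume x y := fun x y => hφ.intervalIntegrable _ _
  have hd : ∀ x, HasDerivAt ζ (h⁻¹ * (φ (x + h) - φ x)) x := by
    intro x
    have h1 : ∀ x, HasDerivAt (fun x => ∫ y in (0 : ℝ)..x, φ y) (φ x) x := fun x =>
      intervalIntegral.integral_hasDerivAt_right (hint _ _)
        (hφ.stronglyMeasurableAtFilter _ _) hφ.continuousAt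
    have h2 := (((h1 (x + h)).comp_add_const x h).sub (h1 x)).const_mul h⁻¹
    have h3 : ζ = fun x => h⁻¹ * ((∫ y in (0 : ℝ)..(x + h), φ y) - ∫ y in (0 : ℝ)..x, φ y) := by
      ext x
      rw [hζ, intervalIntegral.integral_interval_sub_left (hint _ _) (hint _ _)]
    rw [h3]; exact h2
  have hder : deriv ζ = fun x => h⁻¹ * (φ (x + h) - φ x) := funext fun x => (hd x).deriv
  have hζ1 : ContDiff ℝ 1 ζ := by
    rw [contDiff_one_iff_deriv]
    refine ⟨fun x => (hd x).differentiableAt, ?_⟩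
    rw [hder]; fun_prop
  have hζs : HasCompactSupport ζ := by
    refine HasCompactSupport.intro (K := Metric.cthickening h (tsupport φ)) hφs.cthickening
      fun x hx => ?_
    have : ∀ y ∈ uIcc x (x + h), φ y = 0 := by
      intro y hy
      rw [uIcc_of_le (by linarith)] at hy
      refine image_eq_zero_of_notMem_tsupport fun hy' => hx
        (Metric.mem_cthickening_of_dist_le x y _ _ hy' ?_)
      rw [Real.dist_eq, abs_le]; constructor <;> linarith [hy.1, hy.2]
    rw [hζ]
    simp only
    rw [intervalIntegral.integral_congr this]
    simp
  have hζb : ∀ x, |ζ x| ≤ 1 := by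
    intro x
    have := intervalIntegral.norm_integral_le_of_norm_le_const (f := φ) (a := x) (b := x + h)
      (C := 1) fun y _ => by simpa using hφ1 y
    rw [hζ, abs_mul, abs_inv, abs_of_pos hh, inv_mul_le_iff₀ hh]
    simpa [abs_of_pos hh] using this
  have h2 : ∫ x, u x * deriv ζ x ≤ B := integral_mul_deriv_le_of_totalVar_le hB hζ1 hζs hζb
  have hb : ∀ c, Integrable fun x => u x * φ (x + c) := fun c =>
    hu.mul_bdd (c := 1) (by fun_prop) (ae_of_all _ fun x => by simpa using hφ1 _)
  have hb0 : Integrable fun x => u x * φ x := by simpa using hb 0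
  have hb1 : Integrable fun x => u (x - h) * φ x := by
    simpa using (hb h).comp_sub_right h
  have h3 : ∫ x, u (x - h) * φ x = ∫ x, u x * φ (x + h) := by
    rw [← integral_add_right_eq_self _ h]; simp
  have h4 : ∫ x, (u (x - h) - u x) * φ x = h * ∫ x, u x * deriv ζ x := by
    rw [hder]
    calc ∫ x, (u (x - h) - u x) * φ x = ∫ x, (u (x - h) * φ x - u x * φ x) := by
          congr 1; ext x; ring
      _ = ∫ x, (u x * φ (x + h) - u x * φ x) := by
          rw [integral_sub hb1 hb0, h3, integral_sub (hb h) hb0]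
      _ = ∫ x, h * (u x * (h⁻¹ * (φ (x + h) - φ x))) := by
          congr 1; ext x; field_simp
      _ = _ := integral_const_mul _ _
  calc ∫ x, (u (x - h) - u x) * φ x = h * ∫ x, u x * deriv ζ x := h4
    _ ≤ h * B := by gcongr
    _ = B * h := mul_comm _ _

/-! ### Curves in `L^1` -/

theorem oneNorm_eq {w : ℝ → ℝ} (hw : Integrable w) :
    oneNorm w = ENNReal.ofReal (∫ x, |w x|) := by
  rw [oneNorm, eLpNorm_one_eq_lintegral_enorm,
    ofReal_integral_eq_lintegral_ofReal hw.abs (ae_of_all _ fun x => abs_nonneg _)]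
  simp [Real.enorm_eq_ofReal_abs]

/-- A continuous curve `[0, T] → L^1(ℝ)`. -/
structure L1Curve (T : ℝ) (w : ℝ → ℝ → ℝ) : Prop where
  integrable : ∀ t ∈ Icc 0 T, Integrable (w t)
  continuous : ∀ s ∈ Icc 0 T,
    Tendsto (fun t => ∫ x, |w t x - w s x|) (𝓝[Icc 0 T] s) (𝓝 0)

theorem IsEntropySolution.l1Curve {N : ℕ} {D : SystemData N} {T : ℝ} {U₀ : Fin N → ℝ → ℝ}
    {U : Fin N → ℝ → ℝ → ℝ} (hU : IsEntropySolution D T U₀ U) (k : Fin N) : L1Curve T (U k) where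
  integrable := hU.integrable k
  continuous s hs := by
    have h := (ENNReal.tendsto_toReal ENNReal.zero_ne_top).comp (hU.continuous k s hs)
    rw [ENNReal.toReal_zero] at h
    refine h.congr' ?_
    filter_upwards [self_mem_nhdsWithin] with t ht
    simp only [Function.comp]
    rw [oneNorm_eq (w := fun x => U k t x - U k s x)
      ((hU.integrable k t ht).sub (hU.integrable k s hs)), ENNReal.toReal_ofReal
      (integral_nonneg fun x => abs_nonneg _)]

namespace L1Curve

variable {T : ℝ} {w w' : ℝ → ℝ → ℝ}

theorem sub (hw : L1Curve T w) (hw' : L1Curve T w') : L1Curve T fun t x => w t x - w' t x where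
  integrable t ht := (hw.integrable t ht).sub (hw'.integrable t ht)
  continuous s hs := by
    have h := (hw.continuous s hs).add (hw'.continuous s hs)
    rw [add_zero] at h
    refine tendsto_of_tendsto_of_tendsto_of_le_of_le' tendsto_const_nhds h
      (Eventually.of_forall fun t => integral_nonneg fun x => abs_nonneg _) ?_
    filter_upwards [self_mem_nhdsWithin] with t ht
    have i1 := ((hw.integrable t ht).sub (hw.integrable s hs)).abs
    have i2 := ((hw'.integrable t ht).sub (hw'.integrable s hs)).abs
    have e := integral_add i1 i2
    simp only [Pi.sub_apply] at e
    rw [← e]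
    refine integral_mono (((hw.integrable t ht).sub (hw'.integrable t ht)).sub
      ((hw.integrable s hs).sub (hw'.integrable s hs))).abs (i1.add i2) fun x => ?_
    simp only
    rw [show w t x - w' t x - (w s x - w' s x) = (w t x - w s x) - (w' t x - w' s x) by ring]
    exact abs_sub _ _

theorem mono (hw : L1Curve T w) {t : ℝ} (ht : t ≤ T) : L1Curve t w where
  integrable s hs := hw.integrable s ⟨hs.1, hs.2.trans ht⟩
  continuous s hs := (hw.continuous s ⟨hs.1, hs.2.trans ht⟩).mono_left
    (nhdsWithin_mono _ (Icc_subset_Icc_right ht))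

theorem abs_integral_mul_sub_le (hw : L1Curve T w) {s t : ℝ} (hs : s ∈ Icc 0 T) (ht : t ∈ Icc 0 T)
    {φ : ℝ → ℝ} (hφ : AEStronglyMeasurable φ) {c : ℝ} (hc : ∀ x, |φ x| ≤ c) :
    |(∫ x, w t x * φ x) - ∫ x, w s x * φ x| ≤ c * ∫ x, |w t x - w s x| := by
  have i : ∀ t ∈ Icc 0 T, Integrable fun x => w t x * φ x := fun t ht =>
    (hw.integrable t ht).mul_bdd (c := c) hφ (ae_of_all _ hc)
  rw [← integral_sub (i t ht) (i s hs), ← integral_const_mul]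
  refine (abs_integral_le_integral_abs).trans (integral_mono ((i t ht).sub (i s hs)).abs
    (((hw.integrable t ht).sub (hw.integrable s hs)).abs.const_mul c) fun x => ?_)
  simp only
  rw [← sub_mul, abs_mul, mul_comm]
  exact mul_le_mul_of_nonneg_right (hc x) (abs_nonneg _)

theorem continuousOn_norm (hw : L1Curve T w) : ContinuousOn (fun t => ∫ x, |w t x|) (Icc 0 T) := by
  intro s hs
  rw [ContinuousWithinAt, tendsto_iff_dist_tendsto_zero]
  refine tendsto_of_tendsto_of_tendsto_of_le_of_le' tendsto_const_nhds (hw.continuous s hs)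
    (Eventually.of_forall fun t => dist_nonneg) ?_
  filter_upwards [self_mem_nhdsWithin] with t ht
  rw [Real.dist_eq, ← integral_sub (hw.integrable t ht).abs (hw.integrable s hs).abs]
  refine (abs_integral_le_integral_abs).trans (integral_mono
    ((hw.integrable t ht).abs.sub (hw.integrable s hs).abs).abs
    ((hw.integrable t ht).sub (hw.integrable s hs)).abs fun x => ?_)
  exact abs_abs_sub_abs_le_abs_sub _ _

/-- Lower semicontinuity of the total variation along the curve. -/
theorem totalVar_le (hT : 0 < T) (hw : L1Curve T w) {B : ℝ≥0}
    (hB : ∀ᵐ t ∂(volume.restrict (Icc 0 T)), totalVar (w t) ≤ B) :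
    ∀ t ∈ Icc 0 T, totalVar (w t) ≤ B := by
  intro t ht
  refine iSup_le fun φ => iSup_le fun hφ => iSup_le fun hφs => iSup_le fun hφ1 => ?_
  have hφ' : Continuous (deriv φ) := hφ.continuous_deriv le_rfl
  obtain ⟨c, hc⟩ := hφs.deriv.exists_bound_of_continuous hφ'
  rw [← ENNReal.ofReal_coe_nnreal]
  refine ENNReal.ofReal_le_ofReal ?_
  have hcont : ContinuousWithinAt (fun t => ∫ x, w t x * deriv φ x) (Icc 0 T) t := by
    rw [ContinuousWithinAt, tendsto_iff_dist_tendsto_zero]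
    have h := (hw.continuous t ht).const_mul c
    rw [mul_zero] at h
    refine tendsto_of_tendsto_of_tendsto_of_le_of_le' tendsto_const_nhds h
      (Eventually.of_forall fun t => dist_nonneg) ?_
    filter_upwards [self_mem_nhdsWithin] with s hs
    exact hw.abs_integral_mul_sub_le ht hs hφ'.aestronglyMeasurable hc
  -- A subset of full measure in (0, T) meets every nonempty open subset, hence is dense in [0, T].
  have hdense : t ∈ closure {s ∈ Ioo 0 T | totalVar (w s) ≤ B} := by
    have h1 : ∀ᵐ s ∂(volume.restrict (Ioo 0 T)), totalVar (w s) ≤ B :=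
      ae_restrict_of_ae_restrict_of_subset Ioo_subset_Icc_self hB
    have h2 : Ioo 0 T ⊆ closure {s ∈ Ioo 0 T | totalVar (w s) ≤ B} := by
      intro x hx
      rw [mem_closure_iff]
      intro o ho hxo
      by_contra hne
      rw [not_nonempty_iff_eq_empty] at hne
      rw [ae_restrict_iff' measurableSet_Ioo, ae_iff] at h1
      have h3 : volume (o ∩ Ioo 0 T) = 0 := by
        refine measure_mono_null ?_ h1
        intro y hy hB
        have : y ∈ o ∩ {s ∈ Ioo 0 T | totalVar (w s) ≤ B} := ⟨hy.1, hy.2, hB hy.2⟩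
        rw [hne] at this
        exact this
      exact (ho.inter isOpen_Ioo).measure_pos volume ⟨x, hxo, hx⟩ |>.ne' h3
    have h3 := closure_minimal h2 isClosed_closure
    rw [closure_Ioo hT.ne] at h3
    exact h3 ht
  have hsub : {s ∈ Ioo 0 T | totalVar (w s) ≤ B} ⊆ Icc 0 T := fun s hs => Ioo_subset_Icc_self hs.1
  have hne : (𝓝[{s ∈ Ioo 0 T | totalVar (w s) ≤ B}] t).NeBot := mem_closure_iff_nhdsWithin_neBot.1 hdense
  refine le_of_tendsto (hcont.mono_left (nhdsWithin_mono _ hsub)) ?_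
  filter_upwards [self_mem_nhdsWithin] with s hs
  exact integral_mul_deriv_le_of_totalVar_le hs.2 hφ hφs hφ1

end L1Curve

/-! ### Convolution in space and memory in time -/

/-- Projection of the real line onto `[0, T]`. -/
def clamp (T t : ℝ) : ℝ := max 0 (min T t)

theorem continuous_clamp (T : ℝ) : Continuous (clamp T) := by unfold clamp; fun_prop

theorem clamp_mem {T : ℝ} (hT : 0 ≤ T) (t : ℝ) : clamp T t ∈ Icc 0 T :=
  ⟨le_max_left _ _, max_le hT (min_le_left _ _)⟩

theorem clamp_of_mem {T t : ℝ} (ht : t ∈ Icc 0 T) : clamp T t = t := by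
  rw [clamp, min_eq_right ht.2, max_eq_right ht.1]

/-- Convolution of each time slice with a spatial kernel. -/
def spConv (κ : ℝ → ℝ) (w : ℝ → ℝ → ℝ) (τ x : ℝ) : ℝ := ∫ ξ, w τ ξ * κ (x - ξ)

/-- The memory term with a temporal kernel. -/
def tConv (γ : ℝ → ℝ) (P : ℝ → ℝ → ℝ) (t x : ℝ) : ℝ := ∫ τ in (0 : ℝ)..t, P τ x * γ (t - τ)

/-- The temporal factor does not depend on ξ. Pulling it out splits the space-time convolution into
a spatial and a temporal one, which are estimated separately. -/
theorem memConv_eq {N : ℕ} (κ γ : Fin N → Fin N → ℝ → ℝ) (U : Fin N → ℝ → ℝ → ℝ) (k : Fin N)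
    (t x : ℝ) (j : Fin N) :
    memConv κ γ U k t x j = tConv (γ j k) (spConv (κ j k) (U j)) t x := by
  simp only [memConv, tConv, spConv, integral_mul_const]

/-- A function on `[0, T] × ℝ` that is continuous and bounded. -/
structure StripField (T C : ℝ) (P : ℝ → ℝ → ℝ) : Prop where
  continuousOn : ContinuousOn (fun p : ℝ × ℝ => P p.1 p.2) (Icc 0 T ×ˢ univ)
  bound : ∀ t ∈ Icc 0 T, ∀ x, |P t x| ≤ C

theorem StripField.continuous_clamp {T C : ℝ} {P : ℝ → ℝ → ℝ} (hP : StripField T C P)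
    (hT : 0 ≤ T) : Continuous fun p : ℝ × ℝ => P (clamp T p.1) p.2 := by
  have h : Continuous fun p : ℝ × ℝ => (clamp T p.1, p.2) := by
    have := NonlocalMemory.continuous_clamp T
    fun_prop
  exact hP.continuousOn.comp_continuous h fun p => ⟨clamp_mem hT _, mem_univ _⟩

/-- A truncated measurable version of a bounded temporal kernel. -/
theorem exists_kernel_rep {γ : ℝ → ℝ} {G : ℝ} (hG : 0 ≤ G) (T : ℝ)
    (hγ : AEStronglyMeasurable γ halfLine) (hγG : ∀ᵐ s ∂halfLine, |γ s| ≤ G) :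
    ∃ g : ℝ → ℝ, Measurable g ∧ (∀ s, |g s| ≤ G) ∧ (∀ s, s ∉ Ico 0 T → g s = 0) ∧
      ∀ᵐ s, s ∈ Ico 0 T → g s = γ s := by
  -- For 0 < τ ≤ t ≤ T the argument t - τ lies in [0, T), so memory up to time T does not see the
  -- truncation, and the truncated kernel becomes integrable on the whole line.
  refine ⟨(Ico 0 T).indicator fun s => max (-G) (min G (hγ.mk γ s)), ?_, ?_, ?_, ?_⟩
  · have := hγ.stronglyMeasurable_mk.measurable
    exact Measurable.indicator (by fun_prop) measurableSet_Ico
  · intro s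
    by_cases hs : s ∈ Ico 0 T
    · rw [indicator_of_mem hs, abs_le]
      exact ⟨le_max_left _ _, max_le (by linarith) (min_le_left _ _)⟩
    · rw [indicator_of_notMem hs, abs_zero]; exact hG
  · exact fun s hs => indicator_of_notMem hs _
  · have h1 := hγ.ae_eq_mk
    unfold halfLine at h1
    rw [EventuallyEq, ae_restrict_iff' measurableSet_Ici] at h1
    unfold halfLine at hγG
    rw [ae_restrict_iff' measurableSet_Ici] at hγG
    filter_upwards [h1, hγG] with s h2 h3 hs
    have h4 := abs_le.1 (h3 hs.1)
    have h5 : hγ.mk γ s = γ s := (h2 hs.1).symm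
    rw [indicator_of_mem hs, h5, min_eq_right h4.2, max_eq_right h4.1]

theorem ae_comp_sub_left {p : ℝ → Prop} (h : ∀ᵐ s, p s) (t : ℝ) : ∀ᵐ τ, p (t - τ) :=
  (quasiMeasurePreserving_sub_left volume t).ae h

theorem tConv_congr {γ g : ℝ → ℝ} {T : ℝ} (h : ∀ᵐ s, s ∈ Ico 0 T → g s = γ s)
    (P : ℝ → ℝ → ℝ) {t : ℝ} (ht : t ∈ Icc 0 T) (x : ℝ) : tConv γ P t x = tConv g P t x := by
  refine intervalIntegral.integral_congr_ae ?_
  filter_upwards [ae_comp_sub_left h t] with τ hτ hτt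
  rw [uIoc_of_le ht.1] at hτt
  rw [hτ ⟨by linarith [hτt.2], by linarith [hτt.1, ht.2]⟩]

/-! ### Convolution in space. -/

section SpConv

variable {T c : ℝ} {κ : ℝ → ℝ} {w : ℝ → ℝ → ℝ}

theorem integrable_spConv_integrand (hκ : Continuous κ) (hc : ∀ x, |κ x| ≤ c) {τ : ℝ}
    (hw : Integrable (w τ)) (x : ℝ) : Integrable fun ξ => w τ ξ * κ (x - ξ) :=
  hw.mul_bdd (c := c) (by fun_prop) (ae_of_all _ fun ξ => by simpa using hc _)

theorem abs_spConv_le (hc : ∀ x, |κ x| ≤ c) {τ : ℝ} (hw : Integrable (w τ)) (x : ℝ) :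
    |spConv κ w τ x| ≤ c * ∫ ξ, |w τ ξ| := by
  rw [← integral_const_mul]
  rw [← Real.norm_eq_abs]
  refine norm_integral_le_of_norm_le (hw.abs.const_mul c) (ae_of_all _ fun ξ => ?_)
  rw [norm_mul, mul_comm]
  exact mul_le_mul_of_nonneg_right (hc _) (abs_nonneg _)

theorem spConv_sub (hκ : Continuous κ) (hc : ∀ x, |κ x| ≤ c) {κ' : ℝ → ℝ} (hκ' : Continuous κ')
    (hc' : ∀ x, |κ' x| ≤ c) {w' : ℝ → ℝ → ℝ} {τ : ℝ} (hw : Integrable (w τ))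
    (hw' : Integrable (w' τ)) (x : ℝ) :
    spConv κ w τ x - spConv κ' w' τ x
      = spConv (fun y => κ y - κ' y) w τ x + spConv κ' (fun t y => w t y - w' t y) τ x := by
  have i1 := integrable_spConv_integrand hκ hc hw x
  have i2 := integrable_spConv_integrand hκ' hc' hw' x
  have i3 := integrable_spConv_integrand hκ' hc' hw x
  simp only [spConv, mul_sub, sub_mul]
  rw [integral_sub i1 i3, integral_sub i3 i2]
  ring

/-- At a fixed time continuity in x is dominated convergence. A change of time alters the value by
at most c times the L¹ distance of the slices, uniformly in x; together this gives joint continuity.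
-/
theorem L1Curve.stripField_spConv (hw : L1Curve T w) (hκ : Continuous κ) (hc : ∀ x, |κ x| ≤ c)
    {S : ℝ} (hS : ∀ t ∈ Icc 0 T, ∫ x, |w t x| ≤ S) : StripField T (c * S) (spConv κ w) where
  bound t ht x := (abs_spConv_le hc (hw.integrable t ht) x).trans
    (mul_le_mul_of_nonneg_left (hS t ht) ((abs_nonneg _).trans (hc 0)))
  continuousOn := by
    rintro ⟨s, x₀⟩ ⟨hs, -⟩
    have h1 : Tendsto (fun x => spConv κ w s x) (𝓝 x₀) (𝓝 (spConv κ w s x₀)) := by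
      have : Continuous fun x => spConv κ w s x := by
        refine continuous_of_dominated (bound := fun ξ => |w s ξ| * c)
          (fun x => (integrable_spConv_integrand hκ hc (hw.integrable s hs) x).1)
          (fun x => ae_of_all _ fun ξ => ?_) ((hw.integrable s hs).abs.mul_const c)
          (ae_of_all _ fun ξ => by fun_prop)
        rw [norm_mul]
        exact mul_le_mul_of_nonneg_left (hc _) (abs_nonneg _)
      exact this.tendsto x₀
    have hfst : Tendsto (fun p : ℝ × ℝ => p.1) (𝓝[Icc 0 T ×ˢ univ] (s, x₀)) (𝓝[Icc 0 T] s) := by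
      rw [nhdsWithin_prod_eq]; exact tendsto_fst
    have hsnd : Tendsto (fun p : ℝ × ℝ => p.2) (𝓝[Icc 0 T ×ˢ univ] (s, x₀)) (𝓝 x₀) := by
      rw [nhdsWithin_prod_eq, nhdsWithin_univ]; exact tendsto_snd
    have h2 : Tendsto (fun p : ℝ × ℝ => spConv κ w p.1 p.2 - spConv κ w s p.2)
        (𝓝[Icc 0 T ×ˢ univ] (s, x₀)) (𝓝 0) := by
      have h := ((hw.continuous s hs).comp hfst).const_mul c
      rw [mul_zero] at h
      rw [tendsto_zero_iff_abs_tendsto_zero]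
      refine tendsto_of_tendsto_of_tendsto_of_le_of_le' tendsto_const_nhds h
        (Eventually.of_forall fun t => abs_nonneg _) ?_
      filter_upwards [self_mem_nhdsWithin] with p hp
      exact hw.abs_integral_mul_sub_le hs hp.1 (φ := fun ξ => κ (p.2 - ξ)) (by fun_prop)
        fun ξ => hc _
    have h3 := h2.add (h1.comp hsnd)
    simpa [ContinuousWithinAt] using h3

/-- The derivative falls on the kernel, so the slice needs no regularity. -/
theorem hasDerivAt_spConv (hκ : ContDiff ℝ 1 κ) (hc : ∀ x, |κ x| ≤ c) {c' : ℝ}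
    (hc' : ∀ x, |deriv κ x| ≤ c') {τ : ℝ} (hw : Integrable (w τ)) (x : ℝ) :
    HasDerivAt (fun y => spConv κ w τ y) (spConv (deriv κ) w τ x) x := by
  have hκ' : Continuous (deriv κ) := hκ.continuous_deriv le_rfl
  refine (hasDerivAt_integral_of_dominated_loc_of_deriv_le (s := univ)
    (F' := fun y ξ => w τ ξ * deriv κ (y - ξ)) (bound := fun ξ => |w τ ξ| * c') univ_mem
    (Eventually.of_forall fun y => (integrable_spConv_integrand hκ.continuous hc hw y).1)
    (integrable_spConv_integrand hκ.continuous hc hw x)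
    (integrable_spConv_integrand hκ' hc' hw x).1
    (ae_of_all _ fun ξ y _ => ?_) (hw.abs.mul_const c') (ae_of_all _ fun ξ y _ => ?_)).2
  · rw [norm_mul]
    exact mul_le_mul_of_nonneg_left (hc' _) (abs_nonneg _)
  · exact (((hκ.differentiable one_ne_zero (y - ξ)).hasDerivAt).comp_sub_const y ξ).const_mul _

/-- Young's inequality for the spatial convolution. -/
theorem lintegral_spConv_le (hκ : Continuous κ) {τ : ℝ} (hw : Integrable (w τ)) :
    ∫⁻ x, ‖spConv κ w τ x‖ₑ ≤ (∫⁻ x, ‖w τ x‖ₑ) * ∫⁻ x, ‖κ x‖ₑ := by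
  calc ∫⁻ x, ‖spConv κ w τ x‖ₑ ≤ ∫⁻ x, ∫⁻ ξ, ‖w τ ξ‖ₑ * ‖κ (x - ξ)‖ₑ := by
        refine lintegral_mono fun x => (enorm_integral_le_lintegral_enorm _).trans_eq ?_
        simp only [enorm_mul]
    _ = ∫⁻ ξ, ∫⁻ x, ‖w τ ξ‖ₑ * ‖κ (x - ξ)‖ₑ := by
        refine lintegral_lintegral_swap ?_
        refine AEMeasurable.mul (hw.1.comp_snd).enorm ?_
        have : Measurable κ := hκ.measurable
        fun_prop
    _ = ∫⁻ ξ, ‖w τ ξ‖ₑ * ∫⁻ x, ‖κ x‖ₑ := by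
        refine lintegral_congr fun ξ => ?_
        rw [lintegral_const_mul _ (by have := hκ.measurable; fun_prop),
          lintegral_sub_right_eq_self (fun x => ‖κ x‖ₑ) ξ]
    _ = _ := lintegral_mul_const'' _ hw.1.enorm

end SpConv

/-! ### Memory in time. -/

section TConv

variable {T C G : ℝ} {γ : ℝ → ℝ} {P : ℝ → ℝ → ℝ}

theorem StripField.continuousOn_slice (hP : StripField T C P) (x : ℝ) :
    ContinuousOn (fun τ => P τ x) (Icc 0 T) :=
  hP.continuousOn.comp (f := fun τ => (τ, x)) (by fun_prop) fun τ hτ => ⟨hτ, mem_univ _⟩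

theorem StripField.integrable_tConv (hP : StripField T C P) (hγ : Measurable γ)
    (hG : ∀ᵐ s, |γ s| ≤ G) {t : ℝ} (ht : t ∈ Icc 0 T) (x : ℝ) :
    Integrable (fun τ => P τ x * γ (t - τ)) (volume.restrict (Ioc 0 t)) := by
  have h1 : IntegrableOn (fun τ => P τ x) (Ioc 0 t) :=
    (((hP.continuousOn_slice x).mono (Icc_subset_Icc_right ht.2)).integrableOn_Icc).mono_set
      Ioc_subset_Icc_self
  have mγ : Measurable fun τ => γ (t - τ) := by fun_prop
  exact Integrable.mul_bdd (c := G) h1 mγ.aestronglyMeasurable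
    (ae_restrict_of_ae (ae_comp_sub_left hG t))

theorem StripField.intervalIntegrable_tConv (hP : StripField T C P) (hγ : Measurable γ)
    (hG : ∀ᵐ s, |γ s| ≤ G) {t : ℝ} (ht : t ∈ Icc 0 T) (x : ℝ) :
    IntervalIntegrable (fun τ => P τ x * γ (t - τ)) volume 0 t := by
  rw [intervalIntegrable_iff_integrableOn_Ioc_of_le ht.1]
  exact hP.integrable_tConv hγ hG ht x

/-- The bound on P may depend on time. With L¹ norms of slices inserted for n, the estimate retains
the time integral that Gronwall's inequality requires. -/
theorem StripField.abs_tConv_le (hG : ∀ᵐ s, |γ s| ≤ G) {t : ℝ} (ht : t ∈ Icc 0 T) (x : ℝ)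
    {n : ℝ → ℝ} (hn : ContinuousOn n (Icc 0 T)) (hPn : ∀ τ ∈ Icc 0 T, |P τ x| ≤ n τ) :
    |tConv γ P t x| ≤ G * ∫ τ in (0 : ℝ)..T, n τ := by
  have hT := ht.1.trans ht.2
  obtain ⟨s₀, hs₀⟩ := hG.exists
  have hG0 : 0 ≤ G := (abs_nonneg _).trans hs₀
  have hni : IntervalIntegrable n volume 0 T := by
    refine ContinuousOn.intervalIntegrable ?_
    rwa [uIcc_of_le hT]
  have hni' : IntervalIntegrable n volume 0 t := by
    refine ContinuousOn.intervalIntegrable (hn.mono ?_)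
    rw [uIcc_of_le ht.1]; exact Icc_subset_Icc_right ht.2
  calc |tConv γ P t x| ≤ ∫ τ in (0 : ℝ)..t, G * n τ := by
        rw [← Real.norm_eq_abs]
        refine intervalIntegral.norm_integral_le_of_norm_le ht.1 ?_ (hni'.const_mul G)
        filter_upwards [ae_comp_sub_left hG t] with τ hτ hτt
        rw [norm_mul, mul_comm]
        exact mul_le_mul hτ (hPn τ ⟨hτt.1.le, hτt.2.trans ht.2⟩) (abs_nonneg _) hG0
    _ = G * ∫ τ in (0 : ℝ)..t, n τ := intervalIntegral.integral_const_mul _ _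
    _ ≤ G * ∫ τ in (0 : ℝ)..T, n τ := by
        refine mul_le_mul_of_nonneg_left ?_ hG0
        refine intervalIntegral.integral_mono_interval le_rfl ht.1 ht.2 ?_ hni
        rw [EventuallyLE, ae_restrict_iff' measurableSet_Ioc]
        exact ae_of_all _ fun τ hτ => (abs_nonneg _).trans (hPn τ (Ioc_subset_Icc_self hτ))

theorem StripField.tConv_sub {γ' : ℝ → ℝ} {P' : ℝ → ℝ → ℝ} (hP : StripField T C P)
    (hP' : StripField T C P') (hγ : Measurable γ) (hγ' : Measurable γ') (hG : ∀ᵐ s, |γ s| ≤ G)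
    (hG' : ∀ᵐ s, |γ' s| ≤ G) {t : ℝ} (ht : t ∈ Icc 0 T) (x : ℝ) :
    tConv γ P t x - tConv γ' P' t x
      = tConv (fun s => γ s - γ' s) P t x + tConv γ' (fun τ y => P τ y - P' τ y) t x := by
  have i1 := hP.intervalIntegrable_tConv hγ hG ht x
  have i2 := hP'.intervalIntegrable_tConv hγ' hG' ht x
  have i3 := hP.intervalIntegrable_tConv hγ' hG' ht x
  simp only [tConv, mul_sub, sub_mul]
  rw [intervalIntegral.integral_sub i1 i3, intervalIntegral.integral_sub i3 i2]
  ring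

/-- The temporal kernel is only measurable. After the substitution σ = t - τ it no longer depends on
(t, x), the continuous field is translated instead, and the variable upper limit becomes an
indicator that is discontinuous only at the null set σ = t. -/
theorem StripField.continuousOn_tConv (hT : 0 ≤ T) (hP : StripField T C P) (hγ : Measurable γ)
    (hG : ∀ᵐ s, |γ s| ≤ G) :
    ContinuousOn (fun p : ℝ × ℝ => tConv γ P p.1 p.2) (Icc 0 T ×ˢ univ) := by
  have hc := hP.continuous_clamp hT
  obtain ⟨s₀, hs₀⟩ := hG.exists
  have hG0 : 0 ≤ G := (abs_nonneg _).trans hs₀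
  have hC0 : 0 ≤ C := (abs_nonneg _).trans (hP.bound 0 ⟨le_rfl, hT⟩ 0)
  have hcont : Continuous fun p : ℝ × ℝ =>
      ∫ σ in Ioc 0 T, (Iic p.1).indicator (fun σ => P (clamp T (p.1 - σ)) p.2) σ * γ σ := by
    rw [continuous_iff_continuousAt]
    intro p₀
    refine continuousAt_of_dominated (bound := fun _ => C * G)
      (Eventually.of_forall fun p => ?_) (Eventually.of_forall fun p => ?_)
      (integrable_const _) ?_
    · refine AEStronglyMeasurable.mul (AEStronglyMeasurable.indicator ?_ measurableSet_Iic)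
        hγ.aestronglyMeasurable
      exact (hc.comp (f := fun σ : ℝ => (p.1 - σ, p.2)) (by fun_prop)).aestronglyMeasurable
    · filter_upwards [ae_restrict_of_ae hG] with σ hσ
      rw [norm_mul]
      refine mul_le_mul ?_ hσ (norm_nonneg _) hC0
      by_cases hm : σ ∈ Iic p.1
      · rw [indicator_of_mem hm]; exact hP.bound _ (clamp_mem hT _) _
      · rw [indicator_of_notMem hm, norm_zero]; exact hC0
    · filter_upwards [ae_restrict_of_ae (Measure.ae_ne volume p₀.1)] with σ hσ
      refine ContinuousAt.mul ?_ continuousAt_const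
      have hcσ : Continuous fun p : ℝ × ℝ => P (clamp T (p.1 - σ)) p.2 :=
        hc.comp (f := fun p : ℝ × ℝ => (p.1 - σ, p.2)) (by fun_prop)
      rcases lt_or_gt_of_ne hσ with hlt | hgt
      · refine hcσ.continuousAt.congr ?_
        filter_upwards [continuous_fst.continuousAt.eventually (lt_mem_nhds hlt)] with p hp
        rw [indicator_of_mem (mem_Iic.2 (le_of_lt hp))]
      · refine (continuousAt_const (y := (0 : ℝ))).congr ?_
        filter_upwards [continuous_fst.continuousAt.eventually (gt_mem_nhds hgt)] with p hp
        rw [indicator_of_notMem (fun h => not_le.2 hp (mem_Iic.1 h))]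
  refine hcont.continuousOn.congr ?_
  rintro ⟨t, x⟩ ⟨ht, -⟩
  simp only
  have h1 : tConv γ P t x = ∫ σ in (0 : ℝ)..t, P (t - σ) x * γ σ := by
    have := intervalIntegral.integral_comp_sub_left (a := 0) (b := t)
      (fun σ => P (t - σ) x * γ σ) t
    simpa [tConv] using this
  rw [h1, intervalIntegral.integral_of_le ht.1]
  have h2 : Ioc 0 t = Ioc 0 T ∩ Iic t := by
    ext σ; simp only [mem_Ioc, mem_inter_iff, mem_Iic]
    exact ⟨fun h => ⟨⟨h.1, h.2.trans ht.2⟩, h.2⟩, fun h => ⟨h.1.1, h.2⟩⟩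
  rw [h2, ← setIntegral_indicator measurableSet_Iic]
  refine setIntegral_congr_fun measurableSet_Ioc fun σ hσ => ?_
  by_cases hm : σ ∈ Iic t
  · simp only [indicator_of_mem hm]
    rw [clamp_of_mem ⟨by linarith [mem_Iic.1 hm], by linarith [hσ.1, ht.2]⟩]
  · simp only [indicator_of_notMem hm, zero_mul]

theorem StripField.hasDerivAt_tConv {C' : ℝ} {P' : ℝ → ℝ → ℝ} (hP : StripField T C P)
    (hP' : StripField T C' P') (hγ : Measurable γ) (hG : ∀ᵐ s, |γ s| ≤ G)
    (hd : ∀ τ ∈ Icc 0 T, ∀ x, HasDerivAt (fun y => P τ y) (P' τ x) x) {t : ℝ}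
    (ht : t ∈ Icc 0 T) (x : ℝ) :
    HasDerivAt (fun y => tConv γ P t y) (tConv γ P' t x) x := by
  have hT := ht.1.trans ht.2
  have hC0 : 0 ≤ C' := (abs_nonneg _).trans (hP'.bound 0 ⟨le_rfl, hT⟩ 0)
  have e : ∀ P : ℝ → ℝ → ℝ, ∀ y, tConv γ P t y = ∫ τ in Ioc 0 t, P τ y * γ (t - τ) := fun P y =>
    intervalIntegral.integral_of_le ht.1
  simp only [e]
  refine (hasDerivAt_integral_of_dominated_loc_of_deriv_le (s := univ)
    (F' := fun y τ => P' τ y * γ (t - τ)) (bound := fun _ => C' * G) univ_mem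
    (Eventually.of_forall fun y => (hP.integrable_tConv hγ hG ht y).1)
    (hP.integrable_tConv hγ hG ht x) (hP'.integrable_tConv hγ hG ht x).1
    ?_ (integrable_const _) ?_).2
  · filter_upwards [ae_restrict_of_ae (ae_comp_sub_left hG t), ae_restrict_mem measurableSet_Ioc]
      with τ hτ hτt y _
    rw [norm_mul]
    exact mul_le_mul (hP'.bound τ ⟨hτt.1.le, hτt.2.trans ht.2⟩ y) hτ (norm_nonneg _) hC0
  · filter_upwards [ae_restrict_mem measurableSet_Ioc] with τ hτt y _
    exact (hd τ ⟨hτt.1.le, hτt.2.trans ht.2⟩ y).mul_const _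

/-- Young's inequality for the memory term. -/
theorem StripField.lintegral_tConv_le (hT : 0 ≤ T) (hP : StripField T C P) (hγ : Measurable γ) :
    ∫⁻ t in Ioo 0 T, ∫⁻ x, ‖tConv γ P t x‖ₑ
      ≤ (∫⁻ τ in Ioo 0 T, ∫⁻ x, ‖P τ x‖ₑ) * ∫⁻ s, ‖γ s‖ₑ := by
  have mP : Measurable fun p : ℝ × ℝ => P (clamp T p.1) p.2 := (hP.continuous_clamp hT).measurable
  have mN : Measurable fun τ => ∫⁻ x, ‖P (clamp T τ) x‖ₑ :=
    Measurable.lintegral_prod_right' (f := fun p : ℝ × ℝ => ‖P (clamp T p.1) p.2‖ₑ) mP.enorm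
  have hsl : ∀ τ, Measurable fun x => ‖P (clamp T τ) x‖ₑ := fun τ =>
    (mP.comp (measurable_const.prodMk measurable_id)).enorm
  -- Enlarging the range of τ from (0, t) to (0, T) leaves a product domain, on which Tonelli gives
  -- Young's inequality.
  calc ∫⁻ t in Ioo 0 T, ∫⁻ x, ‖tConv γ P t x‖ₑ
      ≤ ∫⁻ t in Ioo 0 T, ∫⁻ x, ∫⁻ τ in Ioo 0 T, ‖P (clamp T τ) x‖ₑ * ‖γ (t - τ)‖ₑ := by
        refine setLIntegral_mono' measurableSet_Ioo fun t ht => lintegral_mono fun x => ?_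
        rw [tConv, intervalIntegral.integral_of_le ht.1.le]
        refine (enorm_integral_le_lintegral_enorm _).trans ?_
        rw [Measure.restrict_congr_set Ioo_ae_eq_Ioc.symm]
        refine le_trans (setLIntegral_mono' measurableSet_Ioo
          (g := fun τ => ‖P (clamp T τ) x‖ₑ * ‖γ (t - τ)‖ₑ) fun τ hτ => ?_)
          (lintegral_mono_set (Ioo_subset_Ioo_right ht.2.le))
        rw [enorm_mul, clamp_of_mem ⟨hτ.1.le, (hτ.2.trans ht.2).le⟩]
    _ = ∫⁻ t in Ioo 0 T, ∫⁻ τ in Ioo 0 T, (∫⁻ x, ‖P (clamp T τ) x‖ₑ) * ‖γ (t - τ)‖ₑ := by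
        refine lintegral_congr fun t => ?_
        rw [lintegral_lintegral_swap]
        · refine lintegral_congr fun τ => ?_
          rw [lintegral_mul_const _ (hsl τ)]
        · exact ((mP.comp measurable_swap).enorm.mul (by fun_prop)).aemeasurable
    _ = ∫⁻ τ in Ioo 0 T, ∫⁻ t in Ioo 0 T, (∫⁻ x, ‖P (clamp T τ) x‖ₑ) * ‖γ (t - τ)‖ₑ := by
        refine lintegral_lintegral_swap ?_
        exact ((mN.comp measurable_snd).mul (by fun_prop)).aemeasurable
    _ ≤ ∫⁻ τ in Ioo 0 T, (∫⁻ x, ‖P (clamp T τ) x‖ₑ) * ∫⁻ s, ‖γ s‖ₑ := by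
        refine lintegral_mono fun τ => ?_
        rw [lintegral_const_mul _ (by fun_prop)]
        refine mul_le_mul_right ?_ _
        refine (setLIntegral_le_lintegral _ _).trans_eq ?_
        exact lintegral_sub_right_eq_self (fun s => ‖γ s‖ₑ) τ
    _ = (∫⁻ τ in Ioo 0 T, ∫⁻ x, ‖P (clamp T τ) x‖ₑ) * ∫⁻ s, ‖γ s‖ₑ :=
        lintegral_mul_const _ mN
    _ = _ := by
        congr 1
        refine setLIntegral_congr_fun measurableSet_Ioo fun τ hτ => ?_
        rw [clamp_of_mem (Ioo_subset_Icc_self hτ)]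

end TConv

/-! ### The strip, and restriction of entropy solutions to shorter times. -/

theorem measurableSet_QT (T : ℝ) : MeasurableSet (QT T) := measurableSet_Ioo.prod MeasurableSet.univ

theorem QT_mono {t T : ℝ} (h : t ≤ T) : QT t ⊆ QT T :=
  prod_mono (Ioo_subset_Ioo_right h) (subset_univ _)

theorem volume_restrict_QT (T : ℝ) :
    volume.restrict (QT T) = (volume.restrict (Ioo 0 T)).prod (volume : Measure ℝ) := by
  rw [QT, Measure.volume_eq_prod, ← Measure.prod_restrict, Measure.restrict_univ]

variable {N : ℕ} {D : SystemData N} {T : ℝ} {U₀ : Fin N → ℝ → ℝ} {U : Fin N → ℝ → ℝ → ℝ}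

/-- A test function supported before time t does not see the solution afterwards. Hence a solution
on [0, T] is one on [0, t], and an estimate at the final time yields one at every time. -/
theorem entropyForm_eq_of_le {t : ℝ} (ht : t ≤ T) {φ : ℝ × ℝ → ℝ} (hφ : IsTestFunction t φ)
    (k : Fin N) (α : ℝ) : D.entropyForm T U₀ U k α φ = D.entropyForm t U₀ U k α φ := by
  have hz : ∀ p ∈ QT T \ QT t, p ∉ tsupport φ := fun p hp h =>
    hp.2 ⟨⟨hp.1.1.1, (hφ.support h).1⟩, mem_univ _⟩
  have h1 : ∀ p ∈ QT T \ QT t, deriv (fun s => φ (s, p.2)) p.1 = 0 := fun p hp =>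
    timeDeriv_eq_zero hφ.smooth (hz p hp)
  have h2 : ∀ p ∈ QT T \ QT t, deriv (fun y => φ (p.1, y)) p.2 = 0 := fun p hp =>
    spaceDeriv_eq_zero hφ.smooth (hz p hp)
  have h3 : ∀ p ∈ QT T \ QT t, φ p = 0 := fun p hp => image_eq_zero_of_notMem_tsupport (hz p hp)
  have key : ∀ F : ℝ × ℝ → ℝ, (∀ p ∈ QT T \ QT t, F p = 0) → ∫ p in QT T, F p = ∫ p in QT t, F p :=
    fun F hF => setIntegral_eq_of_subset_of_forall_sdiff_eq_zero (measurableSet_QT T) (QT_mono ht) hF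
  unfold SystemData.entropyForm
  rw [key _ fun p hp => by rw [h1 p hp, mul_zero], key _ fun p hp => by rw [h2 p hp, mul_zero],
    key (fun p => _ * φ p) fun p hp => by rw [h3 p hp, mul_zero],
    key (fun p => _ * φ p) fun p hp => by rw [h3 p hp, mul_zero]]

theorem IsTestFunction.mono {t : ℝ} (ht : t ≤ T) {φ : ℝ × ℝ → ℝ} (hφ : IsTestFunction t φ) :
    IsTestFunction T φ where
  smooth := hφ.smooth
  compact := hφ.compact
  support := hφ.support.trans (prod_mono (Iio_subset_Iio ht) (subset_univ _))
  nonneg s hs x := by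
    by_cases h : s < t
    · exact hφ.nonneg s ⟨hs.1, h⟩ x
    · have h0 : (s, x) ∉ tsupport φ := fun h' => h (hφ.support h').1
      exact (image_eq_zero_of_notMem_tsupport h0).ge

/-- Restriction of an entropy solution to a shorter time interval. -/
theorem IsEntropySolution.mono (hU : IsEntropySolution D T U₀ U) {t : ℝ} (ht : t ≤ T) :
    IsEntropySolution D t U₀ U where
  measurable k := (hU.measurable k).mono_measure (Measure.restrict_mono (QT_mono ht) le_rfl)
  integrable k s hs := hU.integrable k s ⟨hs.1, hs.2.trans ht⟩
  range k s hs := hU.range k s ⟨hs.1, hs.2.trans ht⟩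
  continuous k s hs := (hU.continuous k s ⟨hs.1, hs.2.trans ht⟩).mono_left
    (nhdsWithin_mono _ (Icc_subset_Icc_right ht))
  bv k := by
    obtain ⟨B, hB⟩ := hU.bv k
    exact ⟨B, ae_restrict_of_ae_restrict_of_subset (Icc_subset_Icc_right ht) hB⟩
  entropy k α φ hφ := by
    rw [← entropyForm_eq_of_le ht hφ]
    exact hU.entropy k α φ (hφ.mono ht)

/-! ### Representatives on the plane -/

/-- `u` is a measurable function on the plane, vanishing off the strip, whose slices are those
of `w`. -/
structure PlaneRep (T : ℝ) (w : ℝ → ℝ → ℝ) (u : ℝ × ℝ → ℝ) : Prop where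
  meas : Measurable u
  zero : ∀ p, p ∉ QT T → u p = 0
  slice : ∀ᵐ t, t ∈ Ioo 0 T → ∀ᵐ x, u (t, x) = w t x

theorem L1Curve.intervalIntegrable_norm {w : ℝ → ℝ → ℝ} (hw : L1Curve T w) (hT : 0 ≤ T) :
    IntervalIntegrable (fun t => ∫ x, |w t x|) volume 0 T := by
  refine ContinuousOn.intervalIntegrable ?_
  rw [uIcc_of_le hT]
  exact hw.continuousOn_norm

theorem L1Curve.lintegral_norm {w : ℝ → ℝ → ℝ} (hw : L1Curve T w) (hT : 0 ≤ T) :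
    ∫⁻ t in Ioo 0 T, ∫⁻ x, ‖w t x‖ₑ = ENNReal.ofReal (∫ t in (0 : ℝ)..T, ∫ x, |w t x|) := by
  have hi : IntegrableOn (fun t => ∫ x, |w t x|) (Ioo 0 T) :=
    (hw.continuousOn_norm.integrableOn_Icc).mono_set Ioo_subset_Icc_self
  rw [intervalIntegral.integral_of_le hT, Measure.restrict_congr_set Ioo_ae_eq_Ioc.symm,
    ofReal_integral_eq_lintegral_ofReal hi (ae_of_all _ fun t => integral_nonneg fun x => abs_nonneg _)]
  refine setLIntegral_congr_fun measurableSet_Ioo fun t ht => ?_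
  rw [ofReal_integral_eq_lintegral_ofReal (hw.integrable t (Ioo_subset_Icc_self ht)).abs
    (ae_of_all _ fun x => abs_nonneg _)]
  simp [Real.enorm_eq_ofReal_abs]

namespace PlaneRep

variable {w w' : ℝ → ℝ → ℝ} {u u' : ℝ × ℝ → ℝ}

theorem sub (hu : PlaneRep T w u) (hu' : PlaneRep T w' u') :
    PlaneRep T (fun t x => w t x - w' t x) fun p => u p - u' p where
  meas := hu.meas.sub hu'.meas
  zero p hp := by rw [hu.zero p hp, hu'.zero p hp, sub_zero]
  slice := by
    filter_upwards [hu.slice, hu'.slice] with t h1 h2 ht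
    filter_upwards [h1 ht, h2 ht] with x h3 h4
    rw [h3, h4]

theorem lintegral_eq (hu : PlaneRep T w u) :
    ∫⁻ p, ‖u p‖ₑ = ∫⁻ t in Ioo 0 T, ∫⁻ x, ‖w t x‖ₑ := by
  rw [Measure.volume_eq_prod, lintegral_prod _ hu.meas.enorm.aemeasurable,
    ← lintegral_indicator measurableSet_Ioo]
  refine lintegral_congr_ae ?_
  filter_upwards [hu.slice] with t h1
  by_cases ht : t ∈ Ioo 0 T
  · rw [indicator_of_mem ht]
    refine lintegral_congr_ae ?_
    filter_upwards [h1 ht] with x hx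
    rw [hx]
  · rw [indicator_of_notMem ht]
    have : ∀ x, u (t, x) = 0 := fun x => hu.zero _ fun h => ht h.1
    simp [this]

theorem integrable (hu : PlaneRep T w u) (hw : L1Curve T w) (hT : 0 ≤ T) : Integrable u := by
  refine ⟨hu.meas.aestronglyMeasurable, ?_⟩
  rw [hasFiniteIntegral_iff_enorm, hu.lintegral_eq, hw.lintegral_norm hT]
  exact ENNReal.ofReal_lt_top

theorem integral_abs (hu : PlaneRep T w u) (hw : L1Curve T w) (hT : 0 ≤ T) :
    ∫ p, |u p| = ∫ t in (0 : ℝ)..T, ∫ x, |w t x| := by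
  rw [integral_eq_lintegral_of_nonneg_ae (ae_of_all _ fun p => abs_nonneg _)
    hu.meas.abs.aestronglyMeasurable]
  simp_rw [← Real.enorm_eq_ofReal_abs]
  rw [hu.lintegral_eq, hw.lintegral_norm hT, ENNReal.toReal_ofReal]
  exact intervalIntegral.integral_nonneg hT fun t _ => integral_nonneg fun x => abs_nonneg _

/-- Passing from almost every slice to almost every point needs a measurable coincidence set, so u
is first compared with a measurable modification of w. -/
theorem ae_eq (hu : PlaneRep T w u)
    (hw : AEStronglyMeasurable (fun p : ℝ × ℝ => w p.1 p.2) (volume.restrict (QT T))) :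
    ∀ᵐ p ∂(volume.restrict (QT T)), u p = w p.1 p.2 := by
  have h1 := hw.ae_eq_mk
  have hm : Measurable (hw.mk fun p : ℝ × ℝ => w p.1 p.2) := hw.stronglyMeasurable_mk.measurable
  generalize hw.mk (fun p : ℝ × ℝ => w p.1 p.2) = m at h1 hm
  have h2 : ∀ᵐ p ∂(volume.restrict (QT T)), u p = m p := by
    rw [volume_restrict_QT] at h1
    rw [volume_restrict_QT, Measure.ae_prod_iff_ae_ae]
    · have h3 := Measure.ae_ae_of_ae_prod h1
      have h4 := (ae_restrict_iff' (measurableSet_Ioo (a := 0) (b := T))).2 hu.slice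
      filter_upwards [h3, h4] with t h5 h6
      filter_upwards [h5, h6] with x h7 h8
      rw [h8]; exact h7
    · exact measurableSet_eq_fun hu.meas hm
  filter_upwards [h1, h2] with p h3 h4
  rw [h4, ← h3]

/-- The translation estimate for BV functions, integrated over the slices. This supplies the
constant B of the scalar theory. -/
theorem integral_translate_le (hu : PlaneRep T w u) (hw : L1Curve T w) (hT : 0 ≤ T) {B : ℝ≥0}
    (hB : ∀ t ∈ Icc 0 T, totalVar (w t) ≤ B) {h : ℝ} (hh : 0 < h) :
    ∫ p, |u (p - (0, h)) - u p| ≤ T * B * h := by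
  have hi := hu.integrable hw hT
  have hint : Integrable (fun p => |u (p - (0, h)) - u p|) := ((hi.comp_sub_right (0, h)).sub hi).abs
  rw [Measure.volume_eq_prod] at hint ⊢
  rw [integral_prod _ hint]
  calc ∫ t, ∫ x, |u ((t, x) - (0, h)) - u (t, x)| ≤ ∫ t, (Ioo 0 T).indicator (fun _ => B * h) t := by
        refine integral_mono_ae hint.integral_prod_left
          ((integrable_indicator_iff measurableSet_Ioo).2 (integrableOn_const (by simp))) ?_
        filter_upwards [hu.slice] with t h1
        by_cases ht : t ∈ Ioo 0 T
        · rw [indicator_of_mem ht]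
          refine le_trans (le_of_eq ?_) (integral_abs_translate_sub_le
            (hw.integrable t (Ioo_subset_Icc_self ht)) (hB t (Ioo_subset_Icc_self ht)) hh)
          refine integral_congr_ae ?_
          have h2 : ∀ᵐ x, u (t, x - h) = w t (x - h) :=
            (measurePreserving_sub_right volume h).quasiMeasurePreserving.ae (h1 ht)
          filter_upwards [h1 ht, h2] with x h3 h4
          simp [h3, h4]
        · rw [indicator_of_notMem ht]
          have : ∀ x, u (t, x) = 0 := fun x => hu.zero _ fun h => ht h.1
          simp [this]
    _ = T * B * h := by
        rw [integral_indicator measurableSet_Ioo, setIntegral_const]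
        simp [measureReal_def, hT, mul_assoc]

end PlaneRep

/-- Every component of an entropy solution has a representative with values in `[0, 1]`. -/
theorem IsEntropySolution.exists_planeRep (hU : IsEntropySolution D T U₀ U) (k : Fin N) :
    ∃ u : ℝ × ℝ → ℝ, PlaneRep T (U k) u ∧ ∀ p, u p ∈ Icc (0 : ℝ) 1 := by
  have hm := hU.measurable k
  have h1 := hm.ae_eq_mk
  set m := hm.mk (fun p : ℝ × ℝ => U k p.1 p.2) with hmk
  have mm : Measurable m := hm.stronglyMeasurable_mk.measurable
  -- Truncation enforces values in [0, 1] everywhere, while on almost every slice it changes nothing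
  -- up to null sets.
  refine ⟨(QT T).indicator fun p => max 0 (min 1 (m p)), ⟨?_, ?_, ?_⟩, ?_⟩
  · exact Measurable.indicator (by fun_prop) (measurableSet_QT T)
  · exact fun p hp => indicator_of_notMem hp _
  · rw [volume_restrict_QT] at h1
    have h3 := Measure.ae_ae_of_ae_prod h1
    rw [ae_restrict_iff' measurableSet_Ioo] at h3
    filter_upwards [h3] with t h4 ht
    filter_upwards [h4 ht, hU.range k t (Ioo_subset_Icc_self ht)] with x h5 h6
    rw [indicator_of_mem (show (t, x) ∈ QT T from ⟨ht, mem_univ _⟩)]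
    have h7 : m (t, x) = U k t x := h5.symm
    rw [h7, min_eq_right h6.2, max_eq_right h6.1]
  · intro p
    by_cases hp : p ∈ QT T
    · rw [indicator_of_mem hp]
      exact ⟨le_max_left _ _, max_le zero_le_one (min_le_left _ _)⟩
    · rw [indicator_of_notMem hp]; exact ⟨le_rfl, zero_le_one⟩

/-! ### Space-time convolutions with product kernels -/

/-- Bounds for a pair of a spatial kernel `κ` and a temporal kernel `γ`. -/
structure KernelBound (c G : ℝ) (κ γ : ℝ → ℝ) : Prop where
  κ_cont : Continuous κ
  κ_le : ∀ x, |κ x| ≤ c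
  γ_meas : AEStronglyMeasurable γ halfLine
  γ_le : ∀ᵐ s ∂halfLine, |γ s| ≤ G

theorem nonneg_of_ae_halfLine {γ : ℝ → ℝ} {G : ℝ} (h : ∀ᵐ s ∂halfLine, |γ s| ≤ G) : 0 ≤ G := by
  have : NeBot (ae halfLine) := by
    rw [ae_neBot, halfLine]
    simp
  obtain ⟨s, hs⟩ := h.exists
  exact (abs_nonneg _).trans hs

theorem continuous_comp_clamp {T : ℝ} {P : ℝ → ℝ → ℝ} (hT : 0 ≤ T)
    (hP : ContinuousOn (fun p : ℝ × ℝ => P p.1 p.2) (Icc 0 T ×ˢ univ)) :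
    Continuous fun p : ℝ × ℝ => P (clamp T p.1) p.2 := by
  have h : Continuous fun p : ℝ × ℝ => (clamp T p.1, p.2) := by
    have := continuous_clamp T
    fun_prop
  exact hP.comp_continuous h fun p => ⟨clamp_mem hT _, mem_univ _⟩

/-- Additivity of the upper integral requires one measurable summand; continuity of P on the strip
provides it after clamping the time. -/
theorem lintegral_strip_add_le {T : ℝ} {P Q : ℝ → ℝ → ℝ} (hT : 0 ≤ T)
    (hP : ContinuousOn (fun p : ℝ × ℝ => P p.1 p.2) (Icc 0 T ×ˢ univ)) :
    ∫⁻ t in Ioo 0 T, ∫⁻ x, ‖P t x + Q t x‖ₑ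
      ≤ (∫⁻ t in Ioo 0 T, ∫⁻ x, ‖P t x‖ₑ) + ∫⁻ t in Ioo 0 T, ∫⁻ x, ‖Q t x‖ₑ := by
  have mP : Measurable fun p : ℝ × ℝ => P (clamp T p.1) p.2 := (continuous_comp_clamp hT hP).measurable
  have mN : Measurable fun τ => ∫⁻ x, ‖P (clamp T τ) x‖ₑ :=
    Measurable.lintegral_prod_right' (f := fun p : ℝ × ℝ => ‖P (clamp T p.1) p.2‖ₑ) mP.enorm
  have e : ∫⁻ t in Ioo 0 T, ∫⁻ x, ‖P t x‖ₑ = ∫⁻ t in Ioo 0 T, ∫⁻ x, ‖P (clamp T t) x‖ₑ := by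
    refine setLIntegral_congr_fun measurableSet_Ioo fun τ hτ => ?_
    rw [clamp_of_mem (Ioo_subset_Icc_self hτ)]
  rw [e, ← lintegral_add_left mN]
  refine setLIntegral_mono' measurableSet_Ioo fun t ht => ?_
  rw [← lintegral_add_left]
  · rw [clamp_of_mem (Ioo_subset_Icc_self ht)]
    exact lintegral_mono fun x => enorm_add_le _ _
  · exact (mP.comp (measurable_const.prodMk measurable_id)).enorm

theorem StripField.sub {T C C' : ℝ} {P Q : ℝ → ℝ → ℝ} (hP : StripField T C P)
    (hQ : StripField T C' Q) : StripField T (C + C') fun t x => P t x - Q t x where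
  continuousOn := hP.continuousOn.sub hQ.continuousOn
  bound t ht x := (abs_sub _ _).trans (add_le_add (hP.bound t ht x) (hQ.bound t ht x))

theorem L1Curve.exists_bound {T : ℝ} {w : ℝ → ℝ → ℝ} (hw : L1Curve T w) :
    ∃ S, 0 ≤ S ∧ ∀ t ∈ Icc 0 T, ∫ x, |w t x| ≤ S := by
  obtain ⟨S, hS⟩ := isCompact_Icc.exists_bound_of_continuousOn hw.continuousOn_norm
  refine ⟨max S 0, le_max_right _ _, fun t ht => ?_⟩
  exact ((le_abs_self _).trans (hS t ht)).trans (le_max_left _ _)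

/-- The `L^1` norm of a curve over space and time. -/
def curveNorm (T : ℝ) (w : ℝ → ℝ → ℝ) : ℝ := ∫ t in (0 : ℝ)..T, ∫ x, |w t x|

theorem curveNorm_nonneg {T : ℝ} (hT : 0 ≤ T) (w : ℝ → ℝ → ℝ) : 0 ≤ curveNorm T w :=
  intervalIntegral.integral_nonneg hT fun _ _ => integral_nonneg fun _ => abs_nonneg _

theorem ae_abs_le_of_kernel_rep {T : ℝ} {γ γ' g g' : ℝ → ℝ} {d : ℝ}
    (h1 : ∀ s, s ∉ Ico 0 T → g s = 0) (h2 : ∀ᵐ s, s ∈ Ico 0 T → g s = γ s)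
    (h1' : ∀ s, s ∉ Ico 0 T → g' s = 0) (h2' : ∀ᵐ s, s ∈ Ico 0 T → g' s = γ' s)
    (hd : ∀ᵐ s ∂halfLine, |γ s - γ' s| ≤ d) : ∀ᵐ s, |g s - g' s| ≤ d := by
  have hd0 := nonneg_of_ae_halfLine hd
  unfold halfLine at hd
  rw [ae_restrict_iff' measurableSet_Ici] at hd
  filter_upwards [h2, h2', hd] with s h3 h4 h5
  by_cases hs : s ∈ Ico 0 T
  · rw [h3 hs, h4 hs]; exact h5 hs.1
  · rw [h1 s hs, h1' s hs, sub_zero, abs_zero]; exact hd0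

section

variable {T c G : ℝ} {κ γ κ' γ' : ℝ → ℝ} {w w' : ℝ → ℝ → ℝ}

theorem KernelBound.continuousOn (h : KernelBound c G κ γ) (hT : 0 ≤ T) (hw : L1Curve T w) :
    ContinuousOn (fun p : ℝ × ℝ => tConv γ (spConv κ w) p.1 p.2) (Icc 0 T ×ˢ univ) := by
  obtain ⟨S, -, hS⟩ := hw.exists_bound
  obtain ⟨g, g1, g2, g3, g4⟩ :=
    exists_kernel_rep (nonneg_of_ae_halfLine h.γ_le) T h.γ_meas h.γ_le
  refine ((hw.stripField_spConv h.κ_cont h.κ_le hS).continuousOn_tConv hT g1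
    (ae_of_all _ g2)).congr ?_
  rintro ⟨t, x⟩ ⟨ht, -⟩
  exact tConv_congr g4 _ ht x

theorem KernelBound.abs_le (h : KernelBound c G κ γ) (hw : L1Curve T w) {t : ℝ}
    (ht : t ∈ Icc 0 T) (x : ℝ) :
    |tConv γ (spConv κ w) t x| ≤ G * c * curveNorm T w := by
  obtain ⟨g, g1, g2, g3, g4⟩ :=
    exists_kernel_rep (nonneg_of_ae_halfLine h.γ_le) T h.γ_meas h.γ_le
  rw [tConv_congr g4 _ ht x, curveNorm, mul_assoc, ← intervalIntegral.integral_const_mul]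
  exact StripField.abs_tConv_le (ae_of_all _ g2) ht x (hw.continuousOn_norm.const_smul c)
    fun τ hτ => abs_spConv_le h.κ_le (hw.integrable τ hτ) x

theorem KernelBound.hasDerivAt (h : KernelBound c G κ γ) (hκ : ContDiff ℝ 1 κ) {c' : ℝ}
    (hc' : ∀ x, |deriv κ x| ≤ c') (hw : L1Curve T w) {t : ℝ} (ht : t ∈ Icc 0 T) (x : ℝ) :
    HasDerivAt (fun y => tConv γ (spConv κ w) t y) (tConv γ (spConv (deriv κ) w) t x) x := by
  obtain ⟨S, -, hS⟩ := hw.exists_bound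
  obtain ⟨g, g1, g2, g3, g4⟩ :=
    exists_kernel_rep (nonneg_of_ae_halfLine h.γ_le) T h.γ_meas h.γ_le
  simp only [tConv_congr g4 _ ht]
  exact (hw.stripField_spConv h.κ_cont h.κ_le hS).hasDerivAt_tConv
    (hw.stripField_spConv (hκ.continuous_deriv le_rfl) hc' hS) g1 (ae_of_all _ g2)
    (fun τ hτ x => hasDerivAt_spConv hκ h.κ_le hc' (hw.integrable τ hτ) x) ht x

/-- Uniform stability of the space-time convolution. -/
theorem KernelBound.abs_sub_le (h : KernelBound c G κ γ) (h' : KernelBound c G κ' γ')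
    (hw : L1Curve T w) (hw' : L1Curve T w') {dκ dγ : ℝ} (hdκ : ∀ x, |κ x - κ' x| ≤ dκ)
    (hdγ : ∀ᵐ s ∂halfLine, |γ s - γ' s| ≤ dγ) {t : ℝ} (ht : t ∈ Icc 0 T) (x : ℝ) :
    |tConv γ (spConv κ w) t x - tConv γ' (spConv κ' w') t x|
      ≤ (dγ * c + G * dκ) * curveNorm T w
        + G * c * curveNorm T fun t x => w t x - w' t x := by
  have hT := ht.1.trans ht.2
  obtain ⟨S, hS0, hS⟩ := hw.exists_bound
  obtain ⟨S', hS0', hS'⟩ := hw'.exists_bound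
  obtain ⟨g, g1, g2, g3, g4⟩ :=
    exists_kernel_rep (nonneg_of_ae_halfLine h.γ_le) T h.γ_meas h.γ_le
  obtain ⟨g', g1', g2', g3', g4'⟩ :=
    exists_kernel_rep (nonneg_of_ae_halfLine h'.γ_le) T h'.γ_meas h'.γ_le
  have hc0 : 0 ≤ c := (abs_nonneg _).trans (h.κ_le 0)
  have hP := hw.stripField_spConv h.κ_cont h.κ_le fun t ht => (hS t ht).trans (le_max_left S S')
  have hP' := hw'.stripField_spConv h'.κ_cont h'.κ_le fun t ht => (hS' t ht).trans (le_max_right S S')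
  have hws := hw.sub hw'
  rw [tConv_congr g4 _ ht x, tConv_congr g4' _ ht x,
    hP.tConv_sub hP' g1 g1' (ae_of_all _ g2) (ae_of_all _ g2') ht x]
  have e1 : |tConv (fun s => g s - g' s) (spConv κ w) t x| ≤ dγ * (c * curveNorm T w) := by
    rw [curveNorm, ← intervalIntegral.integral_const_mul]
    exact StripField.abs_tConv_le (ae_abs_le_of_kernel_rep g3 g4 g3' g4' hdγ) ht x
      (hw.continuousOn_norm.const_smul c)
      fun τ hτ => abs_spConv_le h.κ_le (hw.integrable τ hτ) x
  have e2 : |tConv g' (fun τ y => spConv κ w τ y - spConv κ' w' τ y) t x|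
      ≤ G * (dκ * curveNorm T w + c * curveNorm T fun t x => w t x - w' t x) := by
    rw [curveNorm, curveNorm, ← intervalIntegral.integral_const_mul,
      ← intervalIntegral.integral_const_mul, ← intervalIntegral.integral_add
      ((hw.intervalIntegrable_norm hT).const_mul _) ((hws.intervalIntegrable_norm hT).const_mul _)]
    refine StripField.abs_tConv_le (ae_of_all _ g2') ht x
      ((hw.continuousOn_norm.const_smul dκ).add (hws.continuousOn_norm.const_smul c))
      fun τ hτ => ?_
    rw [spConv_sub h.κ_cont h.κ_le h'.κ_cont h'.κ_le (hw.integrable τ hτ) (hw'.integrable τ hτ)]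
    exact (abs_add_le _ _).trans (add_le_add (abs_spConv_le hdκ (hw.integrable τ hτ) x)
      (abs_spConv_le h'.κ_le (hws.integrable τ hτ) x))
  refine (abs_add_le _ _).trans ((add_le_add e1 e2).trans_eq ?_)
  ring

theorem lintegral_spConv_strip_le (hT : 0 ≤ T) (hκ : Continuous κ) (hi : Integrable κ)
    (hw : L1Curve T w) :
    ∫⁻ t in Ioo 0 T, ∫⁻ x, ‖spConv κ w t x‖ₑ
      ≤ ENNReal.ofReal (curveNorm T w) * ∫⁻ x, ‖κ x‖ₑ := by
  rw [curveNorm, ← hw.lintegral_norm hT, ← lintegral_mul_const' _ _ hi.2.ne]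
  exact setLIntegral_mono' measurableSet_Ioo fun t ht =>
    lintegral_spConv_le hκ (hw.integrable t (Ioo_subset_Icc_self ht))

theorem lintegral_kernel_rep_le {g : ℝ → ℝ} {G : ℝ} (h2 : ∀ s, |g s| ≤ G)
    (h3 : ∀ s, s ∉ Ico 0 T → g s = 0) : ∫⁻ s, ‖g s‖ₑ ≤ ENNReal.ofReal (G * T) := by
  have hG : 0 ≤ G := (abs_nonneg _).trans (h2 0)
  calc ∫⁻ s, ‖g s‖ₑ ≤ ∫⁻ s, (Ico 0 T).indicator (fun _ => ENNReal.ofReal G) s := by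
        refine lintegral_mono fun s => ?_
        by_cases hs : s ∈ Ico 0 T
        · rw [indicator_of_mem hs, Real.enorm_eq_ofReal_abs]
          exact ENNReal.ofReal_le_ofReal (h2 s)
        · simp [h3 s hs]
    _ = ENNReal.ofReal (G * T) := by
        rw [lintegral_indicator measurableSet_Ico, setLIntegral_const, Real.volume_Ico, sub_zero,
          ENNReal.ofReal_mul hG]

theorem KernelBound.lintegral_le (h : KernelBound c G κ γ) (hi : Integrable κ) (hT : 0 ≤ T)
    (hw : L1Curve T w) :
    ∫⁻ t in Ioo 0 T, ∫⁻ x, ‖tConv γ (spConv κ w) t x‖ₑ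
      ≤ ENNReal.ofReal (curveNorm T w) * (∫⁻ x, ‖κ x‖ₑ) * ENNReal.ofReal (G * T) := by
  obtain ⟨S, -, hS⟩ := hw.exists_bound
  obtain ⟨g, g1, g2, g3, g4⟩ :=
    exists_kernel_rep (nonneg_of_ae_halfLine h.γ_le) T h.γ_meas h.γ_le
  have e : ∫⁻ t in Ioo 0 T, ∫⁻ x, ‖tConv γ (spConv κ w) t x‖ₑ
      = ∫⁻ t in Ioo 0 T, ∫⁻ x, ‖tConv g (spConv κ w) t x‖ₑ := by
    refine setLIntegral_congr_fun measurableSet_Ioo fun t ht => ?_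
    simp only [tConv_congr g4 _ (Ioo_subset_Icc_self ht)]
  rw [e]
  refine ((hw.stripField_spConv h.κ_cont h.κ_le hS).lintegral_tConv_le hT g1).trans ?_
  exact mul_le_mul' (lintegral_spConv_strip_le hT h.κ_cont hi hw) (lintegral_kernel_rep_le g2 g3)

/-- `L^1` stability of the space-time convolution. -/
theorem KernelBound.lintegral_sub_le (h : KernelBound c G κ γ) (h' : KernelBound c G κ' γ')
    (hi : Integrable κ) (hi' : Integrable κ') (hT : 0 ≤ T) (hw : L1Curve T w)
    (hw' : L1Curve T w') :
    ∫⁻ t in Ioo 0 T, ∫⁻ x, ‖tConv γ (spConv κ w) t x - tConv γ' (spConv κ' w') t x‖ₑ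
      ≤ ENNReal.ofReal (curveNorm T w) * (∫⁻ x, ‖κ x‖ₑ) * (∫⁻ s, ‖γ s - γ' s‖ₑ ∂halfLine)
        + (ENNReal.ofReal (curveNorm T w) * (∫⁻ x, ‖κ x - κ' x‖ₑ)
          + ENNReal.ofReal (curveNorm T fun t x => w t x - w' t x) * ∫⁻ x, ‖κ' x‖ₑ)
          * ENNReal.ofReal (G * T) := by
  obtain ⟨S, hS0, hS⟩ := hw.exists_bound
  obtain ⟨S', hS0', hS'⟩ := hw'.exists_bound
  obtain ⟨g, g1, g2, g3, g4⟩ :=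
    exists_kernel_rep (nonneg_of_ae_halfLine h.γ_le) T h.γ_meas h.γ_le
  obtain ⟨g', g1', g2', g3', g4'⟩ :=
    exists_kernel_rep (nonneg_of_ae_halfLine h'.γ_le) T h'.γ_meas h'.γ_le
  have hP := hw.stripField_spConv h.κ_cont h.κ_le fun t ht => (hS t ht).trans (le_max_left S S')
  have hP' := hw'.stripField_spConv h'.κ_cont h'.κ_le fun t ht => (hS' t ht).trans (le_max_right S S')
  have hws := hw.sub hw'
  have e : ∫⁻ t in Ioo 0 T, ∫⁻ x, ‖tConv γ (spConv κ w) t x - tConv γ' (spConv κ' w') t x‖ₑ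
      = ∫⁻ t in Ioo 0 T, ∫⁻ x, ‖tConv (fun s => g s - g' s) (spConv κ w) t x
        + tConv g' (fun τ y => spConv κ w τ y - spConv κ' w' τ y) t x‖ₑ := by
    refine setLIntegral_congr_fun measurableSet_Ioo fun t ht => ?_
    have ht' := Ioo_subset_Icc_self ht
    refine lintegral_congr fun x => ?_
    rw [tConv_congr g4 _ ht' x, tConv_congr g4' _ ht' x,
      hP.tConv_sub hP' g1 g1' (ae_of_all _ g2) (ae_of_all _ g2') ht' x]
  rw [e]
  have hgg : ∀ᵐ s, |g s - g' s| ≤ G + G := ae_of_all _ fun s =>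
    (abs_sub _ _).trans (add_le_add (g2 s) (g2' s))
  refine (lintegral_strip_add_le hT (hP.continuousOn_tConv hT (g1.sub g1') hgg)).trans ?_
  refine add_le_add ?_ ?_
  · refine (hP.lintegral_tConv_le hT (g1.sub g1')).trans ?_
    refine mul_le_mul' (lintegral_spConv_strip_le hT h.κ_cont hi hw) ?_
    rw [halfLine, ← lintegral_indicator measurableSet_Ici]
    refine lintegral_mono_ae ?_
    filter_upwards [g4, g4'] with s h3 h4
    by_cases hs : s ∈ Ico 0 T
    · rw [indicator_of_mem (mem_Ici.2 hs.1), Pi.sub_apply, h3 hs, h4 hs]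
    · simp [g3 s hs, g3' s hs]
  · refine ((hP.sub hP').lintegral_tConv_le hT g1').trans ?_
    refine mul_le_mul' ?_ (lintegral_kernel_rep_le g2' g3')
    have e3 : ∫⁻ t in Ioo 0 T, ∫⁻ x, ‖spConv κ w t x - spConv κ' w' t x‖ₑ
        = ∫⁻ t in Ioo 0 T, ∫⁻ x, ‖spConv (fun y => κ y - κ' y) w t x
          + spConv κ' (fun t y => w t y - w' t y) t x‖ₑ := by
      refine setLIntegral_congr_fun measurableSet_Ioo fun t ht => ?_
      have ht' := Ioo_subset_Icc_self ht
      refine lintegral_congr fun x => ?_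
      rw [spConv_sub h.κ_cont h.κ_le h'.κ_cont h'.κ_le (hw.integrable t ht')
        (hw'.integrable t ht')]
    rw [e3]
    have hκκ : ∀ x, |κ x - κ' x| ≤ c + c := fun x =>
      (abs_sub _ _).trans (add_le_add (h.κ_le x) (h'.κ_le x))
    refine (lintegral_strip_add_le hT
      (hw.stripField_spConv (h.κ_cont.sub h'.κ_cont) hκκ hS).continuousOn).trans ?_
    exact add_le_add (lintegral_spConv_strip_le hT (h.κ_cont.sub h'.κ_cont) (hi.sub hi') hw)
      (lintegral_spConv_strip_le hT h'.κ_cont hi' hws)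

end

/-! ### Pointwise bounds from norm bounds -/

/-- A continuous function that exceeds c at a point exceeds it on an open set, which has positive
measure. -/
theorem abs_le_of_supNorm_le {E : Type*} [TopologicalSpace E] [MeasureSpace E]
    [(volume : Measure E).IsOpenPosMeasure] {g : E → ℝ} (hg : Continuous g) {c : ℝ} (hc0 : 0 ≤ c)
    (hc : supNorm g ≤ ENNReal.ofReal c) (x : E) : |g x| ≤ c := by
  have h1 : ∀ᵐ x, |g x| ≤ c := by
    have := ae_le_eLpNormEssSup (f := g) (μ := volume)
    filter_upwards [this] with y hy
    rw [← eLpNorm_exponent_top, Real.enorm_eq_ofReal_abs] at hy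
    exact (ENNReal.ofReal_le_ofReal_iff hc0).1 (hy.trans hc)
  by_contra! hlt
  have ho : IsOpen {y | c < |g y|} := isOpen_lt continuous_const hg.abs
  refine (ho.measure_pos volume ⟨x, hlt⟩).ne' ?_
  rw [ae_iff] at h1
  simpa using h1

theorem ae_abs_le_of_eLpNorm_top_le {μ : Measure ℝ} {g : ℝ → ℝ} {c : ℝ} (hc0 : 0 ≤ c)
    (hc : eLpNorm g (⊤ : ℝ≥0∞) μ ≤ ENNReal.ofReal c) : ∀ᵐ s ∂μ, |g s| ≤ c := by
  filter_upwards [ae_le_eLpNormEssSup (f := g) (μ := μ)] with y hy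
  rw [← eLpNorm_exponent_top, Real.enorm_eq_ofReal_abs] at hy
  exact (ENNReal.ofReal_le_ofReal_iff hc0).1 (hy.trans hc)

/-- In [0, ∞] the quotient 0 / 0 is 0, so the case y = 0 of a difference quotient carries no
information and is supplied by `hxy`. -/
theorem le_mul_of_ofReal_div_le {x y c : ℝ} (hy : 0 ≤ y) (hc : 0 ≤ c) (hxy : y = 0 → x = 0)
    (h : ENNReal.ofReal x / ENNReal.ofReal y ≤ ENNReal.ofReal c) : x ≤ c * y := by
  rcases hy.eq_or_lt with h0 | h0
  · rw [hxy h0.symm, ← h0, mul_zero]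
  · rw [ENNReal.div_le_iff (by simpa using h0) ENNReal.ofReal_ne_top, ← ENNReal.ofReal_mul hc,
      ENNReal.ofReal_le_ofReal_iff (by positivity)] at h
    exact h

theorem abs_sub_le_of_lipR_le {g : ℝ → ℝ} {c : ℝ} (hc0 : 0 ≤ c) (hc : lipR g ≤ ENNReal.ofReal c)
    (x y : ℝ) : |g x - g y| ≤ c * |x - y| := by
  refine le_mul_of_ofReal_div_le (abs_nonneg _) hc0 (fun h => ?_) (le_trans ?_ hc)
  · rw [sub_eq_zero.1 (abs_eq_zero.1 h), sub_self, abs_zero]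
  · exact le_iSup₂_of_le x y le_rfl

theorem norm1_nonneg {N : ℕ} (a : Fin N → ℝ) : 0 ≤ norm1 a :=
  Finset.sum_nonneg fun _ _ => abs_nonneg _

theorem norm1_eq_zero {N : ℕ} {a : Fin N → ℝ} (h : norm1 a = 0) : a = 0 := by
  ext j
  have := (Finset.sum_eq_zero_iff_of_nonneg fun j _ => abs_nonneg (a j)).1 h j (Finset.mem_univ _)
  simpa using this

theorem abs_sub_le_of_lipSource_le {N : ℕ} {G : (Fin N → ℝ) → (Fin N → ℝ) → ℝ} {c : ℝ}
    (hc0 : 0 ≤ c) (hc : lipSource G ≤ ENNReal.ofReal c) (a b a' b' : Fin N → ℝ) :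
    |G a b - G a' b'| ≤ c * (norm1 (a - a') + norm1 (b - b')) := by
  refine le_mul_of_ofReal_div_le (add_nonneg (norm1_nonneg _) (norm1_nonneg _)) hc0
    (fun h => ?_) (le_trans ?_ hc)
  · have h1 := norm1_nonneg (a - a')
    have h2 := norm1_nonneg (b - b')
    rw [sub_eq_zero.1 (norm1_eq_zero (a := a - a') (by linarith)),
      sub_eq_zero.1 (norm1_eq_zero (a := b - b') (by linarith)), sub_self, abs_zero]
  · exact le_iSup₂_of_le a b (le_iSup₂_of_le a' b' le_rfl)

theorem contDiff_partialD {N : ℕ} {g : (Fin N → ℝ) → ℝ} {m n : WithTop ℕ∞} (hg : ContDiff ℝ n g)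
    (hmn : m + 1 ≤ n) (j : Fin N) : ContDiff ℝ m (partialD j g) :=
  (hg.fderiv_right hmn).clm_apply contDiff_const

theorem fderiv_eq_sum_partialD {N : ℕ} (g : (Fin N → ℝ) → ℝ) (w v : Fin N → ℝ) :
    fderiv ℝ g w v = ∑ j, partialD j g w * v j := by
  conv_lhs => rw [pi_eq_sum_univ' v]
  rw [map_sum]
  refine Finset.sum_congr rfl fun j _ => ?_
  rw [map_smul, smul_eq_mul, mul_comm, partialD]

/-- The mean value inequality with respect to the `1`-norm. -/
theorem abs_sub_le_norm1_of_partialD_le {N : ℕ} {g : (Fin N → ℝ) → ℝ} (hg : ContDiff ℝ 1 g)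
    {c : ℝ} (hc : ∀ j w, |partialD j g w| ≤ c) (w w' : Fin N → ℝ) :
    |g w - g w'| ≤ c * norm1 (w - w') := by
  have hd : ∀ s : ℝ, HasDerivAt (fun s : ℝ => g (w' + s • (w - w')))
      (fderiv ℝ g (w' + s • (w - w')) (w - w')) s := by
    intro s
    have h1 : HasFDerivAt g (fderiv ℝ g (w' + s • (w - w'))) (w' + s • (w - w')) :=
      (hg.differentiable one_ne_zero _).hasFDerivAt
    have h2 : HasDerivAt (fun s : ℝ => w' + s • (w - w')) (w - w') s := by
      simpa using ((hasDerivAt_id s).smul_const (w - w')).const_add w'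
    exact h1.comp_hasDerivAt s h2
  have hb : ∀ s : ℝ, ‖fderiv ℝ g (w' + s • (w - w')) (w - w')‖ ≤ c * norm1 (w - w') := by
    intro s
    rw [fderiv_eq_sum_partialD, norm1, Finset.mul_sum]
    refine (norm_sum_le _ _).trans (Finset.sum_le_sum fun j _ => ?_)
    rw [norm_mul]
    exact mul_le_mul_of_nonneg_right (hc j _) (abs_nonneg _)
  have := Convex.norm_image_sub_le_of_norm_hasDerivWithin_le (s := univ) (x := (0 : ℝ)) (y := 1)
    (fun s _ => (hd s).hasDerivWithinAt) (fun s _ => hb s) convex_univ (mem_univ _) (mem_univ _)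
  simpa using this

/-- Pointwise consequences of the standing assumptions together with norm bounds. -/
structure SystemData.PointwiseBounds {N : ℕ} (D : SystemData N) (M : ℝ) : Prop where
  nonneg : 0 ≤ M
  f_lip : ∀ k x y, |D.f k x - D.f k y| ≤ M * |x - y|
  f_zero : ∀ k, D.f k 0 = 0
  ν_smooth : ∀ k, ContDiff ℝ 2 (D.ν k)
  ν_le : ∀ k w, |D.ν k w| ≤ M
  ν_grad_le : ∀ k j w, |partialD j (D.ν k) w| ≤ M
  ν_hess_le : ∀ k i j w, |partialD i (partialD j (D.ν k)) w| ≤ M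
  μ_smooth : ∀ j k, ContDiff ℝ 1 (D.μ j k)
  μΓ : ∀ j k, KernelBound M M (D.μ j k) (D.Γ j k)
  μ'Γ : ∀ j k, KernelBound M M (deriv (D.μ j k)) (D.Γ j k)
  ηθ : ∃ c, ∀ j k, KernelBound c M (D.η j k) (D.θ j k)
  η_int : ∀ j k, Integrable (D.η j k)
  η_le : ∀ j k, ∫⁻ x, ‖D.η j k x‖ₑ ≤ ENNReal.ofReal M
  R_cont : ∀ k, Continuous (Function.uncurry (D.R k))
  R_lip : ∀ k a b a' b', |D.R k a b - D.R k a' b'| ≤ M * (norm1 (a - a') + norm1 (b - b'))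
  R_zero : ∀ k, D.R k 0 0 = 0

theorem SystemData.Admissible.pointwiseBounds {N : ℕ} {D : SystemData N} (hD : D.Admissible)
    {M : ℝ≥0} (hM : D.BoundedBy M) : D.PointwiseBounds M := by
  have hμ' : ∀ j k, Continuous (deriv (D.μ j k)) := fun j k =>
    (hD.μ_smooth j k).continuous_deriv le_rfl
  have hΓ : ∀ j k, ∀ᵐ s ∂halfLine, |D.Γ j k s| ≤ (M : ℝ) := fun j k =>
    ae_abs_le_of_eLpNorm_top_le M.2 (by simpa using hM.Γ_le j k)
  have hpos : ∀ k j, ContDiff ℝ 1 (partialD j (D.ν k)) := fun k j =>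
    contDiff_partialD (hD.ν_smooth k) (by norm_num [one_add_one_eq_two]) j
  refine
    { nonneg := M.2
      f_lip := fun k => abs_sub_le_of_lipR_le M.2 (by simpa using hM.f_le k)
      f_zero := hD.f_zero
      ν_smooth := hD.ν_smooth
      ν_le := fun k => abs_le_of_supNorm_le (hD.ν_smooth k).continuous M.2 (by simpa using hM.ν_le k)
      ν_grad_le := fun k j => abs_le_of_supNorm_le (hpos k j).continuous M.2
        (by simpa using hM.ν_grad_le k j)
      ν_hess_le := fun k i j => abs_le_of_supNorm_le
        (contDiff_partialD (m := 0) (hpos k j) (by norm_num) i).continuous M.2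
        (by simpa using hM.ν_hess_le k i j)
      μ_smooth := hD.μ_smooth
      μΓ := fun j k => ⟨(hD.μ_smooth j k).continuous, abs_le_of_supNorm_le
        (hD.μ_smooth j k).continuous M.2 (by simpa using le_self_add.trans (hM.μ_le j k)),
        (hD.Γ_bdd j k).1, hΓ j k⟩
      μ'Γ := fun j k => ⟨hμ' j k, abs_le_of_supNorm_le (hμ' j k) M.2
        (by simpa using le_add_self.trans (hM.μ_le j k)), (hD.Γ_bdd j k).1, hΓ j k⟩
      ηθ := ?_
      η_int := hD.η_integrable
      η_le := fun j k => ?_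
      R_cont := fun k => ?_
      R_lip := fun k => abs_sub_le_of_lipSource_le M.2 (by simpa using hM.R_le k)
      R_zero := hD.R_zero }
  -- The constants may not depend on the sup norm of η. This bound c is qualitative: it gives
  -- continuity and measurability of the memory terms, and no estimate for the sources contains it.
  · have h1 : ∀ j k, ∀ x, |D.η j k x| ≤ (sobolevNorm (D.η j k)).toReal := fun j k =>
      abs_le_of_supNorm_le (hD.η_smooth j k).continuous ENNReal.toReal_nonneg (by
        rw [ENNReal.ofReal_toReal (hD.η_sobolev j k).ne]; exact le_self_add)
    refine ⟨∑ j, ∑ k, (sobolevNorm (D.η j k)).toReal, fun j k => ⟨(hD.η_smooth j k).continuous,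
      fun x => (h1 j k x).trans ?_, (hD.θ_bdd j k).1,
      ae_abs_le_of_eLpNorm_top_le M.2 (by simpa using hM.θ_le j k)⟩⟩
    refine le_trans (Finset.single_le_sum (f := fun k => (sobolevNorm (D.η j k)).toReal)
      (fun _ _ => ENNReal.toReal_nonneg) (Finset.mem_univ k)) ?_
    exact Finset.single_le_sum (f := fun j => ∑ k, (sobolevNorm (D.η j k)).toReal)
      (fun _ _ => Finset.sum_nonneg fun _ _ => ENNReal.toReal_nonneg) (Finset.mem_univ j)
  · rw [← eLpNorm_one_eq_lintegral_enorm, ENNReal.ofReal_coe_nnreal]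
    exact hM.η_le j k
  · obtain ⟨K, hK⟩ := hD.R_lip k
    exact hK.continuous

/-! ### Velocities and sources of entropy solutions -/

section

variable {N : ℕ} {D : SystemData N} {M T : ℝ} {U : Fin N → ℝ → ℝ → ℝ}

/-- The spatial derivative of the velocity. -/
def SystemData.velocityDeriv (D : SystemData N) (U : Fin N → ℝ → ℝ → ℝ) (k : Fin N)
    (t x : ℝ) : ℝ :=
  ∑ j, partialD j (D.ν k) (memConv D.μ D.Γ U k t x)
    * memConv (fun j k => deriv (D.μ j k)) D.Γ U k t x j

theorem continuous_memConv_clamp {κ γ : Fin N → Fin N → ℝ → ℝ} {c G : ℝ} {k : Fin N}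
    (h : ∀ j, KernelBound c G (κ j k) (γ j k)) (hT : 0 ≤ T) (hU : ∀ j, L1Curve T (U j)) :
    Continuous fun p : ℝ × ℝ => memConv κ γ U k (clamp T p.1) p.2 := by
  refine continuous_pi fun j => ?_
  simp only [memConv_eq]
  exact continuous_comp_clamp hT ((h j).continuousOn hT (hU j))

theorem hasDerivAt_velocity (hD : D.PointwiseBounds M) (hU : ∀ j, L1Curve T (U j)) (k : Fin N)
    {t : ℝ} (ht : t ∈ Icc 0 T) (x : ℝ) :
    HasDerivAt (fun y => D.velocity U k t y) (D.velocityDeriv U k t x) x := by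
  have h1 : HasDerivAt (fun y => memConv D.μ D.Γ U k t y)
      (memConv (fun j k => deriv (D.μ j k)) D.Γ U k t x) x := by
    rw [hasDerivAt_pi]
    intro j
    simp only [memConv_eq]
    exact (hD.μΓ j k).hasDerivAt (hD.μ_smooth j k) (hD.μ'Γ j k).κ_le (hU j) ht x
  have h2 : HasFDerivAt (D.ν k) (fderiv ℝ (D.ν k) (memConv D.μ D.Γ U k t x))
      (memConv D.μ D.Γ U k t x) := ((hD.ν_smooth k).differentiable (by simp) _).hasFDerivAt
  have h3 := h2.comp_hasDerivAt x h1
  rw [fderiv_eq_sum_partialD] at h3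
  exact h3

theorem continuous_velocity (hD : D.PointwiseBounds M) (hT : 0 ≤ T) (hU : ∀ j, L1Curve T (U j))
    (k : Fin N) : Continuous fun p : ℝ × ℝ => D.velocity U k (clamp T p.1) p.2 :=
  (hD.ν_smooth k).continuous.comp (continuous_memConv_clamp (fun j => hD.μΓ j k) hT hU)

theorem continuous_velocityDeriv (hD : D.PointwiseBounds M) (hT : 0 ≤ T)
    (hU : ∀ j, L1Curve T (U j)) (k : Fin N) :
    Continuous fun p : ℝ × ℝ => D.velocityDeriv U k (clamp T p.1) p.2 := by
  unfold SystemData.velocityDeriv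
  refine continuous_finsetSum _ fun j _ => Continuous.mul ?_ ?_
  · exact (contDiff_partialD (m := 1) (hD.ν_smooth k) (by norm_num [one_add_one_eq_two])
      j).continuous.comp (continuous_memConv_clamp (fun j => hD.μΓ j k) hT hU)
  · exact (continuous_apply j).comp (continuous_memConv_clamp
      (κ := fun j k => deriv (D.μ j k)) (fun j => hD.μ'Γ j k) hT hU)

theorem norm1_memConv_deriv_le (hD : D.PointwiseBounds M) (hU : ∀ j, L1Curve T (U j))
    (k : Fin N) {t : ℝ} (ht : t ∈ Icc 0 T) (x : ℝ) :
    norm1 (memConv (fun j k => deriv (D.μ j k)) D.Γ U k t x)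
      ≤ M * M * ∑ j, curveNorm T (U j) := by
  rw [norm1, Finset.mul_sum]
  refine Finset.sum_le_sum fun j _ => ?_
  rw [memConv_eq]
  exact (hD.μ'Γ j k).abs_le (hU j) ht x

theorem abs_velocityDeriv_le (hD : D.PointwiseBounds M) (hU : ∀ j, L1Curve T (U j)) (k : Fin N)
    {t : ℝ} (ht : t ∈ Icc 0 T) (x : ℝ) :
    |D.velocityDeriv U k t x| ≤ M * (M * M * ∑ j, curveNorm T (U j)) := by
  refine le_trans ?_ (mul_le_mul_of_nonneg_left (norm1_memConv_deriv_le hD hU k ht x) hD.nonneg)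
  rw [norm1, Finset.mul_sum]
  refine (Finset.abs_sum_le_sum_abs _ _).trans (Finset.sum_le_sum fun j _ => ?_)
  rw [abs_mul]
  exact mul_le_mul_of_nonneg_right (hD.ν_grad_le _ _ _) (abs_nonneg _)

/-- The source term on the plane, written with representatives of the components. -/
def SystemData.planeSource (D : SystemData N) (T : ℝ) (U : Fin N → ℝ → ℝ → ℝ)
    (u : Fin N → ℝ × ℝ → ℝ) (k : Fin N) : ℝ × ℝ → ℝ :=
  (QT T).indicator fun p => D.R k (fun j => u j p) (memConv D.η D.θ U k (clamp T p.1) p.2)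

theorem measurable_planeSource (hD : D.PointwiseBounds M) (hT : 0 ≤ T)
    (hU : ∀ j, L1Curve T (U j)) {u : Fin N → ℝ × ℝ → ℝ} (hu : ∀ j, Measurable (u j)) (k : Fin N) :
    Measurable (D.planeSource T U u k) := by
  obtain ⟨c, hc⟩ := hD.ηθ
  refine Measurable.indicator ?_ (measurableSet_QT T)
  exact (hD.R_cont k).measurable.comp ((measurable_pi_lambda _ hu).prodMk
    (continuous_memConv_clamp (fun j => hc j k) hT hU).measurable)

theorem lintegral_plane_strip {F : ℝ × ℝ → ℝ≥0∞} (hF : Measurable F) :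
    ∫⁻ p in QT T, F p = ∫⁻ t in Ioo 0 T, ∫⁻ x, F (t, x) := by
  rw [volume_restrict_QT, lintegral_prod _ hF.aemeasurable]

/-- Space-time integrals of sources reduce to those of densities and memory terms. -/
theorem lintegral_le_of_abs_le_sum {F : ℝ × ℝ → ℝ} {L : ℝ} {u m : Fin N → ℝ × ℝ → ℝ}
    (hL : 0 ≤ L) (hF : ∀ p ∈ QT T, |F p| ≤ L * ((∑ j, |u j p|) + ∑ j, |m j p|))
    (hF0 : ∀ p, p ∉ QT T → F p = 0) (hu : ∀ j, Measurable (u j)) (hm : ∀ j, Measurable (m j)) :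
    ∫⁻ p, ‖F p‖ₑ ≤ ENNReal.ofReal L * ((∑ j, ∫⁻ p, ‖u j p‖ₑ)
      + ∑ j, ∫⁻ t in Ioo 0 T, ∫⁻ x, ‖m j (t, x)‖ₑ) := by
  have h1 : ∫⁻ p, ‖F p‖ₑ = ∫⁻ p in QT T, ‖F p‖ₑ := by
    rw [← lintegral_indicator (measurableSet_QT T)]
    refine lintegral_congr fun p => ?_
    by_cases hp : p ∈ QT T
    · rw [indicator_of_mem hp]
    · rw [indicator_of_notMem hp, hF0 p hp, enorm_zero]
  rw [h1]
  calc ∫⁻ p in QT T, ‖F p‖ₑ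
      ≤ ∫⁻ p in QT T, ENNReal.ofReal L * ((∑ j, ‖u j p‖ₑ) + ∑ j, ‖m j p‖ₑ) := by
        refine setLIntegral_mono' (measurableSet_QT T) fun p hp => ?_
        rw [Real.enorm_eq_ofReal_abs]
        refine (ENNReal.ofReal_le_ofReal (hF p hp)).trans_eq ?_
        rw [ENNReal.ofReal_mul hL, ENNReal.ofReal_add (Finset.sum_nonneg fun _ _ => abs_nonneg _)
          (Finset.sum_nonneg fun _ _ => abs_nonneg _),
          ENNReal.ofReal_sum_of_nonneg fun _ _ => abs_nonneg _,
          ENNReal.ofReal_sum_of_nonneg fun _ _ => abs_nonneg _]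
        simp only [Real.enorm_eq_ofReal_abs]
    _ = ENNReal.ofReal L * ((∑ j, ∫⁻ p in QT T, ‖u j p‖ₑ) + ∑ j, ∫⁻ p in QT T, ‖m j p‖ₑ) := by
        have mu : Measurable fun p => ∑ j, ‖u j p‖ₑ :=
          Finset.measurable_sum _ fun j _ => (hu j).enorm
        have mm : Measurable fun p => ∑ j, ‖m j p‖ₑ :=
          Finset.measurable_sum _ fun j _ => (hm j).enorm
        rw [lintegral_const_mul (ENNReal.ofReal L)
          (f := fun p => (∑ j, ‖u j p‖ₑ) + ∑ j, ‖m j p‖ₑ) (mu.add mm), lintegral_add_left mu,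
          lintegral_finsetSum _ fun j _ => (hu j).enorm,
          lintegral_finsetSum _ fun j _ => (hm j).enorm]
    _ ≤ _ := by
        refine mul_le_mul_right (add_le_add (Finset.sum_le_sum fun j _ =>
          setLIntegral_le_lintegral _ _) (Finset.sum_le_sum fun j _ => ?_)) _
        rw [lintegral_plane_strip (F := fun p => ‖m j p‖ₑ) (hm j).enorm]

theorem integrable_planeSource (hD : D.PointwiseBounds M) (hT : 0 ≤ T)
    (hU : ∀ j, L1Curve T (U j)) {u : Fin N → ℝ × ℝ → ℝ} (hu : ∀ j, PlaneRep T (U j) (u j))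
    (k : Fin N) : Integrable (D.planeSource T U u k) := by
  refine ⟨(measurable_planeSource hD hT hU (fun j => (hu j).meas) k).aestronglyMeasurable, ?_⟩
  obtain ⟨c, hc⟩ := hD.ηθ
  have hcont := continuous_memConv_clamp (fun j => hc j k) hT hU
  rw [hasFiniteIntegral_iff_enorm]
  refine (lintegral_le_of_abs_le_sum (T := T) (L := M) (u := u)
    (m := fun j p => memConv D.η D.θ U k (clamp T p.1) p.2 j) hD.nonneg (fun p hp => ?_)
    (fun p hp => indicator_of_notMem hp _) (fun j => (hu j).meas)
    fun j => ((continuous_apply j).comp hcont).measurable).trans_lt ?_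
  · rw [indicator_of_mem hp]
    have := hD.R_lip k (fun j => u j p) (memConv D.η D.θ U k (clamp T p.1) p.2) 0 0
    rw [hD.R_zero, sub_zero, sub_zero, sub_zero] at this
    exact this
  · refine ENNReal.mul_lt_top ENNReal.ofReal_lt_top (ENNReal.add_lt_top.2
      ⟨ENNReal.sum_lt_top.2 fun j _ => ?_, ENNReal.sum_lt_top.2 fun j _ => ?_⟩)
    · exact ((hu j).integrable (hU j) hT).2
    · have e : ∫⁻ t in Ioo 0 T, ∫⁻ x, ‖memConv D.η D.θ U k (clamp T t) x j‖ₑ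
          = ∫⁻ t in Ioo 0 T, ∫⁻ x, ‖tConv (D.θ j k) (spConv (D.η j k) (U j)) t x‖ₑ := by
        refine setLIntegral_congr_fun measurableSet_Ioo fun t ht => ?_
        simp only [clamp_of_mem (Ioo_subset_Icc_self ht), memConv_eq]
      simp only
      rw [e]
      refine ((hc j k).lintegral_le (hD.η_int j k) hT (hU j)).trans_lt ?_
      exact ENNReal.mul_lt_top (ENNReal.mul_lt_top ENNReal.ofReal_lt_top (hD.η_int j k).2)
        ENNReal.ofReal_lt_top

end

section

variable {N : ℕ} {D : SystemData N} {M T : ℝ} {U₀ : Fin N → ℝ → ℝ} {U : Fin N → ℝ → ℝ → ℝ}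
  {u : Fin N → ℝ × ℝ → ℝ}

/-- The entropy form in terms of representatives on the plane. -/
theorem IsEntropySolution.entropyForm_eq (hU : IsEntropySolution D T U₀ U) (hT : 0 ≤ T)
    (hD : D.PointwiseBounds M) (hu : ∀ k, PlaneRep T (U k) (u k))
    (hur : ∀ k p, u k p ∈ Icc (0 : ℝ) 1) (k : Fin N) (α : ℝ) {φ : ℝ × ℝ → ℝ}
    (hφ : ContDiff ℝ ∞ φ) (hφc : HasCompactSupport φ) :
    D.entropyForm T U₀ U k α φ = (∫ p in QT T, (|u k p - α| * timeDeriv φ p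
      + Real.sign (u k p - α) * (D.velocity U k (clamp T p.1) p.2 * (D.f k (u k p) - D.f k α))
        * spaceDeriv φ p
      + Real.sign (u k p - α) * (D.planeSource T U u k p
        - D.f k α * D.velocityDeriv U k (clamp T p.1) p.2) * φ p))
      + ∫ x, |U₀ k x - α| * φ (0, x) := by
  have hw : ∀ j, L1Curve T (U j) := hU.l1Curve
  have mu := (hu k).meas
  have mf : Measurable (D.f k) := (continuous_of_lip (hD.f_lip k)).measurable
  have ma := (continuous_velocity hD hT hw k).measurable
  have ca' := continuous_velocityDeriv hD hT hw k
  have mS : Measurable fun p => Real.sign (u k p - α) := measurable_realSign.comp (by fun_prop)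
  have hub : ∀ p, |u k p - α| ≤ 1 + |α| := fun p => by
    refine (abs_sub _ _).trans (add_le_add_left ?_ _)
    rw [abs_of_nonneg (hur k p).1]; exact (hur k p).2
  have i1 : Integrable fun p => |u k p - α| * timeDeriv φ p :=
    (integrable_timeDeriv hφ hφc).bdd_mul (c := 1 + |α|) (by fun_prop)
      (ae_of_all _ fun p => by simpa using hub p)
  have i2 : Integrable fun p : ℝ × ℝ => Real.sign (u k p - α)
      * (D.velocity U k (clamp T p.1) p.2 * (D.f k (u k p) - D.f k α)) * spaceDeriv φ p := by
    refine (integrable_spaceDeriv hφ hφc).bdd_mul (c := M * (M * (1 + |α|)))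
      (mS.mul (ma.mul (by fun_prop))).aestronglyMeasurable (ae_of_all _ fun p => ?_)
    rw [Real.norm_eq_abs, abs_mul, abs_mul]
    refine (mul_le_of_le_one_left (by positivity) (abs_realSign_le _)).trans ?_
    exact mul_le_mul (hD.ν_le _ _) ((hD.f_lip k _ _).trans
      (mul_le_mul_of_nonneg_left (hub p) hD.nonneg)) (abs_nonneg _) hD.nonneg
  have hφi : Integrable φ := hφ.continuous.integrable_of_hasCompactSupport hφc
  obtain ⟨Cφ, hCφ⟩ := hφc.exists_bound_of_continuous hφ.continuous
  have i3 : Integrable fun p => Real.sign (u k p - α) * D.planeSource T U u k p * φ p := by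
    have h1 := (integrable_planeSource hD hT hw hu k).bdd_mul (c := Cφ)
      (f := fun p => Real.sign (u k p - α) * φ p)
      (mS.mul hφ.continuous.measurable).aestronglyMeasurable (ae_of_all _ fun p => by
        rw [norm_mul]
        exact (mul_le_of_le_one_left (norm_nonneg _) (abs_realSign_le _)).trans (hCφ p))
    exact h1.congr (ae_of_all _ fun p => by simp only; ring)
  have i4 : Integrable fun p : ℝ × ℝ => D.f k α * Real.sign (u k p - α)
      * D.velocityDeriv U k (clamp T p.1) p.2 * φ p := by
    have h1 : Integrable fun p : ℝ × ℝ => D.velocityDeriv U k (clamp T p.1) p.2 * φ p :=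
      (ca'.mul hφ.continuous).integrable_of_hasCompactSupport hφc.mul_left
    have h2 := h1.bdd_mul (c := |D.f k α| * 1) (f := fun p => D.f k α * Real.sign (u k p - α))
      (mS.const_mul _).aestronglyMeasurable (ae_of_all _ fun p => by
        rw [Real.norm_eq_abs, abs_mul]
        exact mul_le_mul_of_nonneg_left (abs_realSign_le _) (abs_nonneg _))
    exact h2.congr (ae_of_all _ fun p => by simp only; ring)
  -- On the strip the representatives agree almost everywhere with the components and clamping has
  -- no effect, so the four integrals can be rewritten one by one.
  have hae : ∀ᵐ p ∂(volume.restrict (QT T)), (∀ j, u j p = U j p.1 p.2) ∧ p ∈ QT T :=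
    (ae_all_iff.2 fun j => (hu j).ae_eq (hU.measurable j)).and (ae_restrict_mem (measurableSet_QT T))
  have e1 : ∫ p in QT T, |U k p.1 p.2 - α| * deriv (fun s => φ (s, p.2)) p.1
      = ∫ p in QT T, |u k p - α| * timeDeriv φ p := by
    refine integral_congr_ae ?_
    filter_upwards [hae] with p hp
    rw [hp.1 k]; rfl
  have e2 : ∫ p in QT T, Real.sign (U k p.1 p.2 - α) * D.velocity U k p.1 p.2
      * (D.f k (U k p.1 p.2) - D.f k α) * deriv (fun y => φ (p.1, y)) p.2
      = ∫ p in QT T, Real.sign (u k p - α)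
        * (D.velocity U k (clamp T p.1) p.2 * (D.f k (u k p) - D.f k α)) * spaceDeriv φ p := by
    refine integral_congr_ae ?_
    filter_upwards [hae] with p hp
    rw [hp.1 k, clamp_of_mem (Ioo_subset_Icc_self hp.2.1), spaceDeriv]
    ring
  have e3 : ∫ p in QT T, Real.sign (U k p.1 p.2 - α) * D.source U k p.1 p.2 * φ p
      = ∫ p in QT T, Real.sign (u k p - α) * D.planeSource T U u k p * φ p := by
    refine integral_congr_ae ?_
    filter_upwards [hae] with p hp
    rw [SystemData.planeSource, indicator_of_mem hp.2, clamp_of_mem (Ioo_subset_Icc_self hp.2.1),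
      SystemData.source]
    simp only [hp.1]
  have e4 : ∫ p in QT T, D.f k α * Real.sign (U k p.1 p.2 - α)
      * deriv (fun y => D.velocity U k p.1 y) p.2 * φ p
      = ∫ p in QT T, D.f k α * Real.sign (u k p - α)
        * D.velocityDeriv U k (clamp T p.1) p.2 * φ p := by
    refine integral_congr_ae ?_
    filter_upwards [hae] with p hp
    rw [hp.1 k, clamp_of_mem (Ioo_subset_Icc_self hp.2.1),
      (hasDerivAt_velocity hD hw k (Ioo_subset_Icc_self hp.2.1) p.2).deriv]
  rw [SystemData.entropyForm, e1, e2, e3, e4]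
  have j1 := i1.integrableOn (s := QT T)
  have j2 := i2.integrableOn (s := QT T)
  have j3 := i3.integrableOn (s := QT T)
  have j4 := i4.integrableOn (s := QT T)
  have h1 := integral_add (j1.integrable.add j2.integrable) (j3.integrable.sub j4.integrable)
  have h2 := integral_add j1.integrable j2.integrable
  have h3 := integral_sub j3.integrable j4.integrable
  simp only [Pi.add_apply, Pi.sub_apply] at h1 h2 h3
  have h4 : ∫ p in QT T, (|u k p - α| * timeDeriv φ p
      + Real.sign (u k p - α) * (D.velocity U k (clamp T p.1) p.2 * (D.f k (u k p) - D.f k α))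
        * spaceDeriv φ p
      + Real.sign (u k p - α) * (D.planeSource T U u k p
        - D.f k α * D.velocityDeriv U k (clamp T p.1) p.2) * φ p)
      = ∫ p in QT T, (|u k p - α| * timeDeriv φ p
      + Real.sign (u k p - α) * (D.velocity U k (clamp T p.1) p.2 * (D.f k (u k p) - D.f k α))
        * spaceDeriv φ p
      + (Real.sign (u k p - α) * D.planeSource T U u k p * φ p
        - D.f k α * Real.sign (u k p - α) * D.velocityDeriv U k (clamp T p.1) p.2 * φ p)) := by
    congr 1; ext p; ring
  rw [h4]
  linarith

/-- Each component of an entropy solution solves a scalar balance law. -/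
theorem IsEntropySolution.scalarSolution (hU : IsEntropySolution D T U₀ U) (hT : 0 ≤ T)
    (hD : D.PointwiseBounds M) (hS : ∑ j, curveNorm T (U j) ≤ M)
    (hu : ∀ k, PlaneRep T (U k) (u k)) (hur : ∀ k p, u k p ∈ Icc (0 : ℝ) 1) (k : Fin N) :
    ScalarSolution T M M (M * (M * M * M)) (D.f k)
      (fun p => D.velocity U k (clamp T p.1) p.2) (fun p => D.velocityDeriv U k (clamp T p.1) p.2)
      (D.planeSource T U u k) (u k) where
  u_meas := (hu k).meas
  u_int := (hu k).integrable (hU.l1Curve k) hT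
  u_range := hur k
  r_meas := measurable_planeSource hD hT hU.l1Curve (fun j => (hu j).meas) k
  r_int := integrable_planeSource hD hT hU.l1Curve hu k
  a_cont := continuous_velocity hD hT hU.l1Curve k
  a'_cont := continuous_velocityDeriv hD hT hU.l1Curve k
  a_le p := hD.ν_le _ _
  a'_le p := (abs_velocityDeriv_le hD hU.l1Curve k (clamp_mem hT _) _).trans
    (mul_le_mul_of_nonneg_left (mul_le_mul_of_nonneg_left hS (mul_nonneg hD.nonneg hD.nonneg))
      hD.nonneg)
  f_lip := hD.f_lip k
  f_zero := hD.f_zero k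
  ineq := by
    intro α φ hφ hφc hφs hφ0
    have h := hU.entropy k α φ ⟨hφ, hφc, hφs.trans (prod_mono (fun t ht => ht.2) subset_rfl),
      fun t _ x => hφ0 _⟩
    rw [hU.entropyForm_eq hT hD hu hur k α hφ hφc] at h
    have h0 : ∀ x, φ (0, x) = 0 := fun x =>
      image_eq_zero_of_notMem_tsupport fun hx => lt_irrefl _ (hφs hx).1.1
    simp only [h0, mul_zero, integral_zero, add_zero] at h
    rwa [setIntegral_eq_integral_of_forall_compl_eq_zero] at h
    intro p hp
    have hp' : p ∉ tsupport φ := fun h => hp (hφs h)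
    rw [timeDeriv_eq_zero hφ hp', spaceDeriv_eq_zero hφ hp', image_eq_zero_of_notMem_tsupport hp']
    simp

/-! ### Attainment of the initial data. -/

/-- A locally integrable function with nonnegative pairings is nonnegative. -/
theorem ae_nonneg_of_forall_pairing {d : ℝ → ℝ} (hd : LocallyIntegrable d)
    (h : ∀ ϖ : ℝ → ℝ, ContDiff ℝ ∞ ϖ → HasCompactSupport ϖ → (∀ x, 0 ≤ ϖ x) →
      0 ≤ ∫ x, ϖ x * d x) : ∀ᵐ x, 0 ≤ d x := by
  let φ : ℕ → ContDiffBump (0 : ℝ) := fun n =>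
    ⟨1 / ((n : ℝ) + 1) / 2, 1 / ((n : ℝ) + 1), by positivity, half_lt_self (by positivity)⟩
  have hφ : Tendsto (fun n => (φ n).rOut) atTop (𝓝 0) := tendsto_one_div_add_atTop_nhds_zero_nat
  have hK : ∀ᶠ n in atTop, (φ n).rOut ≤ 2 * (φ n).rIn :=
    Eventually.of_forall fun n => by simp only [φ]; linarith
  -- Mollifications of d converge to d almost everywhere, and each is a pairing of d with a
  -- nonnegative bump.
  filter_upwards [ContDiffBump.ae_convolution_tendsto_right_of_locallyIntegrable hφ hK hd]
    with x hx
  refine ge_of_tendsto' hx fun n => ?_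
  rw [convolution_def, ← integral_sub_left_eq_self _ volume x]
  simp only [ContinuousLinearMap.lsmul_apply, smul_eq_mul, sub_sub_cancel]
  refine h (fun t => (φ n).normed volume (x - t)) ?_ ?_ fun t => (φ n).nonneg_normed _
  · have : ContDiff ℝ ∞ ((φ n).normed volume) := (φ n).contDiff_normed
    fun_prop
  · exact (φ n).hasCompactSupport_normed.comp_homeomorph (Homeomorph.subLeft x)

/-- The entropy inequality at the initial time. -/
theorem IsEntropySolution.integral_initial_le (hU : IsEntropySolution D T U₀ U) (hT : 0 < T)
    (hD : D.PointwiseBounds M) (k : Fin N) (α : ℝ) {ϖ : ℝ → ℝ} (hϖ : ContDiff ℝ ∞ ϖ)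
    (hϖc : HasCompactSupport ϖ) (hϖ0 : ∀ x, 0 ≤ ϖ x) :
    ∫ x, |U k 0 x - α| * ϖ x ≤ ∫ x, |U₀ k x - α| * ϖ x := by
  choose u hu hur using hU.exists_planeRep
  have hw : ∀ j, L1Curve T (U j) := hU.l1Curve
  have mu := (hu k).meas
  have mf : Measurable (D.f k) := (continuous_of_lip (hD.f_lip k)).measurable
  have ma := (continuous_velocity hD hT.le hw k).measurable
  have ma' := (continuous_velocityDeriv hD hT.le hw k).measurable
  have mS : Measurable fun p => Real.sign (u k p - α) := measurable_realSign.comp (by fun_prop)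
  have hϖ' : Continuous (deriv ϖ) := hϖ.continuous_deriv (by simp)
  have hϖi : Integrable ϖ := hϖ.continuous.integrable_of_hasCompactSupport hϖc
  have hϖi' : Integrable (deriv ϖ) := hϖ'.integrable_of_hasCompactSupport hϖc.deriv
  obtain ⟨Cϖ, hCϖ⟩ := hϖc.exists_bound_of_continuous hϖ.continuous
  have hub : ∀ p, |u k p - α| ≤ 1 + |α| := fun p => by
    refine (abs_sub _ _).trans (add_le_add_left ?_ _)
    rw [abs_of_nonneg (hur k p).1]; exact (hur k p).2
  have hϖ2 : Integrable (fun p : ℝ × ℝ => ϖ p.2) (volume.restrict (QT T)) := by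
    rw [volume_restrict_QT]; exact hϖi.comp_snd _
  have hϖ2' : Integrable (fun p : ℝ × ℝ => deriv ϖ p.2) (volume.restrict (QT T)) := by
    rw [volume_restrict_QT]; exact hϖi'.comp_snd _
  -- Flux and source terms carry the time cutoff itself and not its derivative. Being integrable
  -- over the strip, they vanish as the cutoff shrinks to time zero.
  set q : ℝ × ℝ → ℝ := fun p =>
    Real.sign (u k p - α) * (D.velocity U k (clamp T p.1) p.2 * (D.f k (u k p) - D.f k α))
        * deriv ϖ p.2
      + Real.sign (u k p - α) * (D.planeSource T U u k p
        - D.f k α * D.velocityDeriv U k (clamp T p.1) p.2) * ϖ p.2 with hq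
  have hqi : Integrable q (volume.restrict (QT T)) := by
    have i2 : Integrable (fun p : ℝ × ℝ => Real.sign (u k p - α)
        * (D.velocity U k (clamp T p.1) p.2 * (D.f k (u k p) - D.f k α)) * deriv ϖ p.2)
        (volume.restrict (QT T)) := by
      refine hϖ2'.bdd_mul (c := M * (M * (1 + |α|)))
        (mS.mul (ma.mul (by fun_prop))).aestronglyMeasurable (ae_of_all _ fun p => ?_)
      rw [Real.norm_eq_abs, abs_mul, abs_mul]
      refine (mul_le_of_le_one_left (by positivity) (abs_realSign_le _)).trans ?_
      exact mul_le_mul (hD.ν_le _ _) ((hD.f_lip k _ _).trans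
        (mul_le_mul_of_nonneg_left (hub p) hD.nonneg)) (abs_nonneg _) hD.nonneg
    have i3 : Integrable (fun p => (Real.sign (u k p - α) * ϖ p.2) * D.planeSource T U u k p)
        (volume.restrict (QT T)) := by
      refine (integrable_planeSource hD hT.le hw hu k).integrableOn.integrable.bdd_mul (c := Cϖ)
        (mS.mul (hϖ.continuous.measurable.comp measurable_snd)).aestronglyMeasurable
        (ae_of_all _ fun p => ?_)
      rw [norm_mul]
      exact (mul_le_of_le_one_left (norm_nonneg _) (abs_realSign_le _)).trans (hCϖ _)
    have i4 : Integrable (fun p : ℝ × ℝ => (Real.sign (u k p - α) * (D.f k α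
        * D.velocityDeriv U k (clamp T p.1) p.2)) * ϖ p.2) (volume.restrict (QT T)) := by
      refine hϖ2.bdd_mul (c := |D.f k α| * (M * (M * M * ∑ j, curveNorm T (U j))))
        (mS.mul (ma'.const_mul _)).aestronglyMeasurable (ae_of_all _ fun p => ?_)
      rw [Real.norm_eq_abs, abs_mul, abs_mul]
      refine (mul_le_of_le_one_left (by positivity) (abs_realSign_le _)).trans ?_
      exact mul_le_mul_of_nonneg_left (abs_velocityDeriv_le hD hw k (clamp_mem hT.le _) _)
        (abs_nonneg _)
    refine (i2.add (i3.sub i4)).congr (ae_of_all _ fun p => ?_)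
    simp only [Pi.add_apply, Pi.sub_apply, hq]
    ring
  set V : ℝ → ℝ := fun t => ∫ x, |U k t x - α| * ϖ x with hV
  have hVi : ∀ t ∈ Icc 0 T, Integrable fun x => |U k t x - α| * ϖ x := fun t ht => by
    have h1 : Integrable fun x => |U k t x| * ϖ x :=
      ((hw k).integrable t ht).abs.mul_bdd (c := Cϖ) hϖ.continuous.aestronglyMeasurable
        (ae_of_all _ hCϖ)
    have m1 := ((hw k).integrable t ht).1
    refine (h1.add (hϖi.const_mul |α|)).mono' ?_ (ae_of_all _ fun x => ?_)
    · exact ((m1.sub aestronglyMeasurable_const).norm).mul hϖ.continuous.aestronglyMeasurable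
    · rw [norm_mul, Real.norm_eq_abs, abs_abs, Real.norm_of_nonneg (hϖ0 x), Pi.add_apply, ← add_mul]
      exact mul_le_mul_of_nonneg_right (abs_sub _ _) (hϖ0 x)
  have hVc : ContinuousOn V (Icc 0 T) := by
    intro s hs
    rw [ContinuousWithinAt, tendsto_iff_dist_tendsto_zero]
    have h := ((hw k).continuous s hs).const_mul Cϖ
    rw [mul_zero] at h
    refine tendsto_of_tendsto_of_tendsto_of_le_of_le' tendsto_const_nhds h
      (Eventually.of_forall fun t => dist_nonneg) ?_
    filter_upwards [self_mem_nhdsWithin] with t ht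
    rw [Real.dist_eq, hV, ← integral_sub (hVi t ht) (hVi s hs), ← integral_const_mul]
    refine (abs_integral_le_integral_abs).trans (integral_mono
      ((hVi t ht).sub (hVi s hs)).abs
      ((((hw k).integrable t ht).sub ((hw k).integrable s hs)).abs.const_mul Cϖ) fun x => ?_)
    simp only
    rw [← sub_mul, abs_mul, mul_comm]
    refine mul_le_mul (hCϖ x) ?_ (abs_nonneg _) ((norm_nonneg _).trans (hCϖ x))
    refine (abs_abs_sub_abs_le_abs_sub _ _).trans_eq ?_
    rw [sub_sub_sub_cancel_right]
  have hVcl : Continuous fun t => V (clamp T t) :=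
    hVc.comp_continuous (continuous_clamp T) fun t => clamp_mem hT.le t
  have hVrep : ∀ᵐ t, t ∈ Ioo 0 T → ∫ x, |u k (t, x) - α| * ϖ x = V t := by
    filter_upwards [(hu k).slice] with t h1 ht
    refine integral_congr_ae ?_
    filter_upwards [h1 ht] with x hx
    rw [hx]
  set τ : ℕ → ℝ := fun n => T / ((n : ℝ) + 2) with hτ
  have hτ0 : ∀ n, 0 < τ n := fun n => by positivity
  have hτT : ∀ n, τ n ≤ T / 2 := fun n => by
    refine div_le_div_of_nonneg_left hT.le two_pos ?_
    linarith [Nat.cast_nonneg (α := ℝ) n]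
  have hτl : Tendsto τ atTop (𝓝 0) := tendsto_const_nhds.div_atTop
    (tendsto_atTop_add_const_right _ _ tendsto_natCast_atTop_atTop)
  let φ : ℕ → ContDiffBump (0 : ℝ) := fun n =>
    ⟨τ n / 2 / 2, τ n / 2, by have := hτ0 n; positivity, half_lt_self (half_pos (hτ0 n))⟩
  have hφr : ∀ n, (φ n).rOut = τ n / 2 := fun n => rfl
  have hφl : Tendsto (fun n => (φ n).rOut) atTop (𝓝 0) := by
    have := hτl.div_const 2
    simpa [hφr] using this
  -- Placing the rising edge at -T keeps it outside (0, T) and makes the cutoff equal to 1 at time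
  -- 0; only the falling edge at τ n is seen by the solution.
  have hcut := fun n => exists_time_cutoff (φ n) (t₁ := -T) (t₂ := τ n) (by linarith [hτ0 n])
  choose χ c1 c2 c3 c4 c5 c6 using hcut
  have hη0 : ∀ n x, τ n / 2 ≤ |x| → (φ n).normed volume x = 0 := by
    intro n x hx
    have : x ∉ Function.support ((φ n).normed volume) := by
      rw [(φ n).support_normed_eq, mem_ball_zero_iff]
      exact not_lt.2 hx
    simpa using this
  have hχ0 : ∀ n, χ n 0 = 1 := fun n => c5 n 0
    ⟨by rw [hφr]; linarith [hτT n, hτ0 n], by rw [hφr]; linarith [hτ0 n]⟩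
  have hχz : ∀ n t, 3 / 2 * τ n < t → χ n t = 0 := fun n t ht =>
    image_eq_zero_of_notMem_tsupport fun h => by
      have := (c2 n h).2
      rw [hφr] at this
      linarith
  have key : ∀ n, 0 ≤ -(∫ t, (φ n).normed volume (t - τ n) * V (clamp T t))
      + (∫ p in QT T, χ n p.1 * q p) + ∫ x, |U₀ k x - α| * ϖ x := by
    intro n
    have hχc : HasCompactSupport (χ n) :=
      isCompact_Icc.of_isClosed_subset (isClosed_tsupport _) (c2 n)
    set Φ : ℝ × ℝ → ℝ := fun p => χ n p.1 * ϖ p.2 with hΦ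
    have hcl : tsupport Φ ⊆ tsupport (χ n) ×ˢ tsupport ϖ :=
      closure_minimal (fun p hp => ⟨subset_tsupport _ (left_ne_zero_of_mul hp),
        subset_tsupport _ (right_ne_zero_of_mul hp)⟩)
        ((isClosed_tsupport _).prod (isClosed_tsupport _))
    have hΦs : ContDiff ℝ ∞ Φ := by have := c1 n; fun_prop
    have hΦc : HasCompactSupport Φ := (hχc.prod hϖc).of_isClosed_subset (isClosed_tsupport _) hcl
    have htest : IsTestFunction T Φ := ⟨hΦs, hΦc, fun p hp => ⟨by
        have := (c2 n (hcl hp).1).2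
        rw [hφr] at this
        exact mem_Iio.2 (by linarith [hτT n, hτ0 n]), mem_univ _⟩,
      fun t _ x => mul_nonneg (c3 n t) (hϖ0 x)⟩
    have h := hU.entropy k α Φ htest
    rw [hU.entropyForm_eq hT.le hD hu hur k α hΦs hΦc] at h
    have e0 : ∀ x, Φ (0, x) = ϖ x := fun x => by simp [hΦ, hχ0]
    simp only [e0] at h
    have ht : ∀ p, timeDeriv Φ p = deriv (χ n) p.1 * ϖ p.2 := fun p =>
      deriv_mul_const_field (u := χ n) (x := p.1) (ϖ p.2)
    have hx : ∀ p, spaceDeriv Φ p = χ n p.1 * deriv ϖ p.2 := fun p =>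
      deriv_const_mul_field (v := ϖ) (x := p.2) (χ n p.1)
    have hχ'c : Continuous (deriv (χ n)) := (c1 n).continuous_deriv (by simp)
    obtain ⟨C1, hC1⟩ := hχc.deriv.exists_bound_of_continuous hχ'c
    have j1 : Integrable (fun p : ℝ × ℝ => deriv (χ n) p.1 * (|u k p - α| * ϖ p.2))
        (volume.restrict (QT T)) := by
      refine (hϖ2.bdd_mul (c := 1 + |α|) (f := fun p => |u k p - α|)
        (by fun_prop) (ae_of_all _ fun p => by simpa using hub p)).bdd_mul (c := C1)
        (hχ'c.comp continuous_fst).aestronglyMeasurable (ae_of_all _ fun p => hC1 _)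
    have j2 : Integrable (fun p : ℝ × ℝ => χ n p.1 * q p) (volume.restrict (QT T)) :=
      hqi.bdd_mul (c := 1) ((c1 n).continuous.comp continuous_fst).aestronglyMeasurable
        (ae_of_all _ fun p => by
          rw [Real.norm_of_nonneg (c3 n _)]; exact c4 n _)
    have e1 : ∫ p in QT T, (|u k p - α| * timeDeriv Φ p
      + Real.sign (u k p - α) * (D.velocity U k (clamp T p.1) p.2 * (D.f k (u k p) - D.f k α))
        * spaceDeriv Φ p
      + Real.sign (u k p - α) * (D.planeSource T U u k p
        - D.f k α * D.velocityDeriv U k (clamp T p.1) p.2) * Φ p)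
        = (∫ p in QT T, deriv (χ n) p.1 * (|u k p - α| * ϖ p.2)) + ∫ p in QT T, χ n p.1 * q p := by
      rw [← integral_add j1 j2]
      refine integral_congr_ae (ae_of_all _ fun p => ?_)
      simp only [ht, hx]
      simp only [hq, hΦ]
      ring
    have e2 : ∫ p in QT T, deriv (χ n) p.1 * (|u k p - α| * ϖ p.2)
        = -∫ t, (φ n).normed volume (t - τ n) * V (clamp T t) := by
      rw [volume_restrict_QT] at j1 ⊢
      rw [integral_prod _ j1, ← integral_neg]
      rw [← setIntegral_eq_integral_of_forall_compl_eq_zero (s := Ioo 0 T)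
        (f := fun t => -((φ n).normed volume (t - τ n) * V (clamp T t)))]
      · refine setIntegral_congr_ae measurableSet_Ioo ?_
        filter_upwards [hVrep] with t h1 ht
        rw [integral_const_mul, h1 ht, c6, clamp_of_mem (Ioo_subset_Icc_self ht),
          hη0 n (t - -T) (by
            rw [abs_of_pos (by linarith [ht.1])]; linarith [ht.1, hτT n, hτ0 n])]
        ring
      · intro t ht
        rw [hη0 n (t - τ n), zero_mul, neg_zero]
        rw [le_abs]
        by_contra! hcon
        exact ht ⟨by linarith [hcon.2, hτ0 n], by linarith [hcon.1, hτT n, hτ0 n]⟩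
    rw [e1, e2] at h
    exact h
  have hlim1 := tendsto_integral_normed_sub_mul hVcl hτl hφl
  have hlim2 : Tendsto (fun n => ∫ p in QT T, χ n p.1 * q p) atTop (𝓝 0) := by
    have : Tendsto (fun n => ∫ p in QT T, χ n p.1 * q p) atTop
        (𝓝 (∫ p in QT T, (fun _ => (0 : ℝ)) p)) := by
      refine tendsto_integral_of_dominated_convergence (fun p => ‖q p‖)
        (fun n => ((c1 n).continuous.comp continuous_fst).aestronglyMeasurable.mul hqi.1)
        hqi.norm (fun n => ae_of_all _ fun p => ?_) ?_
      · rw [norm_mul, Real.norm_of_nonneg (c3 n _)]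
        exact mul_le_of_le_one_left (norm_nonneg _) (c4 n _)
      · filter_upwards [ae_restrict_mem (measurableSet_QT T)] with p hp
        refine tendsto_const_nhds.congr' ?_
        have h1 := (hτl.const_mul (3 / 2)).eventually_lt_const (u := p.1) (by
          rw [mul_zero]; exact hp.1.1)
        filter_upwards [h1] with n hn
        rw [hχz n p.1 hn, zero_mul]
    simpa using this
  have hlim := (hlim1.neg.add hlim2).add_const (∫ x, |U₀ k x - α| * ϖ x)
  have h0 := ge_of_tendsto' hlim key
  rw [clamp_of_mem ⟨le_rfl, hT.le⟩] at h0
  linarith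

/-- Entropy solutions attain their initial data. -/
theorem IsEntropySolution.initial_trace (hU : IsEntropySolution D T U₀ U) (hT : 0 < T)
    (hD : D.PointwiseBounds M) (hU₀ : ∀ k, Integrable (U₀ k)) (k : Fin N) :
    U k 0 =ᵐ[volume] U₀ k := by
  have hi := hU.integrable k 0 ⟨le_rfl, hT.le⟩
  -- Countably many α share one null set. Off it the inequality extends to all real α by continuity,
  -- and α = U₀(x) forces equality.
  have h : ∀ α : ℚ, ∀ᵐ x, |U k 0 x - α| ≤ |U₀ k x - α| := by
    intro α
    have m1 : AEStronglyMeasurable (fun x => |U₀ k x - α|) :=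
      ((hU₀ k).1.sub aestronglyMeasurable_const).norm
    have m2 : AEStronglyMeasurable (fun x => |U k 0 x - α|) :=
      (hi.1.sub aestronglyMeasurable_const).norm
    have hdi : Integrable fun x => |U₀ k x - α| - |U k 0 x - α| := by
      refine ((hU₀ k).sub hi).abs.mono' (m1.sub m2) (ae_of_all _ fun x => ?_)
      refine (abs_abs_sub_abs_le_abs_sub _ _).trans_eq ?_
      simp
    have := ae_nonneg_of_forall_pairing hdi.locallyIntegrable fun ϖ hϖ hϖc hϖ0 => ?_
    · filter_upwards [this] with x hx
      linarith
    obtain ⟨C, hC⟩ := hϖc.exists_bound_of_continuous hϖ.continuous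
    have hϖi : Integrable ϖ := hϖ.continuous.integrable_of_hasCompactSupport hϖc
    have hint : ∀ w : ℝ → ℝ, Integrable w → Integrable fun x => |w x - α| * ϖ x := fun w hw => by
      have h1 : Integrable fun x => |w x| * ϖ x :=
        hw.abs.mul_bdd (c := C) hϖ.continuous.aestronglyMeasurable (ae_of_all _ hC)
      refine (h1.add (hϖi.const_mul |(α : ℝ)|)).mono' ?_ (ae_of_all _ fun x => ?_)
      · exact ((hw.1.sub aestronglyMeasurable_const).norm).mul hϖ.continuous.aestronglyMeasurable
      · rw [norm_mul, Real.norm_eq_abs, abs_abs, Real.norm_of_nonneg (hϖ0 x), Pi.add_apply,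
          ← add_mul]
        exact mul_le_mul_of_nonneg_right (abs_sub _ _) (hϖ0 x)
    have h1 := hU.integral_initial_le hT hD k α hϖ hϖc hϖ0
    have h2 := integral_sub (hint _ (hU₀ k)) (hint _ hi)
    have h3 : ∫ x, ϖ x * (|U₀ k x - α| - |U k 0 x - α|)
        = ∫ x, (|U₀ k x - α| * ϖ x - |U k 0 x - α| * ϖ x) := by
      congr 1; ext x; ring
    rw [h3, h2]
    linarith
  filter_upwards [ae_all_iff.2 h] with x hx
  have hcl : IsClosed {α : ℝ | |U k 0 x - α| ≤ |U₀ k x - α|} :=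
    isClosed_le (by fun_prop) (by fun_prop)
  have hall : ∀ α : ℝ, α ∈ {α : ℝ | |U k 0 x - α| ≤ |U₀ k x - α|} := by
    intro α
    have : Set.range ((↑) : ℚ → ℝ) ⊆ {α : ℝ | |U k 0 x - α| ≤ |U₀ k x - α|} := by
      rintro _ ⟨r, rfl⟩
      exact hx r
    exact (closure_minimal this hcl) (Rat.denseRange_cast α)
  have := hall (U₀ k x)
  simp only [mem_ofPred_eq, sub_self, abs_zero] at this
  linarith [sub_eq_zero.1 (abs_nonpos_iff.1 this)]

end

/-! ### Comparison of two systems -/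

/-- Distances between the coefficient functions of two systems. -/
structure CoeffGap where
  f : ℝ
  ν : ℝ
  gradν : ℝ
  Γ : ℝ
  μ : ℝ
  η : ℝ
  θ : ℝ
  R : ℝ

/-- The sum of all distances. -/
def CoeffGap.total (δ : CoeffGap) : ℝ :=
  δ.f + δ.ν + δ.gradν + δ.Γ + δ.μ + δ.η + δ.θ + δ.R

/-- The coefficients of `D` and `D'` differ by at most `δ`. -/
structure SystemData.Close {N : ℕ} (D D' : SystemData N) (δ : CoeffGap) : Prop where
  f_nonneg : 0 ≤ δ.f
  ν_nonneg : 0 ≤ δ.ν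
  gradν_nonneg : 0 ≤ δ.gradν
  Γ_nonneg : 0 ≤ δ.Γ
  μ_nonneg : 0 ≤ δ.μ
  η_nonneg : 0 ≤ δ.η
  θ_nonneg : 0 ≤ δ.θ
  R_nonneg : 0 ≤ δ.R
  f_le : ∀ k x y, |(D.f k x - D'.f k x) - (D.f k y - D'.f k y)| ≤ δ.f * |x - y|
  ν_le : ∀ k w, |D.ν k w - D'.ν k w| ≤ δ.ν
  gradν_le : ∀ k j w, |partialD j (D.ν k) w - partialD j (D'.ν k) w| ≤ δ.gradν
  Γ_le : ∀ j k, ∀ᵐ s ∂halfLine, |D.Γ j k s - D'.Γ j k s| ≤ δ.Γ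
  μ_le : ∀ j k x, |D.μ j k x - D'.μ j k x| ≤ δ.μ
  derivμ_le : ∀ j k x, |deriv (D.μ j k) x - deriv (D'.μ j k) x| ≤ δ.μ
  η_le : ∀ k, ∑ j, ∫⁻ x, ‖D.η j k x - D'.η j k x‖ₑ ≤ ENNReal.ofReal δ.η
  θ_le : ∀ k, ∑ j, ∫⁻ s, ‖D.θ j k s - D'.θ j k s‖ₑ ∂halfLine ≤ ENNReal.ofReal δ.θ
  R_le : ∀ k a b, |D.R k a b - D'.R k a b| ≤ δ.R * (norm1 a + norm1 b)

section

variable {N : ℕ} {D D' : SystemData N} {M T T₀ : ℝ} {U V : Fin N → ℝ → ℝ → ℝ} {δ : CoeffGap}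
  {U₀ V₀ : Fin N → ℝ → ℝ} {u v : Fin N → ℝ × ℝ → ℝ}

theorem KernelBound.mono {c c' G : ℝ} {κ γ : ℝ → ℝ} (h : KernelBound c G κ γ) (hc : c ≤ c') :
    KernelBound c' G κ γ := ⟨h.κ_cont, fun x => (h.κ_le x).trans hc, h.γ_meas, h.γ_le⟩

/-- The kernels are arbitrary so that the same bound serves μ in the velocity and its derivative in
the velocity gradient. -/
theorem norm1_memConv_sub_le {κ κ' γ γ' : Fin N → Fin N → ℝ → ℝ} {c G dκ dγ S : ℝ} {k : Fin N}
    (h : ∀ j, KernelBound c G (κ j k) (γ j k)) (h' : ∀ j, KernelBound c G (κ' j k) (γ' j k))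
    (hU : ∀ j, L1Curve T (U j)) (hV : ∀ j, L1Curve T (V j))
    (hdκ : ∀ j x, |κ j k x - κ' j k x| ≤ dκ)
    (hdγ : ∀ j, ∀ᵐ s ∂halfLine, |γ j k s - γ' j k s| ≤ dγ)
    (hS : ∑ j, curveNorm T (U j) ≤ S) {t : ℝ} (ht : t ∈ Icc 0 T) (x : ℝ) :
    norm1 (memConv κ γ U k t x - memConv κ' γ' V k t x)
      ≤ (dγ * c + G * dκ) * S + G * c * ∑ j, curveNorm T fun t x => U j t x - V j t x := by
  rcases isEmpty_or_nonempty (Fin N) with hN | ⟨⟨j₀⟩⟩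
  · exact hN.elim k
  have h0 : 0 ≤ dγ * c + G * dκ := add_nonneg
    (mul_nonneg (nonneg_of_ae_halfLine (hdγ j₀)) ((abs_nonneg _).trans ((h j₀).κ_le 0)))
    (mul_nonneg (nonneg_of_ae_halfLine (h j₀).γ_le) ((abs_nonneg _).trans (hdκ j₀ 0)))
  refine le_trans ?_ (add_le_add_left (mul_le_mul_of_nonneg_left hS h0) _)
  rw [norm1, Finset.mul_sum, Finset.mul_sum, ← Finset.sum_add_distrib]
  refine Finset.sum_le_sum fun j _ => ?_
  rw [Pi.sub_apply, memConv_eq, memConv_eq]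
  exact (h j).abs_sub_le (h' j) (hU j) (hV j) (hdκ j) (hdγ j) ht x

/-- The value of ν^k for D at the memory of V is inserted: the gradient bound handles the change of
argument, and the gap handles the change of ν. -/
theorem abs_velocity_sub_le (hD : D.PointwiseBounds M) (hc : D.Close D' δ) {X : ℝ} {k : Fin N}
    {t x : ℝ} (hX : norm1 (memConv D.μ D.Γ U k t x - memConv D'.μ D'.Γ V k t x) ≤ X) :
    |D.velocity U k t x - D'.velocity V k t x| ≤ M * X + δ.ν := by
  unfold SystemData.velocity
  refine (_root_.abs_sub_le _ (D.ν k (memConv D'.μ D'.Γ V k t x)) _).trans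
    (add_le_add ?_ (hc.ν_le _ _))
  exact (abs_sub_le_norm1_of_partialD_le ((hD.ν_smooth k).of_le (by norm_num)) (hD.ν_grad_le k) _
    _).trans (mul_le_mul_of_nonneg_left hX hD.nonneg)

/-- By the chain rule both sides are sums of products. Telescoping uses the gradient bound on ν for
one factor, and its Hessian bound with the size of the memory of V for the other; this is where two
derivatives of ν are needed. -/
theorem abs_velocityDeriv_sub_le (hD : D.PointwiseBounds M) (hD' : D'.PointwiseBounds M)
    (hc : D.Close D' δ) (hV : ∀ j, L1Curve T (V j)) (hS : ∑ j, curveNorm T (V j) ≤ M)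
    {X : ℝ} {k : Fin N} {t x : ℝ} (ht : t ∈ Icc 0 T)
    (hX : norm1 (memConv D.μ D.Γ U k t x - memConv D'.μ D'.Γ V k t x) ≤ X)
    (hX' : norm1 (memConv (fun j k => deriv (D.μ j k)) D.Γ U k t x
      - memConv (fun j k => deriv (D'.μ j k)) D'.Γ V k t x) ≤ X) :
    |D.velocityDeriv U k t x - D'.velocityDeriv V k t x|
      ≤ M * X + (M * X + δ.gradν) * (M * M * M) := by
  have hM := hD.nonneg
  have hn : norm1 (memConv (fun j k => deriv (D'.μ j k)) D'.Γ V k t x) ≤ M * M * M :=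
    (norm1_memConv_deriv_le hD' hV k ht x).trans (mul_le_mul_of_nonneg_left hS (mul_nonneg hM hM))
  have hp : ∀ j, |partialD j (D.ν k) (memConv D.μ D.Γ U k t x)
      - partialD j (D'.ν k) (memConv D'.μ D'.Γ V k t x)| ≤ M * X + δ.gradν := fun j => by
    refine (_root_.abs_sub_le _ (partialD j (D.ν k) (memConv D'.μ D'.Γ V k t x)) _).trans
      (add_le_add ?_ (hc.gradν_le _ _ _))
    exact (abs_sub_le_norm1_of_partialD_le
      (contDiff_partialD (hD.ν_smooth k) (by norm_num [one_add_one_eq_two]) j)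
      (fun i => hD.ν_hess_le k i j) _ _).trans (mul_le_mul_of_nonneg_left hX hM)
  have h0 : 0 ≤ M * X + δ.gradν := (abs_nonneg _).trans (hp k)
  unfold SystemData.velocityDeriv
  refine le_trans ?_ (add_le_add (mul_le_mul_of_nonneg_left hX' hM)
    (mul_le_mul_of_nonneg_left hn h0))
  rw [norm1, norm1, Finset.mul_sum, Finset.mul_sum, ← Finset.sum_add_distrib,
    ← Finset.sum_sub_distrib]
  refine (Finset.abs_sum_le_sum_abs _ _).trans (Finset.sum_le_sum fun j _ => ?_)
  have e : ∀ a b a' b' : ℝ, |a * b - a' * b'| ≤ |a| * |b - b'| + |a - a'| * |b'| := by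
    intro a b a' b'
    rw [← abs_mul, ← abs_mul, show a * b - a' * b' = a * (b - b') + (a - a') * b' by ring]
    exact abs_add_le _ _
  refine (e _ _ _ _).trans ?_
  rw [Pi.sub_apply]
  exact add_le_add (mul_le_mul_of_nonneg_right (hD.ν_grad_le _ _ _) (abs_nonneg _))
    (mul_le_mul_of_nonneg_right (hp j) (abs_nonneg _))

theorem lintegral_enorm_combination {ρ : Measure (ℝ × ℝ)} {a b : ℝ} (ha : 0 ≤ a) (hb : 0 ≤ b)
    {g h : ℝ × ℝ → ℝ} (hg : Measurable g) (hh : Measurable h) :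
    ∫⁻ p, ‖a * |g p| + b * |h p|‖ₑ ∂ρ
      = ENNReal.ofReal a * (∫⁻ p, ‖g p‖ₑ ∂ρ) + ENNReal.ofReal b * ∫⁻ p, ‖h p‖ₑ ∂ρ := by
  rw [← lintegral_const_mul _ hg.enorm, ← lintegral_const_mul _ hh.enorm,
    ← lintegral_add_left (hg.enorm.const_mul _)]
  refine lintegral_congr fun p => ?_
  rw [Real.enorm_eq_ofReal (by positivity), ENNReal.ofReal_add (by positivity) (by positivity),
    ENNReal.ofReal_mul ha, ENNReal.ofReal_mul hb, Real.enorm_eq_ofReal_abs, Real.enorm_eq_ofReal_abs]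

theorem curveNorm_le_of_sum_le (hT : 0 ≤ T) {S : ℝ} (hS : ∑ j, curveNorm T (U j) ≤ S) (j : Fin N) :
    curveNorm T (U j) ≤ S :=
  (Finset.single_le_sum (f := fun j => curveNorm T (U j)) (fun _ _ => curveNorm_nonneg hT _)
    (Finset.mem_univ j)).trans hS

theorem sum_ofReal_curveNorm_le (hT : 0 ≤ T) {S : ℝ} (hS : ∑ j, curveNorm T (U j) ≤ S) :
    ∑ j, ENNReal.ofReal (curveNorm T (U j)) ≤ ENNReal.ofReal S := by
  rw [← ENNReal.ofReal_sum_of_nonneg fun _ _ => curveNorm_nonneg hT _]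
  exact ENNReal.ofReal_le_ofReal hS

/-- The memory terms of the source are integrable in space-time. -/
theorem sum_lintegral_memory_le (hD : D.PointwiseBounds M) (hT : 0 ≤ T) (hTT : T ≤ T₀)
    (hU : ∀ j, L1Curve T (U j)) (hS : ∑ j, curveNorm T (U j) ≤ M) (k : Fin N) :
    ∑ j, ∫⁻ t in Ioo 0 T, ∫⁻ x, ‖memConv D.η D.θ U k (clamp T t) x j‖ₑ
      ≤ ENNReal.ofReal (M * M * (M * T₀)) := by
  have hM := hD.nonneg
  obtain ⟨c, hc⟩ := hD.ηθ
  have h : ∀ j, ∫⁻ t in Ioo 0 T, ∫⁻ x, ‖memConv D.η D.θ U k (clamp T t) x j‖ₑ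
      ≤ ENNReal.ofReal (curveNorm T (U j)) * ENNReal.ofReal M * ENNReal.ofReal (M * T₀) := fun j => by
    have e : ∫⁻ t in Ioo 0 T, ∫⁻ x, ‖memConv D.η D.θ U k (clamp T t) x j‖ₑ
        = ∫⁻ t in Ioo 0 T, ∫⁻ x, ‖tConv (D.θ j k) (spConv (D.η j k) (U j)) t x‖ₑ := by
      refine setLIntegral_congr_fun measurableSet_Ioo fun t ht => ?_
      simp only [clamp_of_mem (Ioo_subset_Icc_self ht), memConv_eq]
    rw [e]
    refine ((hc j k).lintegral_le (hD.η_int j k) hT (hU j)).trans ?_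
    gcongr
    exact hD.η_le j k
  refine (Finset.sum_le_sum fun j _ => h j).trans ?_
  rw [← Finset.sum_mul, ← Finset.sum_mul, ENNReal.ofReal_mul (p := M * M) (by positivity),
    ENNReal.ofReal_mul (q := M) hM]
  gcongr
  exact sum_ofReal_curveNorm_le hT hS

/-- `L^1` stability of the memory terms of the source. -/
theorem sum_lintegral_memory_sub_le (hD : D.PointwiseBounds M) (hD' : D'.PointwiseBounds M)
    (hδ : D.Close D' δ) (hT : 0 ≤ T) (hTT : T ≤ T₀) (hU : ∀ j, L1Curve T (U j))
    (hV : ∀ j, L1Curve T (V j)) (hS : ∑ j, curveNorm T (U j) ≤ M) {E : ℝ}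
    (hE : ∑ j, curveNorm T (fun t x => U j t x - V j t x) ≤ E) (k : Fin N) :
    ∑ j, ∫⁻ t in Ioo 0 T, ∫⁻ x, ‖memConv D.η D.θ U k (clamp T t) x j
        - memConv D'.η D'.θ V k (clamp T t) x j‖ₑ
      ≤ ENNReal.ofReal (M * M * δ.θ + (M * δ.η + E * M) * (M * T₀)) := by
  have hM := hD.nonneg
  have hη := hδ.η_nonneg
  have hθ := hδ.θ_nonneg
  have hE0 : 0 ≤ E := (Finset.sum_nonneg fun _ _ => curveNorm_nonneg hT _).trans hE
  have hT₀ : 0 ≤ T₀ := hT.trans hTT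
  obtain ⟨c, hc⟩ := hD.ηθ
  obtain ⟨c', hc'⟩ := hD'.ηθ
  have h : ∀ j, ∫⁻ t in Ioo 0 T, ∫⁻ x, ‖memConv D.η D.θ U k (clamp T t) x j
        - memConv D'.η D'.θ V k (clamp T t) x j‖ₑ
      ≤ ENNReal.ofReal M * ENNReal.ofReal M * (∫⁻ s, ‖D.θ j k s - D'.θ j k s‖ₑ ∂halfLine)
        + (ENNReal.ofReal M * (∫⁻ x, ‖D.η j k x - D'.η j k x‖ₑ)
          + ENNReal.ofReal (curveNorm T fun t x => U j t x - V j t x) * ENNReal.ofReal M)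
          * ENNReal.ofReal (M * T₀) := fun j => by
    have e : ∫⁻ t in Ioo 0 T, ∫⁻ x, ‖memConv D.η D.θ U k (clamp T t) x j
        - memConv D'.η D'.θ V k (clamp T t) x j‖ₑ
        = ∫⁻ t in Ioo 0 T, ∫⁻ x, ‖tConv (D.θ j k) (spConv (D.η j k) (U j)) t x
          - tConv (D'.θ j k) (spConv (D'.η j k) (V j)) t x‖ₑ := by
      refine setLIntegral_congr_fun measurableSet_Ioo fun t ht => ?_
      simp only [clamp_of_mem (Ioo_subset_Icc_self ht), memConv_eq]
    rw [e]
    -- The two sup bounds are replaced by a common one to match the kernels; neither appears in the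
    -- resulting estimate.
    refine (((hc j k).mono (le_max_left c c')).lintegral_sub_le ((hc' j k).mono (le_max_right c c'))
      (hD.η_int j k) (hD'.η_int j k) hT (hU j) (hV j)).trans ?_
    have := curveNorm_le_of_sum_le hT hS j
    gcongr
    · exact hD.η_le j k
    · exact hD'.η_le j k
  refine (Finset.sum_le_sum fun j _ => h j).trans ?_
  rw [Finset.sum_add_distrib, ← Finset.mul_sum, ← Finset.sum_mul, Finset.sum_add_distrib,
    ← Finset.mul_sum, ← Finset.sum_mul, ENNReal.ofReal_add (by positivity) (by positivity),
    ENNReal.ofReal_mul (p := M * M) (by positivity), ENNReal.ofReal_mul (q := M) hM,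
    ENNReal.ofReal_mul (p := M * δ.η + E * M) (by positivity),
    ENNReal.ofReal_add (p := M * δ.η) (by positivity) (by positivity),
    ENNReal.ofReal_mul (q := δ.η) hM, ENNReal.ofReal_mul hE0]
  gcongr
  · exact hδ.θ_le k
  · exact hδ.η_le k
  · exact sum_ofReal_curveNorm_le (U := fun j t x => U j t x - V j t x) hT hE

/-- `L^1` stability of the sources. -/
theorem lintegral_planeSource_sub_le (hD : D.PointwiseBounds M) (hD' : D'.PointwiseBounds M)
    (hδ : D.Close D' δ) (hT : 0 ≤ T) (hTT : T ≤ T₀) (hU : ∀ j, L1Curve T (U j))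
    (hV : ∀ j, L1Curve T (V j)) (hu : ∀ j, PlaneRep T (U j) (u j))
    (hv : ∀ j, PlaneRep T (V j) (v j)) (hS : ∑ j, curveNorm T (U j) ≤ M) {E : ℝ}
    (hE : ∑ j, curveNorm T (fun t x => U j t x - V j t x) ≤ E) (k : Fin N) :
    ∫⁻ p, ‖D.planeSource T U u k p - D'.planeSource T V v k p‖ₑ
      ≤ ENNReal.ofReal (δ.R * (M + M * M * (M * T₀))
        + M * (E + (M * M * δ.θ + (M * δ.η + E * M) * (M * T₀)))) := by
  have hM := hD.nonneg
  have hη := hδ.η_nonneg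
  have hθ := hδ.θ_nonneg
  have hR := hδ.R_nonneg
  have hE0 : 0 ≤ E := (Finset.sum_nonneg fun _ _ => curveNorm_nonneg hT _).trans hE
  have hT₀ : 0 ≤ T₀ := hT.trans hTT
  obtain ⟨c, hc⟩ := hD.ηθ
  obtain ⟨c', hc'⟩ := hD'.ηθ
  have mU : ∀ j, Measurable fun p : ℝ × ℝ => memConv D.η D.θ U k (clamp T p.1) p.2 j := fun j =>
    ((continuous_apply j).comp (continuous_memConv_clamp (fun j => hc j k) hT hU)).measurable
  have mV : ∀ j, Measurable fun p : ℝ × ℝ => memConv D'.η D'.θ V k (clamp T p.1) p.2 j := fun j =>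
    ((continuous_apply j).comp (continuous_memConv_clamp (fun j => hc' j k) hT hV)).measurable
  have muv : ∀ j, Measurable fun p => u j p - v j p := fun j => (hu j).meas.sub (hv j).meas
  have mUV : ∀ j, Measurable fun p : ℝ × ℝ => memConv D.η D.θ U k (clamp T p.1) p.2 j
      - memConv D'.η D'.θ V k (clamp T p.1) p.2 j := fun j => (mU j).sub (mV j)
  have main := lintegral_le_of_abs_le_sum (T := T)
    (F := fun p => D.planeSource T U u k p - D'.planeSource T V v k p) (L := 1)
    (u := fun j p => δ.R * |u j p| + M * |u j p - v j p|)
    (m := fun j p => δ.R * |memConv D.η D.θ U k (clamp T p.1) p.2 j|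
      + M * |memConv D.η D.θ U k (clamp T p.1) p.2 j - memConv D'.η D'.θ V k (clamp T p.1) p.2 j|)
    zero_le_one (fun p hp => ?_)
    (fun p hp => by simp only [SystemData.planeSource, indicator_of_notMem hp, sub_zero])
    (fun j => ((hu j).meas.abs.const_mul _).add ((muv j).abs.const_mul _))
    (fun j => ((mU j).abs.const_mul _).add ((mUV j).abs.const_mul _))
  · refine main.trans ?_
    have e1 : ∀ j, ∫⁻ p, ‖δ.R * |u j p| + M * |u j p - v j p|‖ₑ
        = ENNReal.ofReal δ.R * ENNReal.ofReal (curveNorm T (U j))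
          + ENNReal.ofReal M * ENNReal.ofReal (curveNorm T fun t x => U j t x - V j t x) := fun j => by
      rw [lintegral_enorm_combination hR hM (hu j).meas (muv j), (hu j).lintegral_eq,
        ((hu j).sub (hv j)).lintegral_eq, (hU j).lintegral_norm hT,
        ((hU j).sub (hV j)).lintegral_norm hT]
      rfl
    have e2 : ∀ j, ∫⁻ t in Ioo 0 T, ∫⁻ x, ‖δ.R * |memConv D.η D.θ U k (clamp T t) x j|
        + M * |memConv D.η D.θ U k (clamp T t) x j - memConv D'.η D'.θ V k (clamp T t) x j|‖ₑ
        = ENNReal.ofReal δ.R * (∫⁻ t in Ioo 0 T, ∫⁻ x, ‖memConv D.η D.θ U k (clamp T t) x j‖ₑ)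
          + ENNReal.ofReal M * (∫⁻ t in Ioo 0 T, ∫⁻ x, ‖memConv D.η D.θ U k (clamp T t) x j
            - memConv D'.η D'.θ V k (clamp T t) x j‖ₑ) := fun j => by
      have hA : Measurable fun p : ℝ × ℝ => δ.R * |memConv D.η D.θ U k (clamp T p.1) p.2 j|
          + M * |memConv D.η D.θ U k (clamp T p.1) p.2 j
            - memConv D'.η D'.θ V k (clamp T p.1) p.2 j| :=
        ((mU j).abs.const_mul _).add ((mUV j).abs.const_mul _)
      have := lintegral_enorm_combination (ρ := volume.restrict (QT T)) hR hM (mU j) (mUV j)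
      rwa [lintegral_plane_strip hA.enorm, lintegral_plane_strip (mU j).enorm,
        lintegral_plane_strip (mUV j).enorm] at this
    simp only [e1, e2]
    rw [ENNReal.ofReal_one, one_mul, Finset.sum_add_distrib, Finset.sum_add_distrib,
      ← Finset.mul_sum, ← Finset.mul_sum, ← Finset.mul_sum, ← Finset.mul_sum]
    have h1 := sum_ofReal_curveNorm_le hT hS
    have h2 := sum_ofReal_curveNorm_le (U := fun j t x => U j t x - V j t x) hT hE
    have h3 := sum_lintegral_memory_le hD hT hTT hU hS k
    have h4 := sum_lintegral_memory_sub_le hD hD' hδ hT hTT hU hV hS hE k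
    refine (add_le_add (add_le_add (mul_le_mul_right h1 _) (mul_le_mul_right h2 _))
      (add_le_add (mul_le_mul_right h3 _) (mul_le_mul_right h4 _))).trans_eq ?_
    rw [← ENNReal.ofReal_mul hR, ← ENNReal.ofReal_mul hM, ← ENNReal.ofReal_mul hR,
      ← ENNReal.ofReal_mul hM, ← ENNReal.ofReal_add (by positivity) (by positivity),
      ← ENNReal.ofReal_add (by positivity) (by positivity),
      ← ENNReal.ofReal_add (by positivity) (by positivity)]
    congr 1
    ring
  · simp only [SystemData.planeSource, indicator_of_mem hp]
    set a : Fin N → ℝ := fun j => u j p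
    set a' : Fin N → ℝ := fun j => v j p
    set b := memConv D.η D.θ U k (clamp T p.1) p.2
    set b' := memConv D'.η D'.θ V k (clamp T p.1) p.2
    -- The difference of the sources at the same argument grows with that argument; the change of
    -- argument is charged to the Lipschitz constant of `D'.R`.
    have h1 := (_root_.abs_sub_le (D.R k a b) (D'.R k a b) (D'.R k a' b')).trans
      (add_le_add (hδ.R_le k a b) (hD'.R_lip k a b a' b'))
    have e : ∀ x y : Fin N → ℝ, ∑ j, abs (δ.R * |x j| + M * |x j - y j|)
        = δ.R * norm1 x + M * norm1 (x - y) := fun x y => by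
      rw [norm1, norm1, Finset.mul_sum, Finset.mul_sum, ← Finset.sum_add_distrib]
      exact Finset.sum_congr rfl fun j _ => abs_of_nonneg (by positivity)
    rw [one_mul]
    refine h1.trans (le_of_eq ?_)
    refine Eq.trans ?_ (congrArg₂ (· + ·) (e a a') (e b b')).symm
    ring

end

/-! ### Stability -/

/-- Gronwall's inequality in integral form. -/
theorem le_mul_exp_of_le_add_integral {w : ℝ → ℝ} {T a C : ℝ} (hC : 0 ≤ C)
    (hw : ContinuousOn w (Icc 0 T)) (h : ∀ t ∈ Icc 0 T, w t ≤ a + C * ∫ s in (0 : ℝ)..t, w s) :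
    ∀ t ∈ Icc 0 T, w t ≤ a * Real.exp (C * t) := by
  intro t ht
  have hT : 0 ≤ T := ht.1.trans ht.2
  have hWc : Continuous fun t => w (clamp T t) :=
    hw.comp_continuous (continuous_clamp T) fun t => clamp_mem hT t
  -- On [0, T], G dominates w and G' = C w ≤ C G, so G(t) e^{-Ct} is nonincreasing. Clamping makes G
  -- differentiable on the whole line.
  set G : ℝ → ℝ := fun t => a + C * ∫ s in (0 : ℝ)..t, w (clamp T s) with hG
  have hGd : ∀ t, HasDerivAt G (C * w (clamp T t)) t := fun t =>
    ((intervalIntegral.integral_hasDerivAt_right (hWc.intervalIntegrable _ _)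
      (hWc.stronglyMeasurableAtFilter _ _) hWc.continuousAt).const_mul C).const_add a
  have hwG : ∀ t ∈ Icc 0 T, w t ≤ G t := fun t ht => by
    refine (h t ht).trans_eq ?_
    rw [hG]
    simp only
    congr 2
    refine intervalIntegral.integral_congr fun s hs => ?_
    rw [uIcc_of_le ht.1] at hs
    simp only [clamp_of_mem (show s ∈ Icc 0 T from ⟨hs.1, hs.2.trans ht.2⟩)]
  have hd : ∀ t, HasDerivAt (fun t => G t * Real.exp (-(C * t)))
      (C * w (clamp T t) * Real.exp (-(C * t)) + G t * (Real.exp (-(C * t)) * -(C * 1))) t :=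
    fun t => (hGd t).mul (((hasDerivAt_id t).const_mul C).neg.exp)
  have hanti : AntitoneOn (fun t => G t * Real.exp (-(C * t))) (Icc 0 T) := by
    refine antitoneOn_of_deriv_nonpos (convex_Icc 0 T)
      (fun t _ => (hd t).continuousAt.continuousWithinAt)
      (fun t _ => (hd t).differentiableAt.differentiableWithinAt) fun t ht' => ?_
    rw [interior_Icc] at ht'
    have ht' := Ioo_subset_Icc_self ht'
    rw [(hd t).deriv, clamp_of_mem ht']
    have := mul_nonneg (mul_nonneg hC (sub_nonneg.2 (hwG t ht'))) (Real.exp_pos (-(C * t))).le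
    linarith
  have h1 := hanti ⟨le_rfl, hT⟩ ht ht.1
  simp only [hG, intervalIntegral.integral_same, mul_zero, neg_zero, Real.exp_zero, add_zero,
    mul_one] at h1
  have h2 := hwG t ht
  rw [Real.exp_neg, ← div_eq_mul_inv, div_le_iff₀ (Real.exp_pos _)] at h1
  exact h2.trans h1

section

variable {N : ℕ} {D D' : SystemData N} {T T₀ : ℝ} {M : ℝ≥0} {U V : Fin N → ℝ → ℝ → ℝ}
  {δ : CoeffGap} {U₀ V₀ : Fin N → ℝ → ℝ}

theorem integral_initial_eq (hU : IsEntropySolution D T U₀ U) (hV : IsEntropySolution D' T V₀ V)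
    (hT : 0 < T) (hD : D.PointwiseBounds M) (hD' : D'.PointwiseBounds M)
    (hU₀ : ∀ k, Integrable (U₀ k)) (hV₀ : ∀ k, Integrable (V₀ k)) (k : Fin N) :
    ∫ x, |U k 0 x - V k 0 x| = ∫ x, |U₀ k x - V₀ k x| := by
  refine integral_congr_ae ?_
  filter_upwards [hU.initial_trace hT hD hU₀ k, hV.initial_trace hT hD' hV₀ k] with x h1 h2
  rw [h1, h2]

/-- The distance of two solutions at the final time, in terms of their space-time distance. -/
theorem integral_abs_sub_le (hU : IsEntropySolution D T U₀ U) (hV : IsEntropySolution D' T V₀ V)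
    (hT : 0 < T) (hTT : T ≤ T₀) (hD : D.PointwiseBounds M) (hD' : D'.PointwiseBounds M)
    (hδ : D.Close D' δ) (hU₀ : ∀ k, Integrable (U₀ k)) (hV₀ : ∀ k, Integrable (V₀ k))
    (hSU : ∑ j, curveNorm T (U j) ≤ M) (hSV : ∑ j, curveNorm T (V j) ≤ M)
    (hTV : ∀ k, ∀ t ∈ Icc 0 T, totalVar (U k t) ≤ M) {E X : ℝ}
    (hE : ∑ j, curveNorm T (fun t x => U j t x - V j t x) = E)
    (hX : X = (δ.Γ * M + M * δ.μ) * M + M * M * E) (k : Fin N) :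
    ∫ x, |U k T x - V k T x| ≤ (∫ x, |U₀ k x - V₀ k x|)
      + ((M * δ.f + M * (M * X + δ.ν)) * (T₀ * M)
        + (M * (M * M * M) * δ.f + M * (M * X + (M * X + δ.gradν) * (M * M * M))) * M
        + (δ.R * (M + M * M * (M * T₀))
          + M * (E + (M * M * δ.θ + (M * δ.η + E * M) * (M * T₀))))) := by
  have hM : (0 : ℝ) ≤ M := M.2
  have hT₀ : 0 ≤ T₀ := hT.le.trans hTT
  have hE0 : 0 ≤ E := hE ▸ Finset.sum_nonneg fun _ _ => curveNorm_nonneg hT.le _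
  have hX0 : 0 ≤ X := by
    have := hδ.Γ_nonneg
    have := hδ.μ_nonneg
    rw [hX]; positivity
  have hδf := hδ.f_nonneg
  have hδν := hδ.ν_nonneg
  have hδν' := hδ.gradν_nonneg
  have hδη := hδ.η_nonneg
  have hδθ := hδ.θ_nonneg
  have hδR := hδ.R_nonneg
  have hwU : ∀ j, L1Curve T (U j) := hU.l1Curve
  have hwV : ∀ j, L1Curve T (V j) := hV.l1Curve
  choose u hu hur using hU.exists_planeRep
  choose v hv hvr using hV.exists_planeRep
  have hm : ∀ p : ℝ × ℝ, norm1 (memConv D.μ D.Γ U k (clamp T p.1) p.2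
      - memConv D'.μ D'.Γ V k (clamp T p.1) p.2) ≤ X := fun p => by
    rw [hX, ← hE]
    exact norm1_memConv_sub_le (fun j => hD.μΓ j k) (fun j => hD'.μΓ j k) hwU hwV
      (fun j => hδ.μ_le j k) (fun j => hδ.Γ_le j k) hSU (clamp_mem hT.le _) _
  have hm' : ∀ p : ℝ × ℝ, norm1 (memConv (fun j k => deriv (D.μ j k)) D.Γ U k (clamp T p.1) p.2
      - memConv (fun j k => deriv (D'.μ j k)) D'.Γ V k (clamp T p.1) p.2) ≤ X := fun p => by
    rw [hX, ← hE]
    exact norm1_memConv_sub_le (κ := fun j k => deriv (D.μ j k)) (κ' := fun j k => deriv (D'.μ j k))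
      (fun j => hD.μ'Γ j k) (fun j => hD'.μ'Γ j k) hwU hwV
      (fun j => hδ.derivμ_le j k) (fun j => hδ.Γ_le j k) hSU (clamp_mem hT.le _) _
  have hW : ContinuousOn (fun t => ∫ x, |U k t x - V k t x|) (Icc 0 T) :=
    ((hwU k).sub (hwV k)).continuousOn_norm
  have hWu : ∀ᵐ t, t ∈ Ioo 0 T → ∫ x, |u k (t, x) - v k (t, x)| = ∫ x, |U k t x - V k t x| := by
    filter_upwards [((hu k).sub (hv k)).slice] with t h1 ht
    refine integral_congr_ae ?_
    filter_upwards [h1 ht] with x hx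
    rw [hx]
  -- The larger time T₀ replaces T, since T will be the end of a restricted interval and the
  -- constants must not vary with it.
  have hB : ∀ h : ℝ, 0 < h → ∫ p, |u k (p - (0, h)) - u k p| ≤ T₀ * M * h := fun h hh =>
    ((hu k).integral_translate_le (hwU k) hT.le (hTV k) hh).trans (by gcongr)
  have hstab := scalar_stability hT (hU.scalarSolution hT.le hD hSU hu hur k)
    (hV.scalarSolution hT.le hD' hSV hv hvr k)
    (fun t x => hasDerivAt_velocity hD hwU k (clamp_mem hT.le t) x) hB hδf (hδ.f_le k)
    (fun p => abs_velocity_sub_le hD hδ (hm p))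
    (fun p => abs_velocityDeriv_sub_le hD hD' hδ hwV hSV (clamp_mem hT.le _) (hm p) (hm' p)) hW hWu
  have hu1 : ∫ p, u k p ≤ M := by
    have := (hu k).integral_abs (hwU k) hT.le
    simp only [abs_of_nonneg (hur k _).1] at this
    rw [this]
    exact curveNorm_le_of_sum_le hT.le hSU k
  have hr : ∫ p, |D.planeSource T U u k p - D'.planeSource T V v k p|
      ≤ δ.R * (M + M * M * (M * T₀))
        + M * (E + (M * M * δ.θ + (M * δ.η + E * M) * (M * T₀))) := by
    have hi : Integrable fun p => |D.planeSource T U u k p - D'.planeSource T V v k p| :=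
      ((integrable_planeSource hD hT.le hwU hu k).sub
        (integrable_planeSource hD' hT.le hwV hv k)).abs
    refine (ENNReal.ofReal_le_ofReal_iff (by positivity)).1 ?_
    rw [ofReal_integral_eq_lintegral_ofReal hi (ae_of_all _ fun p => abs_nonneg _)]
    simp_rw [← Real.enorm_eq_ofReal_abs]
    exact lintegral_planeSource_sub_le hD hD' hδ hT.le hTT hwU hwV hu hv hSU hE.le k
  rw [integral_initial_eq hU hV hT hD hD' hU₀ hV₀] at hstab
  refine hstab.trans (add_le_add_right (add_le_add (add_le_add (le_of_eq (by ring))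
    (mul_le_mul_of_nonneg_left hu1 (by positivity))) hr) _)

theorem sum_curveNorm_mono (hU : ∀ j, L1Curve T (U j)) {t : ℝ} (ht : t ∈ Icc 0 T) :
    ∑ j, curveNorm t (U j) ≤ ∑ j, curveNorm T (U j) := by
  refine Finset.sum_le_sum fun j _ => ?_
  refine intervalIntegral.integral_mono_interval le_rfl ht.1 ht.2
    (ae_of_all _ fun s => integral_nonneg fun x => abs_nonneg _)
    ((hU j).intervalIntegrable_norm (ht.1.trans ht.2))

/-- Stability of entropy solutions with respect to data and coefficients. -/
theorem exists_stability_constant (N : ℕ) (M : ℝ≥0) {T : ℝ} (hT : 0 < T) :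
    ∃ C : ℝ≥0, 0 < C ∧ ∀ (D D' : SystemData N) (δ : CoeffGap) (U₀ V₀ : Fin N → ℝ → ℝ)
      (U V : Fin N → ℝ → ℝ → ℝ), D.PointwiseBounds M → D'.PointwiseBounds M → D.Close D' δ →
      (∀ k, Integrable (U₀ k)) → (∀ k, Integrable (V₀ k)) →
      IsEntropySolution D T U₀ U → IsEntropySolution D' T V₀ V →
      ∑ j, curveNorm T (U j) ≤ M → ∑ j, curveNorm T (V j) ≤ M →
      (∀ k, ∀ t ∈ Icc 0 T, totalVar (U k t) ≤ M) → ∀ t ∈ Icc 0 T,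
      ∑ k, ∫ x, |U k t x - V k t x|
        ≤ ((∑ k, ∫ x, |U₀ k x - V₀ k x|) + C * δ.total) * Real.exp (C * t) := by
  set τ : ℝ≥0 := ⟨T, hT.le⟩
  -- These are the coefficients in `integral_abs_sub_le` once X is expanded: q₁ + q₂ for f, q₁ for
  -- ν, q₂ for gradν, q₃ for Γ and μ, q₄ for η, q₅ for θ, M + q₄ for R, and q₃ + M + q₄ for E. Their
  -- common bound is `Q`.
  obtain ⟨q₁, hq₁⟩ : ∃ q : ℝ≥0, q = M * τ * M := ⟨_, rfl⟩
  obtain ⟨q₂, hq₂⟩ : ∃ q : ℝ≥0, q = M * (M * M * M) * M := ⟨_, rfl⟩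
  obtain ⟨q₃, hq₃⟩ : ∃ q : ℝ≥0,
    q = (M * M * τ * M + M * M * M + M * M * (M * M * M) * M) * (M * M) := ⟨_, rfl⟩
  obtain ⟨q₄, hq₄⟩ : ∃ q : ℝ≥0, q = M * M * M * τ := ⟨_, rfl⟩
  obtain ⟨q₅, hq₅⟩ : ∃ q : ℝ≥0, q = M * M * M := ⟨_, rfl⟩
  obtain ⟨Q, hQ⟩ : ∃ Q : ℝ≥0, Q = q₁ + q₂ + q₃ + q₄ + q₅ + M := ⟨_, rfl⟩
  -- The factor N comes from summing over the components. The summand 1 keeps the constant positive,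
  -- which is needed later to handle infinite distances.
  refine ⟨N * Q + 1, by positivity, ?_⟩
  intro D D' δ U₀ V₀ U V hD hD' hδ hU₀ hV₀ hU hV hSU hSV hTV
  have hwU : ∀ j, L1Curve T (U j) := hU.l1Curve
  have hwV : ∀ j, L1Curve T (V j) := hV.l1Curve
  have hδf := hδ.f_nonneg
  have hδν := hδ.ν_nonneg
  have hδν' := hδ.gradν_nonneg
  have hδΓ := hδ.Γ_nonneg
  have hδμ := hδ.μ_nonneg
  have hδη := hδ.η_nonneg
  have hδθ := hδ.θ_nonneg
  have hδR := hδ.R_nonneg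
  have htot : 0 ≤ δ.total := by unfold CoeffGap.total; positivity
  refine le_mul_exp_of_le_add_integral (by positivity)
    (continuousOn_finsetSum _ fun k _ => ((hwU k).sub (hwV k)).continuousOn_norm) fun t ht => ?_
  have hI : ∫ s in (0 : ℝ)..t, ∑ k, ∫ x, |U k s x - V k s x|
      = ∑ k, curveNorm t fun s x => U k s x - V k s x :=
    intervalIntegral.integral_finsetSum fun k _ =>
      (((hwU k).sub (hwV k)).mono ht.2).intervalIntegrable_norm ht.1
  rw [hI]
  set E := ∑ k, curveNorm t fun s x => U k s x - V k s x with hE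
  have hE0 : 0 ≤ E := Finset.sum_nonneg fun _ _ => curveNorm_nonneg ht.1 _
  have hT0 : (τ : ℝ) = T := rfl
  replace hq₁ := congrArg NNReal.toReal hq₁
  replace hq₂ := congrArg NNReal.toReal hq₂
  replace hq₃ := congrArg NNReal.toReal hq₃
  replace hq₄ := congrArg NNReal.toReal hq₄
  replace hq₅ := congrArg NNReal.toReal hq₅
  replace hQ := congrArg NNReal.toReal hQ
  push_cast at hq₁ hq₂ hq₃ hq₄ hq₅ hQ ⊢
  rw [hT0] at hq₁ hq₃ hq₄
  have p₁ := q₁.coe_nonneg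
  have p₂ := q₂.coe_nonneg
  have p₃ := q₃.coe_nonneg
  have p₄ := q₄.coe_nonneg
  have p₅ := q₅.coe_nonneg
  have p₆ := M.coe_nonneg
  have p₇ := Q.coe_nonneg
  generalize (q₁ : ℝ) = q₁, (q₂ : ℝ) = q₂, (q₃ : ℝ) = q₃, (q₄ : ℝ) = q₄, (q₅ : ℝ) = q₅,
    (Q : ℝ) = Q at *
  have step : ∀ k, ∫ x, |U k t x - V k t x|
      ≤ (∫ x, |U₀ k x - V₀ k x|) + Q * (δ.total + E) := fun k => by
    -- At t = 0 the claim is the initial trace. For t > 0 both solutions are restricted to [0, t],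
    -- where t is the final time.
    rcases ht.1.eq_or_lt with h0 | h0
    · rw [← h0, integral_initial_eq hU hV hT hD hD' hU₀ hV₀]
      exact le_add_of_nonneg_right (mul_nonneg p₇ (add_nonneg htot hE0))
    refine (integral_abs_sub_le (hU.mono ht.2) (hV.mono ht.2) h0 ht.2 hD hD' hδ hU₀ hV₀
      ((sum_curveNorm_mono hwU ht).trans hSU) ((sum_curveNorm_mono hwV ht).trans hSV)
      (fun k s hs => hTV k s ⟨hs.1, hs.2.trans ht.2⟩) hE.symm rfl k).trans
      (add_le_add_right ?_ _)
    calc _ = (q₁ + q₂) * δ.f + q₁ * δ.ν + q₂ * δ.gradν + q₃ * δ.Γ + q₃ * δ.μ + q₄ * δ.η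
          + q₅ * δ.θ + (M + q₄) * δ.R + (q₃ + M + q₄) * E := by
          rw [hq₁, hq₂, hq₃, hq₄, hq₅]; ring
      _ ≤ Q * δ.f + Q * δ.ν + Q * δ.gradν + Q * δ.Γ + Q * δ.μ + Q * δ.η
          + Q * δ.θ + Q * δ.R + Q * E := by
          gcongr <;> linarith
      _ = Q * (δ.total + E) := by unfold CoeffGap.total; ring
  refine (Finset.sum_le_sum fun k _ => step k).trans ?_
  rw [Finset.sum_add_distrib, Finset.sum_const, Finset.card_univ, Fintype.card_fin, nsmul_eq_mul]
  linarith

end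

/-! ### Extended norms and real gaps; uniqueness. -/

section

variable {N : ℕ} {D D' : SystemData N} {T : ℝ} {M : ℝ≥0} {U V : Fin N → ℝ → ℝ → ℝ}
  {U₀ V₀ : Fin N → ℝ → ℝ}

theorem IsEntropySolution.ofReal_sum_curveNorm (hU : IsEntropySolution D T U₀ U) (hT : 0 ≤ T) :
    ENNReal.ofReal (∑ j, curveNorm T (U j)) = spaceTimeNorm T U := by
  rw [ENNReal.ofReal_sum_of_nonneg fun _ _ => curveNorm_nonneg hT _, spaceTimeNorm]
  refine Finset.sum_congr rfl fun j _ => ?_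
  have hm := hU.measurable j
  rw [volume_restrict_QT] at hm
  rw [eLpNorm_one_eq_lintegral_enorm, volume_restrict_QT, lintegral_prod _ hm.enorm, curveNorm,
    ← (hU.l1Curve j).lintegral_norm hT]

theorem IsEntropySolution.sum_curveNorm_le (hU : IsEntropySolution D T U₀ U) (hT : 0 ≤ T)
    (h : spaceTimeNorm T U ≤ M) : ∑ j, curveNorm T (U j) ≤ M := by
  rw [← hU.ofReal_sum_curveNorm hT, ← ENNReal.ofReal_coe_nnreal] at h
  exact (ENNReal.ofReal_le_ofReal_iff M.coe_nonneg).1 h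

theorem totalVar_le_of_supTV_le (h : supTV T U ≤ M) (k : Fin N) {t : ℝ} (ht : t ∈ Icc 0 T) :
    totalVar (U k t) ≤ M :=
  (le_iSup_of_le k (le_iSup₂_of_le (f := fun t (_ : t ∈ Icc 0 T) => totalVar (U k t)) t ht
    le_rfl)).trans h

/-- The distances between the coefficients of two systems, as real numbers. -/
def coeffGap (D D' : SystemData N) : CoeffGap where
  f := (⨆ k, lipR (fun u => D'.f k u - D.f k u)).toReal
  ν := (⨆ k, supNorm (fun w => D'.ν k w - D.ν k w)).toReal
  gradν := (⨆ (k) (j), supNorm (fun w => partialD j (D'.ν k) w - partialD j (D.ν k) w)).toReal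
  Γ := (⨆ (j) (k), eLpNorm (fun s => D'.Γ j k s - D.Γ j k s) (⊤ : ℝ≥0∞) halfLine).toReal
  μ := (⨆ (j) (k), sobolevNorm (fun x => D'.μ j k x - D.μ j k x)).toReal
  η := (∑ j, ∑ k, oneNorm (fun x => D'.η j k x - D.η j k x)).toReal
  θ := (∑ j, ∑ k, eLpNorm (fun s => D'.θ j k s - D.θ j k s) 1 halfLine).toReal
  R := (⨆ k, lipSource (fun a b => D.R k a b - D'.R k a b)).toReal

theorem sum_lintegral_enorm_sub_le {ρ : Measure ℝ} {g g' : Fin N → Fin N → ℝ → ℝ}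
    (h : (∑ j, ∑ k, eLpNorm (fun s => g' j k s - g j k s) 1 ρ) ≠ ⊤) (k : Fin N) :
    ∑ j, ∫⁻ x, ‖g j k x - g' j k x‖ₑ ∂ρ
      ≤ ENNReal.ofReal (∑ j, ∑ k, eLpNorm (fun s => g' j k s - g j k s) 1 ρ).toReal := by
  rw [ENNReal.ofReal_toReal h]
  refine Finset.sum_le_sum fun j _ => ?_
  refine le_trans (le_of_eq ?_) (Finset.single_le_sum
    (f := fun k => eLpNorm (fun s => g' j k s - g j k s) 1 ρ) (fun _ _ => zero_le)
    (Finset.mem_univ k))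
  rw [eLpNorm_one_eq_lintegral_enorm]
  exact lintegral_congr fun x => enorm_sub_rev _ _

/-- Finiteness of the suprema is essential: `ENNReal.toReal` sends ∞ to 0, so only a finite distance
yields a genuine pointwise bound. -/
theorem close_coeffGap (hD : D.Admissible) (hD' : D'.Admissible)
    (h1 : (⨆ k, lipR (fun u => D'.f k u - D.f k u)) ≠ ⊤)
    (h2 : (⨆ k, supNorm (fun w => D'.ν k w - D.ν k w)) ≠ ⊤)
    (h3 : (⨆ (k) (j), supNorm (fun w => partialD j (D'.ν k) w - partialD j (D.ν k) w)) ≠ ⊤)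
    (h4 : (⨆ (j) (k), eLpNorm (fun s => D'.Γ j k s - D.Γ j k s) (⊤ : ℝ≥0∞) halfLine) ≠ ⊤)
    (h5 : (⨆ (j) (k), sobolevNorm (fun x => D'.μ j k x - D.μ j k x)) ≠ ⊤)
    (h6 : (∑ j, ∑ k, oneNorm (fun x => D'.η j k x - D.η j k x)) ≠ ⊤)
    (h7 : (∑ j, ∑ k, eLpNorm (fun s => D'.θ j k s - D.θ j k s) 1 halfLine) ≠ ⊤)
    (h8 : (⨆ k, lipSource (fun a b => D.R k a b - D'.R k a b)) ≠ ⊤) :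
    D.Close D' (coeffGap D D') := by
  have hμ : ∀ j k, supNorm (fun x => D'.μ j k x - D.μ j k x)
      + supNorm (deriv fun x => D'.μ j k x - D.μ j k x) ≤ ENNReal.ofReal (coeffGap D D').μ :=
    fun j k => by
      refine le_trans ?_ (ENNReal.ofReal_toReal h5).ge
      exact le_iSup₂_of_le (f := fun j k => sobolevNorm (fun x => D'.μ j k x - D.μ j k x)) j k le_rfl
  have hp : ∀ {D : SystemData N}, D.Admissible → ∀ k j, Continuous (partialD j (D.ν k)) :=
    fun hD k j =>
      (contDiff_partialD (m := 1) (hD.ν_smooth k) (by norm_num [one_add_one_eq_two]) j).continuous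
  exact
    { f_nonneg := ENNReal.toReal_nonneg
      ν_nonneg := ENNReal.toReal_nonneg
      gradν_nonneg := ENNReal.toReal_nonneg
      Γ_nonneg := ENNReal.toReal_nonneg
      μ_nonneg := ENNReal.toReal_nonneg
      η_nonneg := ENNReal.toReal_nonneg
      θ_nonneg := ENNReal.toReal_nonneg
      R_nonneg := ENNReal.toReal_nonneg
      f_le := fun k x y => by
        have h := abs_sub_le_of_lipR_le (g := fun u => D'.f k u - D.f k u)
          ENNReal.toReal_nonneg (c := (coeffGap D D').f) (by
            refine le_trans ?_ (ENNReal.ofReal_toReal h1).ge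
            exact le_iSup (fun k => lipR (fun u => D'.f k u - D.f k u)) k) x y
        rw [← abs_neg]
        convert h using 2
        ring
      ν_le := fun k w => by
        rw [abs_sub_comm]
        refine abs_le_of_supNorm_le (g := fun w => D'.ν k w - D.ν k w)
          ((hD'.ν_smooth k).continuous.sub (hD.ν_smooth k).continuous) ENNReal.toReal_nonneg ?_ w
        refine le_trans ?_ (ENNReal.ofReal_toReal h2).ge
        exact le_iSup (fun k => supNorm (fun w => D'.ν k w - D.ν k w)) k
      gradν_le := fun k j w => by
        rw [abs_sub_comm]
        refine abs_le_of_supNorm_le (g := fun w => partialD j (D'.ν k) w - partialD j (D.ν k) w)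
          ((hp hD' k j).sub (hp hD k j)) ENNReal.toReal_nonneg ?_ w
        refine le_trans ?_ (ENNReal.ofReal_toReal h3).ge
        exact le_iSup₂_of_le (f := fun k j =>
          supNorm (fun w => partialD j (D'.ν k) w - partialD j (D.ν k) w)) k j le_rfl
      Γ_le := fun j k => by
        have h := ae_abs_le_of_eLpNorm_top_le (μ := halfLine)
          (g := fun s => D'.Γ j k s - D.Γ j k s) ENNReal.toReal_nonneg
          (c := (coeffGap D D').Γ) (by
            refine le_trans ?_ (ENNReal.ofReal_toReal h4).ge
            exact le_iSup₂_of_le (f := fun j k =>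
              eLpNorm (fun s => D'.Γ j k s - D.Γ j k s) (⊤ : ℝ≥0∞) halfLine) j k le_rfl)
        filter_upwards [h] with s hs
        rwa [abs_sub_comm]
      μ_le := fun j k x => by
        rw [abs_sub_comm]
        exact abs_le_of_supNorm_le (g := fun x => D'.μ j k x - D.μ j k x)
          ((hD'.μ_smooth j k).continuous.sub (hD.μ_smooth j k).continuous) ENNReal.toReal_nonneg
          (le_self_add.trans (hμ j k)) x
      derivμ_le := fun j k x => by
        have hd := ((hD'.μ_smooth j k).sub (hD.μ_smooth j k)).continuous_deriv le_rfl
        rw [abs_sub_comm, ← deriv_fun_sub ((hD'.μ_smooth j k).differentiable one_ne_zero x)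
          ((hD.μ_smooth j k).differentiable one_ne_zero x)]
        exact abs_le_of_supNorm_le hd ENNReal.toReal_nonneg (le_add_self.trans (hμ j k)) x
      η_le := sum_lintegral_enorm_sub_le h6
      θ_le := sum_lintegral_enorm_sub_le h7
      R_le := fun k a b => by
        have h := abs_sub_le_of_lipSource_le (G := fun a b => D.R k a b - D'.R k a b)
          ENNReal.toReal_nonneg (c := (coeffGap D D').R) (by
            refine le_trans ?_ (ENNReal.ofReal_toReal h8).ge
            exact le_iSup (fun k => lipSource (fun a b => D.R k a b - D'.R k a b)) k) a b 0 0
        simpa only [hD.R_zero, hD'.R_zero, sub_zero] using h }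

theorem sum_oneNorm_sub_eq {w w' : Fin N → ℝ → ℝ} (hw : ∀ k, Integrable (w k))
    (hw' : ∀ k, Integrable (w' k)) :
    ∑ k, oneNorm (fun x => w k x - w' k x) = ENNReal.ofReal (∑ k, ∫ x, |w k x - w' k x|) := by
  rw [ENNReal.ofReal_sum_of_nonneg fun _ _ => integral_nonneg fun _ => abs_nonneg _]
  exact Finset.sum_congr rfl fun k _ => oneNorm_eq ((hw k).sub (hw' k))

/-- The stability estimate in terms of the weighted distance. -/
theorem exists_weightedDist_bound (N : ℕ) (M : ℝ≥0) {T : ℝ} (hT : 0 < T) :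
    ∃ C : ℝ≥0, ∀ (D D' : SystemData N) (U₀ V₀ : Fin N → ℝ → ℝ) (U V : Fin N → ℝ → ℝ → ℝ),
      D.Admissible → D'.Admissible → D.BoundedBy M → D'.BoundedBy M →
      (∀ k, Integrable (U₀ k)) → (∀ k, Integrable (V₀ k)) →
      IsEntropySolution D T U₀ U → IsEntropySolution D' T V₀ V →
      spaceTimeNorm T U ≤ M → spaceTimeNorm T V ≤ M → supTV T U ≤ M →
      ∀ t ∈ Icc 0 T, ∑ k, oneNorm (fun x => U k t x - V k t x) ≤
        weightedDist C C C C C C C C D D' U₀ V₀ * ENNReal.ofReal (Real.exp (C * t)) := by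
  obtain ⟨C, hC, h⟩ := exists_stability_constant N M hT
  refine ⟨C, fun D D' U₀ V₀ U V hD hD' hM hM' hU₀ hV₀ hU hV hSU hSV hTV t ht => ?_⟩
  by_cases htop : weightedDist C C C C C C C C D D' U₀ V₀ = ⊤
  · rw [htop, ENNReal.top_mul (by simpa using Real.exp_pos _)]
    exact le_top
  -- A positive constant lets finiteness of the weighted distance pass to each single gap; for C = 0
  -- the product 0 · ∞ = 0 would hide an infinite one.
  have hC0 : (C : ℝ≥0∞) ≠ 0 := by simpa using hC.ne'
  have hne : ∀ {a : ℝ≥0∞}, (C : ℝ≥0∞) * a ≠ ⊤ → a ≠ ⊤ := fun h ha => h (by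
    rw [ha, ENNReal.mul_top hC0])
  have hfin := htop
  simp only [weightedDist, ENNReal.add_ne_top, and_assoc] at hfin
  obtain ⟨-, h1, h2, h3, h4, h5, h6, h7, h8⟩ := hfin
  have hclose := close_coeffGap hD hD' (hne h1) (hne h2) (hne h3) (hne h4) (hne h5) (hne h6)
    (hne h7) (hne h8)
  have key := h D D' _ U₀ V₀ U V (hD.pointwiseBounds hM) (hD'.pointwiseBounds hM') hclose hU₀ hV₀
    hU hV (hU.sum_curveNorm_le hT.le hSU) (hV.sum_curveNorm_le hT.le hSV)
    (fun k t ht => totalVar_le_of_supTV_le hTV k ht) t ht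
  rw [sum_oneNorm_sub_eq (w := fun k => U k t) (w' := fun k => V k t)
    (fun k => hU.integrable k t ht) fun k => hV.integrable k t ht]
  refine (ENNReal.ofReal_le_ofReal key).trans_eq ?_
  have hW : 0 ≤ ∑ k, ∫ x, |U₀ k x - V₀ k x| :=
    Finset.sum_nonneg fun _ _ => integral_nonneg fun _ => abs_nonneg _
  have g1 := hclose.f_nonneg
  have g2 := hclose.ν_nonneg
  have g3 := hclose.gradν_nonneg
  have g4 := hclose.Γ_nonneg
  have g5 := hclose.μ_nonneg
  have g6 := hclose.η_nonneg
  have g7 := hclose.θ_nonneg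
  have g8 := hclose.R_nonneg
  rw [ENNReal.ofReal_mul' (Real.exp_pos _).le, weightedDist, sum_oneNorm_sub_eq hU₀ hV₀]
  congr 1
  have e : ∀ {a : ℝ≥0∞}, (C : ℝ≥0∞) * a ≠ ⊤ → (C : ℝ≥0∞) * a = ENNReal.ofReal (C * a.toReal) :=
    fun ha => by
      rw [ENNReal.ofReal_mul C.coe_nonneg, ENNReal.ofReal_coe_nnreal,
        ENNReal.ofReal_toReal (hne ha)]
  rw [e h1, e h2, e h3, e h4, e h5, e h6, e h7, e h8]
  iterate 8 rw [← ENNReal.ofReal_add (by positivity) (by positivity)]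
  congr 1
  simp only [CoeffGap.total, coeffGap]
  ring

theorem eventually_le_coe {a : ℝ≥0∞} (ha : a < ⊤) : ∀ᶠ M : ℝ≥0 in atTop, a ≤ M := by
  filter_upwards [eventually_ge_atTop a.toNNReal] with M hM
  rw [← ENNReal.coe_toNNReal ha.ne]
  exact ENNReal.coe_le_coe.2 hM

theorem lipR_lt_top {g : ℝ → ℝ} (hg : ∃ K, LipschitzWith K g) : lipR g < ⊤ := by
  obtain ⟨K, hK⟩ := hg
  refine lt_of_le_of_lt (iSup₂_le fun x y => ?_) (ENNReal.coe_lt_top (r := K))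
  refine ENNReal.div_le_of_le_mul ?_
  have := hK x y
  rwa [edist_dist, edist_dist, Real.dist_eq, Real.dist_eq] at this

/-- `LipschitzWith` refers to the sup metric on the product, which the 1-norm dominates, so the same
constant works. -/
theorem lipSource_lt_top {G : (Fin N → ℝ) → (Fin N → ℝ) → ℝ}
    (hG : ∃ K, LipschitzWith K (Function.uncurry G)) : lipSource G < ⊤ := by
  obtain ⟨K, hK⟩ := hG
  refine lt_of_le_of_lt (iSup₂_le fun a b => iSup₂_le fun a' b' => ?_)
    (ENNReal.coe_lt_top (r := K))
  refine ENNReal.div_le_of_le_mul ?_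
  have h := hK.dist_le_mul (a, b) (a', b')
  have hn : ∀ x y : Fin N → ℝ, dist x y ≤ norm1 (x - y) := fun x y => by
    refine (dist_pi_le_iff (norm1_nonneg _)).2 fun j => ?_
    rw [Real.dist_eq]
    exact Finset.single_le_sum (f := fun j => |(x - y) j|) (fun _ _ => abs_nonneg _)
      (Finset.mem_univ j)
  have hd : dist (a, b) (a', b') ≤ norm1 (a - a') + norm1 (b - b') := by
    rw [Prod.dist_eq]
    exact max_le ((hn a a').trans (le_add_of_nonneg_right (norm1_nonneg _)))
      ((hn b b').trans (le_add_of_nonneg_left (norm1_nonneg _)))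
  rw [← ENNReal.ofReal_coe_nnreal, ← ENNReal.ofReal_mul K.coe_nonneg]
  exact ENNReal.ofReal_le_ofReal (h.trans (mul_le_mul_of_nonneg_left hd K.coe_nonneg))

/-- Formulating the bounds for all large M allows finitely many of them to be met by one M. -/
theorem SystemData.Admissible.eventually_boundedBy (hD : D.Admissible) :
    ∀ᶠ M : ℝ≥0 in atTop, D.BoundedBy M := by
  filter_upwards [eventually_all.2 fun k => eventually_le_coe (lipR_lt_top (hD.f_lip k)),
    eventually_all.2 fun k => eventually_le_coe (hD.ν_bdd k),
    eventually_all.2 fun k => eventually_all.2 fun j => eventually_le_coe (hD.ν_grad_bdd k j),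
    eventually_all.2 fun k => eventually_all.2 fun i => eventually_all.2 fun j =>
      eventually_le_coe (hD.ν_hess_bdd k i j),
    eventually_all.2 fun j => eventually_all.2 fun k => eventually_le_coe (hD.μ_sobolev j k),
    eventually_all.2 fun j => eventually_all.2 fun k => eventually_le_coe (hD.Γ_bdd j k).2,
    eventually_all.2 fun j => eventually_all.2 fun k =>
      eventually_le_coe (memLp_one_iff_integrable.2 (hD.η_integrable j k)).2,
    eventually_all.2 fun j => eventually_all.2 fun k => eventually_le_coe (hD.θ_bdd j k).2,
    eventually_all.2 fun k => eventually_le_coe (lipSource_lt_top (hD.R_lip k))]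
    with M h1 h2 h3 h4 h5 h6 h7 h8 h9
  exact ⟨h1, h2, h3, h4, h5, h6, h7, h8, h9⟩

/-- Entropy solutions are determined by their initial data. -/
theorem IsEntropySolution.ae_eq (hU : IsEntropySolution D T U₀ U)
    (hV : IsEntropySolution D T U₀ V) (hT : 0 < T) (hD : D.Admissible)
    (hU₀ : ∀ k, Integrable (U₀ k)) {t : ℝ} (ht : t ∈ Icc 0 T) (k : Fin N) :
    U k t =ᵐ[volume] V k t := by
  choose B hB using hU.bv
  -- An entropy solution has bounded variation only for almost every t. Lower semicontinuity along
  -- the L¹ curve gives the same bound at every t.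
  have hTV : ∀ᶠ M : ℝ≥0 in atTop, ∀ k, ∀ t ∈ Icc 0 T, totalVar (U k t) ≤ M := by
    filter_upwards [eventually_all.2 fun k => eventually_ge_atTop (B k)] with M hM k t ht
    exact ((hU.l1Curve k).totalVar_le hT (hB k) t ht).trans (ENNReal.coe_le_coe.2 (hM k))
  obtain ⟨M, hM, hTV, hSU, hSV⟩ := (hD.eventually_boundedBy.and (hTV.and
    ((eventually_le_coe (ENNReal.ofReal_lt_top.trans_le'
      (hU.ofReal_sum_curveNorm hT.le).ge)).and
      (eventually_le_coe (ENNReal.ofReal_lt_top.trans_le'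
      (hV.ofReal_sum_curveNorm hT.le).ge))))).exists
  obtain ⟨C, -, h⟩ := exists_stability_constant N M hT
  have hP := hD.pointwiseBounds hM
  have hclose : D.Close D ⟨0, 0, 0, 0, 0, 0, 0, 0⟩ := by constructor <;> simp
  have key := h D D _ U₀ U₀ U V hP hP hclose hU₀ hU₀ hU hV (hU.sum_curveNorm_le hT.le hSU)
    (hV.sum_curveNorm_le hT.le hSV) hTV t ht
  simp only [CoeffGap.total, sub_self, abs_zero, integral_zero, Finset.sum_const_zero, add_zero,
    mul_zero, zero_mul] at key
  have hk : ∫ x, |U k t x - V k t x| = 0 := le_antisymm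
    ((Finset.single_le_sum (f := fun k => ∫ x, |U k t x - V k t x|)
      (fun _ _ => integral_nonneg fun _ => abs_nonneg _) (Finset.mem_univ k)).trans key)
    (integral_nonneg fun _ => abs_nonneg _)
  have h0 := (integral_eq_zero_iff_of_nonneg (f := fun x => |U k t x - V k t x|)
    (fun _ => abs_nonneg _) ((hU.integrable k t ht).sub (hV.integrable k t ht)).abs).1 hk
  filter_upwards [h0] with x hx
  exact sub_eq_zero.1 (abs_eq_zero.1 hx)

end

end NonlocalMemory

end

theorem theorem3p1 (N : ℕ) (T : ℝ) (hT : 0 < T) :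
    (∀ M : ℝ≥0, ∃ C₁ C₂ C₃ C₄ C₅ C₆ C₇ C₈ C₉ : ℝ≥0,
      ∀ (D D' : SystemData N) (U₀ V₀ : Fin N → ℝ → ℝ) (U V : Fin N → ℝ → ℝ → ℝ),
        D.Admissible → D'.Admissible →
        D.BoundedBy M → D'.BoundedBy M →
        (∀ k, Integrable (U₀ k)) → (∀ k, Integrable (V₀ k)) →
        IsEntropySolution D T U₀ U → IsEntropySolution D' T V₀ V →
        spaceTimeNorm T U ≤ M → spaceTimeNorm T V ≤ M → supTV T U ≤ M →
        ∀ t ∈ Icc 0 T,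
          ∑ k, oneNorm (fun x => U k t x - V k t x) ≤
            weightedDist C₁ C₂ C₃ C₄ C₅ C₆ C₇ C₈ D D' U₀ V₀
              * ENNReal.ofReal (Real.exp (C₉ * t))) ∧
    (∀ (D : SystemData N) (U₀ : Fin N → ℝ → ℝ) (U V : Fin N → ℝ → ℝ → ℝ),
        D.Admissible → (∀ k, Integrable (U₀ k)) →
        IsEntropySolution D T U₀ U → IsEntropySolution D T U₀ V →
        ∀ t ∈ Icc 0 T, ∀ k, U k t =ᵐ[volume] V k t) := by
  refine ⟨fun M => ?_, fun D U₀ U V hD hU₀ hU hV t ht k => hU.ae_eq hV hT hD hU₀ ht k⟩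
  obtain ⟨C, hC⟩ := exists_weightedDist_bound N M hT
  -- One constant serves as all the weights and as the exponential rate.
  exact ⟨C, C, C, C, C, C, C, C, C, hC⟩
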